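/- Call a signed Borel measure on $[1,\infty)$ that is finite on bounded sets (its total variation may be infinite) a signed Lebesgue–Stieltjes measure; $|dA|$ denotes its variation measure. Let $dA*dB$ be the multiplicative convolution, $\int_{[1,x]}dA*dB=\iint_{1\le uv\le x}dA(u)\,dB(v)$, and $\exp^{*}(dA)=\sum_{n\ge 0}\frac1{n!}\,dA^{*n}$ with $dA^{*0}=\delta_1$. For such a measure $d\Pi$ set $M_\Pi(x)=\int_{[1,x]}\exp^{*}(-d\Pi)$. All asymptotic relations are as $x\to\infty$. (1) Suppose $d\Pi=d\Pi_0+dE+dR$ with signed Lebesgue–Stieltjes measures $d\Pi$, $d\Pi_0$, $dE$, $dR$ such that $$M_{\Pi_0}(x)=O\!\left(\frac{x}{\log^{a}x}\right)\ \text{for some } a>0,\qquad \int_{[1,x]}|dE|=o\!\left(\frac{x}{\log x}\right),\qquad \int_{[1,\infty)}\frac{|dR(u)|}{u}<\infty .$$ Then $M_\Pi(x)=o(x)$. (2) Let $\Pi_0$ be either Riemann's counting function of the rational primes, $\Pi_0(x)=\sum_{p^k\le x}\frac1k$, or the normalized logarithmic integral, $\Pi_0(x)=\int_1^x\frac{1-u^{-1}}{\log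 u}\,du$. Suppose $d\Pi=d\Pi_0+dE$, where $E$ is monotone (that is, $dE$ or $-dE$ is a non-negative Lebesgue–Stieltjes measure on $[1,\infty)$), and that the prime number theorem $\Pi(x)=\int_{[1,x]}d\Pi\sim x/\log x$ holds. Then $M_\Pi(x)=o(x)$. -/

import Mathlib

open MeasureTheory Filter Set Asymptotics
open scoped ENNReal Nat Topology

noncomputable section

/-- A signed Lebesgue-Stieltjes measure on `[1, ∞)`: a signed Borel measure that is finite on every
bounded interval (its total variation may be infinite), given by its Jordan decomposition
`pos - neg`. It is regarded as a measure on `ℝ` that is concentrated on `[1, ∞)`. -/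
structure LSMeasure where
  /-- the positive part -/
  pos : Measure ℝ
  /-- the negative part -/
  neg : Measure ℝ
  locFin_pos : IsLocallyFiniteMeasure pos
  locFin_neg : IsLocallyFiniteMeasure neg
  pos_Iio : pos (Iio 1) = 0
  neg_Iio : neg (Iio 1) = 0
  mutuallySingular : pos ⟂ₘ neg

namespace LSMeasure

/-- The value of the signed measure on a bounded Borel set. -/
def val (A : LSMeasure) (s : Set ℝ) : ℝ := A.pos.real s - A.neg.real s

/-- The primitive `A(x) = ∫_{[1,x]} dA`. -/
def primitive (A : LSMeasure) (x : ℝ) : ℝ := A.val (Icc 1 x)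

/-- The variation measure `|dA|`. -/
def variation (A : LSMeasure) : Measure ℝ := A.pos + A.neg

/-- The measure `-dA`. -/
instance : Neg LSMeasure where
  neg A := ⟨A.neg, A.pos, A.locFin_neg, A.locFin_pos, A.neg_Iio, A.pos_Iio, A.mutuallySingular.symm⟩

/-- `dA = dB + dC`, as signed measures. -/
def IsSum (A B C : LSMeasure) : Prop :=
  ∀ s : Set ℝ, MeasurableSet s → Bornology.IsBounded s → A.val s = B.val s + C.val s

/-- `dA = dB + dC + dD`, as signed measures. -/
def IsSum₃ (A B C D : LSMeasure) : Prop :=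
  ∀ s : Set ℝ, MeasurableSet s → Bornology.IsBounded s → A.val s = B.val s + C.val s + D.val s

/-- A positive measure, regarded as a signed one. -/
def ofMeasure (μ : Measure ℝ) (h : IsLocallyFiniteMeasure μ) (h1 : μ (Iio 1) = 0) : LSMeasure :=
  ⟨μ, 0, h, inferInstance, h1, by simp, Measure.MutuallySingular.zero_right⟩

/-- Multiplicative convolution of signed measures that are written as differences: the pair `(p, q)`
stands for `p - q`, and `mconv` is the multiplicative convolution of positive measures. -/
def convPair (a b : Measure ℝ × Measure ℝ) : Measure ℝ × Measure ℝ :=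
  (a.1.mconv b.1 + a.2.mconv b.2, a.1.mconv b.2 + a.2.mconv b.1)

/-- The convolution power `dA^{*n}`, as a difference of positive measures; `dA^{*0} = δ₁`. -/
def convPow (A : LSMeasure) : ℕ → Measure ℝ × Measure ℝ
  | 0 => (Measure.dirac 1, 0)
  | n + 1 => convPair (A.convPow n) (A.pos, A.neg)

/-- The convolution exponential `exp*(dA) = ∑ (1/n!) dA^{*n}`, as a difference of positive
measures. Both of them are finite on bounded sets. -/
def expConv (A : LSMeasure) : Measure ℝ × Measure ℝ :=
  (Measure.sum fun n => ((n ! : ℝ≥0∞)⁻¹) • (A.convPow n).1,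
   Measure.sum fun n => ((n ! : ℝ≥0∞)⁻¹) • (A.convPow n).2)

/-- `∫_{[1,x]} exp*(dA)`. -/
def expPrimitive (A : LSMeasure) (x : ℝ) : ℝ :=
  A.expConv.1.real (Icc 1 x) - A.expConv.2.real (Icc 1 x)

/-- The sum function of the Möbius function of the prime measure `dP`:
`M(x) = ∫_{[1,x]} exp*(-dP)`. -/
def mobiusSum (P : LSMeasure) (x : ℝ) : ℝ := (-P).expPrimitive x

end LSMeasure

/-- The measure that has mass `1/k` at each power `p ^ k` of a rational prime (`k ≥ 1`); the index
`(p, j)` stands for `p ^ (j + 1)`. -/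
def classicalPrimeMeasure : Measure ℝ :=
  Measure.sum fun i : Nat.Primes × ℕ =>
    ((i.2 + 1 : ℕ) : ℝ≥0∞)⁻¹ • Measure.dirac (((i.1 : ℕ) : ℝ) ^ (i.2 + 1))

/-- The measure `(1 - u⁻¹) du / log u` on `(1, ∞)`. -/
def logIntegralMeasure : Measure ℝ :=
  (volume.restrict (Ioi 1)).withDensity fun u => ENNReal.ofReal ((1 - u⁻¹) / Real.log u)

theorem classicalPrimeMeasure_Iio : classicalPrimeMeasure (Iio 1) = 0 := by
  rw [classicalPrimeMeasure, Measure.sum_apply _ measurableSet_Iio]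
  refine ENNReal.tsum_eq_zero.2 fun i => ?_
  have h : (1 : ℝ) ≤ ((i.1 : ℕ) : ℝ) ^ (i.2 + 1) :=
    one_le_pow₀ (by exact_mod_cast i.1.2.one_lt.le)
  rw [Measure.smul_apply, Measure.dirac_apply' _ measurableSet_Iio]
  simp [h]

theorem classicalPrimeMeasure_Iio_lt_top (N : ℕ) : classicalPrimeMeasure (Iio (N : ℝ)) < ∞ := by
  classical
  rw [classicalPrimeMeasure, Measure.sum_apply _ measurableSet_Iio]
  have hfin : {i : Nat.Primes × ℕ | (i.1 : ℕ) ^ (i.2 + 1) < N}.Finite := by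
    refine Set.Finite.subset (s := (Subtype.val ⁻¹' Iio N : Set Nat.Primes) ×ˢ Iio N)
      (((finite_Iio N).preimage Subtype.val_injective.injOn).prod (finite_Iio N)) ?_
    rintro ⟨p, k⟩ h
    have h : (p : ℕ) ^ (k + 1) < N := h
    have h1 : (p : ℕ) ≤ (p : ℕ) ^ (k + 1) := Nat.le_self_pow (by omega) _
    have h2 : k + 1 < (p : ℕ) ^ (k + 1) := Nat.lt_pow_self p.2.one_lt
    exact ⟨show (p : ℕ) < N by omega, show k < N by omega⟩
  rw [tsum_eq_sum (s := hfin.toFinset)]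
  · refine ENNReal.sum_lt_top.2 fun i _ => ?_
    rw [Measure.smul_apply, smul_eq_mul]
    exact ENNReal.mul_lt_top (by simp) (measure_lt_top _ _)
  · intro i hi
    have h : (N : ℝ) ≤ ((i.1 : ℕ) : ℝ) ^ (i.2 + 1) := by
      have : N ≤ (i.1 : ℕ) ^ (i.2 + 1) := by simpa using hi
      exact_mod_cast this
    rw [Measure.smul_apply, Measure.dirac_apply' _ measurableSet_Iio]
    simp [h]

theorem classicalPrimeMeasure_locFin : IsLocallyFiniteMeasure classicalPrimeMeasure := by
  refine ⟨fun x => ?_⟩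
  obtain ⟨N, hN⟩ := exists_nat_gt x
  exact ⟨Iio (N : ℝ), Iio_mem_nhds hN, classicalPrimeMeasure_Iio_lt_top N⟩

theorem logIntegralMeasure_Iio : logIntegralMeasure (Iio 1) = 0 := by
  refine withDensity_absolutelyContinuous _ _ ?_
  rw [Measure.restrict_apply measurableSet_Iio, (disjoint_left.2 fun x h1 h2 => lt_asymm (a := x)
    (b := 1) h1 h2 : Disjoint (Iio (1 : ℝ)) (Ioi 1)).inter_eq, measure_empty]

theorem logIntegralMeasure_le : logIntegralMeasure ≤ volume := by
  calc logIntegralMeasure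
      ≤ (volume.restrict (Ioi 1)).withDensity 1 := by
        refine withDensity_mono ?_
        filter_upwards [ae_restrict_mem measurableSet_Ioi] with u hu
        have hu : (1 : ℝ) < u := hu
        have h : 1 - u⁻¹ ≤ Real.log u := Real.one_sub_inv_le_log_of_pos (by linarith)
        simpa using div_le_one_of_le₀ h (Real.log_pos hu).le
    _ ≤ volume := by
        rw [withDensity_one]
        exact Measure.restrict_le_self

theorem logIntegralMeasure_locFin : IsLocallyFiniteMeasure logIntegralMeasure :=
  Measure.isLocallyFiniteMeasure_of_le logIntegralMeasure_le

/-- Riemann's prime counting measure `dΠ₀`, with `Π₀(x) = ∑_{p^k ≤ x} 1/k`. -/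
def classicalPrimes : LSMeasure :=
  .ofMeasure classicalPrimeMeasure classicalPrimeMeasure_locFin classicalPrimeMeasure_Iio

/-- The normalized logarithmic integral `dΠ₀`, with `Π₀(x) = ∫_1^x (1 - u⁻¹) du / log u`. -/
def logIntegral : LSMeasure :=
  .ofMeasure logIntegralMeasure logIntegralMeasure_locFin logIntegralMeasure_Iio

end

/-!
Write `dP = dP₀ + dE + dR`. Convolution exponentials turn sums into convolutions, so that
`M_P` is the primitive of `exp*(-dP₀) * exp*(-dE) * exp*(-dR)`, and
`|M_P(x)| ≤ ∬ |M_{P₀}(x / (v w))| d exp*(|dE|)(v) d exp*(|dR|)(w)` (`LSMeasure.enorm_mobiusSum_le`).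
Such identities between signed measures are checked on Mellin transforms on the line `Re s = 2`:
the transform takes `exp*` to `exp`, and it determines a measure since, after the substitution
`u = exp y`, it is a characteristic function. As only `[1, x]` matters, all measures may be
truncated, and convergence is no issue.

The factor `exp*(|dR|)` has a finite integral of `1 / w`, and dominated convergence removes it. For the
factor `exp*(|dE|)`, suppose that `∫_{[1,y]} |dE(u)| / u = o(log log y)` and that
`∫_{[1,y]} log u |dE(u)| = O(y)`. For `v ≤ √y` the bound `M_{P₀}(y / v) = O(y / (v log ^ a y))` holds, and
`∫_{[1,y]} d exp*(|dE|)(v) / v ≤ exp (∫_{[1,y]} |dE(u)| / u) = log ^ {o(1)} y`. For `v > √y` a factor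
`2 log v / log y ≥ 1` is inserted, and `log · exp*(dν) = (log · dν) * exp*(dν)` moves the logarithm
to `|dE|`, where the second hypothesis applies on dyadic intervals. Both parts are
`O(y log ^ {-a + o(1)} y)`. This is `LSMeasure.mobiusSum_isLittleO_of_isSum₃`.

If `∫_{[1,x]} |dE| = o(x / log x)`, the two hypotheses on `dE` follow from Abelian estimates. If `E` is
monotone and `P` satisfies the prime number theorem, then `|dE|` is `± (dP - dP₀)`; it has a Chebyshev
bound, and `∫ u ^ (-1-δ) |dE(u)| = o(log (1 / δ))` since the transforms of `dP₀` and of the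
logarithmic integral are `log (1 / δ) + O(1)`. By Rankin's trick `∫_{[1,y]} |dE(u)| / u = o(log log y)`.
What is needed about the reference measure is collected in `LSMeasure.IsReference`.

It remains to bound `M_{P₀}` for the two reference measures. For the logarithmic integral the
transform of `exp*(-dP₀)` is `1 - 1 / s`, so that `M_{P₀}(x) = 1 - log x`. For the rational primes
`exp*(-dP₀) = ∑ μ(n) δ_n`, and a bound `∑_{n ≤ x} μ(n) = O(x / log ^ a x)` with some `a > 0` is required
(`sum_moebius_isBigO`, with `a = 1 / 2`). Comparison of sums with integrals bounds `ζ` and `ζ'` by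
`|t| ^ (1 / 10)` to the right of the line `Re s = 1`; the inequality
`ζ(σ)³ |ζ(σ + it)|⁴ |ζ(σ + 2it)| ≥ 1` then bounds `ζ' / ζ²`, the Dirichlet series of `μ(n) log n`, by
`|t| ^ (9 / 10)`. A Perron formula with the weight `1 - n / x`, whose transform `1 / (s (s + 1))` makes
the integral converge, gives `∑ μ(n) log n (1 - n / x) = O(x)`, and the two weights are removed by
elementary means.
-/

noncomputable section

/-! ### Measures on `[1, ∞)` and multiplicative convolution -/

theorem mconv_Iio_one {μ ν : Measure ℝ} [SFinite ν] (hμ : μ (Iio 1) = 0) (hν : ν (Iio 1) = 0) :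
    (μ.mconv ν) (Iio 1) = 0 := by
  rw [← lintegral_indicator_one measurableSet_Iio, Measure.lintegral_mconv (by measurability),
    lintegral_eq_zero_iff' (by
      refine Measurable.aemeasurable ?_
      exact Measurable.lintegral_prod_right' (f := fun p : ℝ × ℝ =>
        (Iio (1 : ℝ)).indicator (1 : ℝ → ℝ≥0∞) (p.1 * p.2))
        ((measurable_one.indicator measurableSet_Iio).comp measurable_mul))]
  have h1 : ∀ᵐ u ∂μ, 1 ≤ u := by rw [ae_iff]; simpa [not_le, Iio_def] using hμ
  have h2 : ∀ᵐ u ∂ν, 1 ≤ u := by rw [ae_iff]; simpa [not_le, Iio_def] using hν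
  filter_upwards [h1] with u hu
  rw [lintegral_congr_ae (g := fun _ => 0), lintegral_zero, Pi.zero_apply]
  filter_upwards [h2] with v hv
  simp only [indicator, mem_Iio, ite_eq_right_iff]
  intro h
  nlinarith

theorem ae_one_le {μ : Measure ℝ} (hμ : μ (Iio 1) = 0) : ∀ᵐ u ∂μ, 1 ≤ u := by
  rw [ae_iff]; simpa [not_le, Iio_def] using hμ

/-- For measures on `[1, ∞)`, the convolution on `[1, X]` only sees the two factors on `[1, X]`. -/
theorem restrict_mconv {μ ν : Measure ℝ} [SFinite μ] [SFinite ν] (hμ : μ (Iio 1) = 0)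
    (hν : ν (Iio 1) = 0) (X : ℝ) :
    (μ.mconv ν).restrict (Iic X)
      = ((μ.restrict (Iic X)).mconv (ν.restrict (Iic X))).restrict (Iic X) := by
  have hm : Measurable fun x : ℝ × ℝ => x.1 * x.2 := measurable_mul
  rw [Measure.mconv, Measure.mconv, Measure.restrict_map hm measurableSet_Iic,
    Measure.restrict_map hm measurableSet_Iic, Measure.prod_restrict,
    Measure.restrict_restrict (hm measurableSet_Iic)]
  congr 1
  refine Measure.restrict_congr_set ?_
  have h1 : ∀ᵐ p ∂(μ.prod ν), 1 ≤ p.1 :=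
    Measure.quasiMeasurePreserving_fst.ae (ae_one_le hμ)
  have h2 : ∀ᵐ p ∂(μ.prod ν), 1 ≤ p.2 :=
    Measure.quasiMeasurePreserving_snd.ae (ae_one_le hν)
  filter_upwards [h1, h2] with p hp1 hp2
  refine propext ⟨fun h => ⟨h, ?_⟩, fun h => h.1⟩
  have h : p.1 * p.2 ≤ X := h
  constructor
  · show p.1 ≤ X
    nlinarith
  · show p.2 ≤ X
    nlinarith

/-- The convolution powers of a positive measure. -/
def totPow (ν : Measure ℝ) : ℕ → Measure ℝ
  | 0 => Measure.dirac 1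
  | n + 1 => (totPow ν n).mconv ν

/-- The convolution exponential of a positive measure. -/
def expTotal (ν : Measure ℝ) : Measure ℝ :=
  Measure.sum fun n => ((n ! : ℝ≥0∞)⁻¹) • totPow ν n

instance sFinite_totPow (ν : Measure ℝ) [SFinite ν] (n : ℕ) : SFinite (totPow ν n) := by
  induction n with
  | zero => rw [totPow]; infer_instance
  | succ n ih => rw [totPow]; infer_instance

instance sFinite_expTotal (ν : Measure ℝ) [SFinite ν] : SFinite (expTotal ν) := by
  unfold expTotal; infer_instance

theorem lintegral_expTotal (ν : Measure ℝ) (f : ℝ → ℝ≥0∞) :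
    ∫⁻ u, f u ∂(expTotal ν) = ∑' n : ℕ, (n ! : ℝ≥0∞)⁻¹ * ∫⁻ u, f u ∂(totPow ν n) := by
  rw [expTotal, lintegral_sum_measure]
  simp only [lintegral_smul_measure, smul_eq_mul]

theorem totPow_Iio {ν : Measure ℝ} [SFinite ν] (hν : ν (Iio 1) = 0) (n : ℕ) :
    totPow ν n (Iio 1) = 0 := by
  induction n with
  | zero => rw [totPow, Measure.dirac_apply' _ measurableSet_Iio]; simp
  | succ n ih => exact mconv_Iio_one ih hν

theorem expTotal_Iio {ν : Measure ℝ} [SFinite ν] (hν : ν (Iio 1) = 0) :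
    expTotal ν (Iio 1) = 0 := by
  rw [expTotal, Measure.sum_apply _ measurableSet_Iio]
  simp [totPow_Iio hν]

theorem totPow_mono {μ ν : Measure ℝ} [SFinite μ] [SFinite ν] (h : μ ≤ ν) (n : ℕ) :
    totPow μ n ≤ totPow ν n := by
  induction n with
  | zero => exact le_rfl
  | succ n ih => exact Measure.map_mono (Measure.prod_mono ih h) measurable_mul

theorem expTotal_mono {μ ν : Measure ℝ} [SFinite μ] [SFinite ν] (h : μ ≤ ν) :
    expTotal μ ≤ expTotal ν := by
  refine Measure.le_iff.2 fun s hs => ?_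
  rw [expTotal, expTotal, Measure.sum_apply _ hs, Measure.sum_apply _ hs]
  refine ENNReal.tsum_le_tsum fun n => ?_
  simp only [Measure.smul_apply, smul_eq_mul]
  gcongr
  exact totPow_mono h n

/-- The exponential series in `ℝ≥0∞`. -/
theorem tsum_inv_factorial_mul_pow {c : ℝ≥0∞} (hc : c ≠ ∞) :
    ∑' n : ℕ, (n ! : ℝ≥0∞)⁻¹ * c ^ n = ENNReal.ofReal (Real.exp c.toReal) := by
  have h : ∀ n : ℕ, (n ! : ℝ≥0∞)⁻¹ * c ^ n = ENNReal.ofReal ((n ! : ℝ)⁻¹ * c.toReal ^ n) := by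
    intro n
    rw [ENNReal.ofReal_mul (by positivity), ENNReal.ofReal_pow (by positivity),
      ENNReal.ofReal_toReal hc, ENNReal.ofReal_inv_of_pos (by positivity), ENNReal.ofReal_natCast]
  simp_rw [h]
  have hs := NormedSpace.expSeries_hasSum_exp (𝕂 := ℝ) c.toReal
  rw [← ENNReal.ofReal_tsum_of_nonneg (fun n => by positivity)]
  · rw [Real.exp_eq_exp_ℝ, NormedSpace.exp_eq_tsum ℝ]; simp [smul_eq_mul]
  · simpa [div_eq_inv_mul] using Real.summable_pow_div_factorial c.toReal

/-- Rankin-type bound: for a weight `w` with `w (u * v) ≤ w u * w v`, the `w`-mass of the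
convolution exponential is at most the exponential of the `w`-mass. -/
theorem lintegral_expTotal_le {ν : Measure ℝ} [SFinite ν] (hν : ν (Iio 1) = 0) {w : ℝ → ℝ≥0∞}
    (hw : Measurable w) (h1 : w 1 ≤ 1) (hmul : ∀ u v, 1 ≤ u → 1 ≤ v → w (u * v) ≤ w u * w v)
    (hfin : ∫⁻ u, w u ∂ν ≠ ∞) :
    ∫⁻ u, w u ∂(expTotal ν) ≤ ENNReal.ofReal (Real.exp (∫⁻ u, w u ∂ν).toReal) := by
  have key : ∀ n, ∫⁻ u, w u ∂(totPow ν n) ≤ (∫⁻ u, w u ∂ν) ^ n := by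
    intro n
    induction n with
    | zero => rw [totPow, lintegral_dirac' _ hw]; simpa
    | succ n ih =>
      rw [totPow, Measure.lintegral_mconv hw, pow_succ]
      calc ∫⁻ u, ∫⁻ v, w (u * v) ∂ν ∂(totPow ν n)
          ≤ ∫⁻ u, ∫⁻ v, w u * w v ∂ν ∂(totPow ν n) := by
            refine lintegral_mono_ae ?_
            filter_upwards [ae_one_le (totPow_Iio hν n)] with u hu
            refine lintegral_mono_ae ?_
            filter_upwards [ae_one_le hν] with v hv
            exact hmul u v hu hv
        _ = (∫⁻ u, w u ∂(totPow ν n)) * ∫⁻ v, w v ∂ν := by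
            simp_rw [lintegral_const_mul _ hw]
            rw [lintegral_mul_const _ hw]
        _ ≤ _ := by gcongr
  rw [lintegral_expTotal, ← tsum_inv_factorial_mul_pow hfin]
  exact ENNReal.tsum_le_tsum fun n => by gcongr; exact key n

/-- The logarithm acts as a derivation on convolution powers. -/
theorem lintegral_totPow_mul_log {ν : Measure ℝ} [SFinite ν] (hν : ν (Iio 1) = 0) (n : ℕ)
    {f : ℝ → ℝ≥0∞} (hf : Measurable f) :
    ∫⁻ u, f u * ENNReal.ofReal (Real.log u) ∂(totPow ν (n + 1))
      = (n + 1 : ℕ) * ∫⁻ u, ∫⁻ v, f (u * v) * ENNReal.ofReal (Real.log v) ∂ν ∂(totPow ν n) := by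
  have hl : Measurable fun u : ℝ => ENNReal.ofReal (Real.log u) :=
    Real.measurable_log.ennreal_ofReal
  have hsplit : ∀ (n : ℕ) {f : ℝ → ℝ≥0∞}, Measurable f →
      ∫⁻ u, f u * ENNReal.ofReal (Real.log u) ∂(totPow ν (n + 1))
      = (∫⁻ v, ∫⁻ u, f (u * v) * ENNReal.ofReal (Real.log u) ∂(totPow ν n) ∂ν)
        + ∫⁻ u, ∫⁻ v, f (u * v) * ENNReal.ofReal (Real.log v) ∂ν ∂(totPow ν n) := by
    intro n f hf
    rw [totPow, Measure.lintegral_mconv (by fun_prop), lintegral_lintegral_swap (μ := ν)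
      (f := fun v u => f (u * v) * ENNReal.ofReal (Real.log u)) (by
        refine Measurable.aemeasurable ?_
        exact (hf.comp (measurable_snd.mul measurable_fst)).mul (hl.comp measurable_snd)),
      ← lintegral_add_left]
    · refine lintegral_congr_ae ?_
      filter_upwards [ae_one_le (totPow_Iio hν n)] with u hu
      rw [← lintegral_add_left (by fun_prop)]
      refine lintegral_congr_ae ?_
      filter_upwards [ae_one_le hν] with v hv
      rw [Real.log_mul (by positivity) (by positivity),
        ENNReal.ofReal_add (Real.log_nonneg hu) (Real.log_nonneg hv), mul_add]
    · exact Measurable.lintegral_prod_right' (f := fun p : ℝ × ℝ =>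
        f (p.1 * p.2) * ENNReal.ofReal (Real.log p.1))
        ((hf.comp measurable_mul).mul (hl.comp measurable_fst))
  induction n generalizing f with
  | zero =>
    rw [hsplit 0 hf]
    have : ∀ v, ∫⁻ u, f (u * v) * ENNReal.ofReal (Real.log u) ∂(totPow ν 0) = 0 := fun v => by
      rw [totPow, lintegral_dirac]; simp
    simp [this]
  | succ n ih =>
    rw [hsplit (n + 1) hf]
    have h1 : ∀ v, ∫⁻ u, f (u * v) * ENNReal.ofReal (Real.log u) ∂(totPow ν (n + 1))
        = (n + 1 : ℕ) * ∫⁻ u, ∫⁻ v', f (u * v' * v) * ENNReal.ofReal (Real.log v') ∂ν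
          ∂(totPow ν n) := fun v => ih (hf.comp (measurable_id.mul_const v))
    simp_rw [h1]
    have hm3 : Measurable fun p : ℝ × ℝ × ℝ =>
        f (p.2.1 * p.2.2 * p.1) * ENNReal.ofReal (Real.log p.2.2) :=
      (hf.comp (((measurable_fst.comp measurable_snd).mul
        (measurable_snd.comp measurable_snd)).mul measurable_fst)).mul
        (hl.comp (measurable_snd.comp measurable_snd))
    rw [lintegral_const_mul]
    · have h2 : ∫⁻ v, ∫⁻ u, ∫⁻ v', f (u * v' * v) * ENNReal.ofReal (Real.log v') ∂ν
            ∂(totPow ν n) ∂ν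
          = ∫⁻ u, ∫⁻ v, f (u * v) * ENNReal.ofReal (Real.log v) ∂ν ∂(totPow ν (n + 1)) := by
        rw [totPow, Measure.lintegral_mconv]
        · rw [lintegral_lintegral_swap]
          · refine lintegral_congr fun u => ?_
            refine lintegral_congr fun v => ?_
            refine lintegral_congr fun v' => ?_
            rw [mul_right_comm]
          · refine Measurable.aemeasurable ?_
            exact Measurable.lintegral_prod_right' (f := fun p : (ℝ × ℝ) × ℝ =>
              f (p.1.2 * p.2 * p.1.1) * ENNReal.ofReal (Real.log p.2))
              (hm3.comp ((measurable_fst.comp measurable_fst).prodMk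
                ((measurable_snd.comp measurable_fst).prodMk measurable_snd)))
        · exact Measurable.lintegral_prod_right' (f := fun p : ℝ × ℝ =>
            f (p.1 * p.2) * ENNReal.ofReal (Real.log p.2))
            ((hf.comp measurable_mul).mul (hl.comp measurable_snd))
      rw [h2]
      push_cast
      ring
    · refine Measurable.lintegral_prod_right' (f := fun p : ℝ × ℝ =>
        ∫⁻ v', f (p.2 * v' * p.1) * ENNReal.ofReal (Real.log v') ∂ν) ?_
      exact Measurable.lintegral_prod_right' (f := fun p : (ℝ × ℝ) × ℝ =>
        f (p.1.2 * p.2 * p.1.1) * ENNReal.ofReal (Real.log p.2))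
        (hm3.comp ((measurable_fst.comp measurable_fst).prodMk
          ((measurable_snd.comp measurable_fst).prodMk measurable_snd)))

/-- The identity `log · exp*(dν) = (log · dν) * exp*(dν)`. -/
theorem lintegral_expTotal_mul_log {ν : Measure ℝ} [SFinite ν] (hν : ν (Iio 1) = 0)
    {f : ℝ → ℝ≥0∞} (hf : Measurable f) :
    ∫⁻ u, f u * ENNReal.ofReal (Real.log u) ∂(expTotal ν)
      = ∫⁻ u, ∫⁻ v, f (u * v) * ENNReal.ofReal (Real.log v) ∂ν ∂(expTotal ν) := by
  rw [lintegral_expTotal, lintegral_expTotal, tsum_eq_zero_add' ENNReal.summable]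
  have h0 : ∫⁻ u, f u * ENNReal.ofReal (Real.log u) ∂(totPow ν 0) = 0 := by
    rw [totPow, lintegral_dirac]; simp
  rw [h0, mul_zero, zero_add]
  refine tsum_congr fun n => ?_
  rw [lintegral_totPow_mul_log hν n hf, ← mul_assoc]
  congr 1
  rw [Nat.factorial_succ, Nat.cast_mul, ENNReal.mul_inv (by simp) (by simp),
    mul_comm ((n + 1 : ℕ) : ℝ≥0∞)⁻¹, mul_assoc, ENNReal.inv_mul_cancel (by simp) (by simp),
    mul_one]

/-! ### The Mellin transform on a vertical line -/

/-- The kernel `u ^ (-2 + i t)` of the Mellin transform on a vertical line, written so that it is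
multiplicative on all of `ℝ`. -/
def mellinKernel (t u : ℝ) : ℂ := ((u⁻¹ ^ 2 : ℝ) : ℂ) * Complex.exp (t * Real.log u * Complex.I)

/-- The modulus `u ^ (-2)` of the Mellin kernel. -/
def mellinWeight (u : ℝ) : ℝ≥0∞ := ENNReal.ofReal (u⁻¹ ^ 2)

@[fun_prop]
theorem measurable_mellinKernel (t : ℝ) : Measurable (mellinKernel t) := by
  unfold mellinKernel; fun_prop

@[fun_prop]
theorem measurable_mellinWeight : Measurable mellinWeight := by
  unfold mellinWeight; fun_prop

theorem mellinKernel_mul (t u v : ℝ) :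
    mellinKernel t (u * v) = mellinKernel t u * mellinKernel t v := by
  rcases eq_or_ne u 0 with rfl | hu
  · simp [mellinKernel]
  rcases eq_or_ne v 0 with rfl | hv
  · simp [mellinKernel]
  have : (t * (Real.log (u * v) : ℝ) * Complex.I : ℂ)
      = t * Real.log u * Complex.I + t * Real.log v * Complex.I := by
    rw [Real.log_mul hu hv]; push_cast; ring
  rw [mellinKernel, mellinKernel, mellinKernel, this, Complex.exp_add]
  push_cast
  ring

theorem mellinWeight_mul (u v : ℝ) :
    mellinWeight (u * v) = mellinWeight u * mellinWeight v := by
  rw [mellinWeight, mellinWeight, mellinWeight, ← ENNReal.ofReal_mul (by positivity)]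
  congr 1
  rw [mul_inv, mul_pow]

theorem enorm_mellinKernel (t u : ℝ) : ‖mellinKernel t u‖ₑ = mellinWeight u := by
  have h : ‖Complex.exp (t * Real.log u * Complex.I)‖ = 1 := by
    rw [← Complex.ofReal_mul]; exact Complex.norm_exp_ofReal_mul_I _
  rw [mellinWeight, ← ofReal_norm, mellinKernel, norm_mul, h, mul_one, Complex.norm_real,
    Real.norm_of_nonneg (by positivity)]

theorem mellinKernel_one (t : ℝ) : mellinKernel t 1 = 1 := by simp [mellinKernel]

theorem mellinWeight_one : mellinWeight 1 = 1 := by simp [mellinWeight]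

theorem integrable_mellinKernel {μ : Measure ℝ} (h : ∫⁻ u, mellinWeight u ∂μ ≠ ∞) (t : ℝ) :
    Integrable (mellinKernel t) μ := by
  refine ⟨(measurable_mellinKernel t).aestronglyMeasurable, ?_⟩
  rw [HasFiniteIntegral]
  simp_rw [enorm_mellinKernel]
  exact h.lt_top

theorem lintegral_mellinWeight_mconv {μ ν : Measure ℝ} [SFinite ν] :
    ∫⁻ u, mellinWeight u ∂(μ.mconv ν)
      = (∫⁻ u, mellinWeight u ∂μ) * ∫⁻ u, mellinWeight u ∂ν := by
  rw [Measure.lintegral_mconv (by fun_prop)]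
  simp_rw [mellinWeight_mul, lintegral_const_mul _ measurable_mellinWeight]
  rw [lintegral_mul_const _ measurable_mellinWeight]

theorem integral_mellinKernel_mconv {μ ν : Measure ℝ} [SFinite μ] [SFinite ν]
    (hμ : ∫⁻ u, mellinWeight u ∂μ ≠ ∞) (hν : ∫⁻ u, mellinWeight u ∂ν ≠ ∞) (t : ℝ) :
    ∫ u, mellinKernel t u ∂(μ.mconv ν)
      = (∫ u, mellinKernel t u ∂μ) * ∫ u, mellinKernel t u ∂ν := by
  rw [integral_mconv (integrable_mellinKernel (by
    rw [lintegral_mellinWeight_mconv]; exact ENNReal.mul_ne_top hμ hν) t)]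
  simp_rw [mellinKernel_mul, integral_const_mul, integral_mul_const]

theorem charFun_map_log_withDensity {μ : Measure ℝ} (t : ℝ) :
    charFun ((μ.withDensity mellinWeight).map Real.log) t = ∫ u, mellinKernel t u ∂μ := by
  rw [charFun_apply_real, integral_map (by fun_prop) (by fun_prop)]
  rw [integral_withDensity_eq_integral_toReal_smul measurable_mellinWeight
    (.of_forall fun u => by simp [mellinWeight])]
  refine integral_congr_ae (.of_forall fun u => ?_)
  simp only [mellinWeight, mellinKernel]
  rw [ENNReal.toReal_ofReal (by positivity), Complex.real_smul]

/-- A measure on `[1, ∞)` is determined by its Mellin transform on the line `Re s = 2`. -/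
theorem measure_ext_of_mellinKernel {μ ν : Measure ℝ} (hμ1 : μ (Iio 1) = 0) (hν1 : ν (Iio 1) = 0)
    (hμ : ∫⁻ u, mellinWeight u ∂μ ≠ ∞) (hν : ∫⁻ u, mellinWeight u ∂ν ≠ ∞)
    (h : ∀ t, ∫ u, mellinKernel t u ∂μ = ∫ u, mellinKernel t u ∂ν) : μ = ν := by
  have hback : ∀ {μ : Measure ℝ}, μ (Iio 1) = 0 →
      (((μ.withDensity mellinWeight).map Real.log).map Real.exp).withDensity
        (fun u => (mellinWeight u)⁻¹) = μ := by
    intro μ hμ1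
    have h1 := ae_one_le hμ1
    rw [Measure.map_map (by fun_prop) (by fun_prop), Measure.map_congr (g := id), Measure.map_id,
      withDensity_inv_same measurable_mellinWeight]
    · filter_upwards [h1] with u hu
      simp only [mellinWeight, ne_eq, ENNReal.ofReal_eq_zero, not_le]
      positivity
    · exact .of_forall fun u => by simp [mellinWeight]
    · filter_upwards [(withDensity_absolutelyContinuous μ mellinWeight).ae_le h1] with u hu
      simp [Real.exp_log (lt_of_lt_of_le one_pos hu)]
  have : IsFiniteMeasure (μ.withDensity mellinWeight) := isFiniteMeasure_withDensity hμ
  have : IsFiniteMeasure (ν.withDensity mellinWeight) := isFiniteMeasure_withDensity hν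
  rw [← hback hμ1, ← hback hν1]
  congr 2
  refine Measure.ext_of_charFun (funext fun t => ?_)
  rw [charFun_map_log_withDensity, charFun_map_log_withDensity, h]

/-! ### Differences of measures -/

/-- The pair `(p, q)`, standing for `p - q`, consists of s-finite measures on `[1, ∞)` with an
absolutely convergent Mellin transform on the line `Re s = 2`. -/
structure MellinPair (a : Measure ℝ × Measure ℝ) : Prop where
  sFinite_fst : SFinite a.1
  sFinite_snd : SFinite a.2
  fst_Iio : a.1 (Iio 1) = 0
  snd_Iio : a.2 (Iio 1) = 0
  fst_ne_top : ∫⁻ u, mellinWeight u ∂a.1 ≠ ∞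
  snd_ne_top : ∫⁻ u, mellinWeight u ∂a.2 ≠ ∞

/-- The Mellin transform of a difference of measures. -/
def pairMellin (a : Measure ℝ × Measure ℝ) (t : ℝ) : ℂ :=
  (∫ u, mellinKernel t u ∂a.1) - ∫ u, mellinKernel t u ∂a.2

/-- The primitive of a difference of measures on `[1, ∞)`. -/
def pairPrimitive (a : Measure ℝ × Measure ℝ) (x : ℝ) : ℝ :=
  a.1.real (Icc 1 x) - a.2.real (Icc 1 x)

theorem MellinPair.convPair {a b : Measure ℝ × Measure ℝ} (ha : MellinPair a) (hb : MellinPair b) :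
    MellinPair (LSMeasure.convPair a b) := by
  obtain ⟨_, _, ha3, ha4, ha5, ha6⟩ := ha
  obtain ⟨_, _, hb3, hb4, hb5, hb6⟩ := hb
  constructor
  · rw [LSMeasure.convPair]; infer_instance
  · rw [LSMeasure.convPair]; infer_instance
  · simp [LSMeasure.convPair, mconv_Iio_one, *]
  · simp [LSMeasure.convPair, mconv_Iio_one, *]
  · simp [LSMeasure.convPair, lintegral_mellinWeight_mconv, ENNReal.mul_eq_top, *]
  · simp [LSMeasure.convPair, lintegral_mellinWeight_mconv, ENNReal.mul_eq_top, *]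

theorem MellinPair.of_le {a : Measure ℝ × Measure ℝ} {μ : Measure ℝ} [SFinite a.1] [SFinite a.2]
    (h1 : a.1 ≤ μ) (h2 : a.2 ≤ μ) (h : μ (Iio 1) = 0) (hμ : ∫⁻ u, mellinWeight u ∂μ ≠ ∞) :
    MellinPair a where
  sFinite_fst := inferInstance
  sFinite_snd := inferInstance
  fst_Iio := le_antisymm ((h1 _).trans h.le) zero_le
  snd_Iio := le_antisymm ((h2 _).trans h.le) zero_le
  fst_ne_top := ne_top_of_le_ne_top hμ (lintegral_mono' h1 le_rfl)
  snd_ne_top := ne_top_of_le_ne_top hμ (lintegral_mono' h2 le_rfl)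

theorem pairMellin_convPair {a b : Measure ℝ × Measure ℝ} (ha : MellinPair a) (hb : MellinPair b)
    (t : ℝ) : pairMellin (LSMeasure.convPair a b) t = pairMellin a t * pairMellin b t := by
  have := ha.sFinite_fst
  have := ha.sFinite_snd
  have := hb.sFinite_fst
  have := hb.sFinite_snd
  have hfin : ∀ {μ ν : Measure ℝ}, SFinite μ → SFinite ν → ∫⁻ u, mellinWeight u ∂μ ≠ ∞ →
      ∫⁻ u, mellinWeight u ∂ν ≠ ∞ → Integrable (mellinKernel t) (μ.mconv ν) := by
    intro μ ν _ _ h1 h2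
    refine integrable_mellinKernel ?_ t
    rw [lintegral_mellinWeight_mconv]; exact ENNReal.mul_ne_top h1 h2
  obtain ⟨_, _, -, -, ha5, ha6⟩ := ha
  obtain ⟨_, _, -, -, hb5, hb6⟩ := hb
  simp only [pairMellin, LSMeasure.convPair]
  rw [integral_add_measure (hfin ‹_› ‹_› ha5 hb5) (hfin ‹_› ‹_› ha6 hb6),
    integral_add_measure (hfin ‹_› ‹_› ha5 hb6) (hfin ‹_› ‹_› ha6 hb5),
    integral_mellinKernel_mconv ha5 hb5, integral_mellinKernel_mconv ha6 hb6,
    integral_mellinKernel_mconv ha5 hb6, integral_mellinKernel_mconv ha6 hb5]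
  ring

/-- A signed measure on `[1, ∞)` is determined by its Mellin transform. -/
theorem add_eq_add_of_pairMellin_eq {a b : Measure ℝ × Measure ℝ} (ha : MellinPair a)
    (hb : MellinPair b) (h : ∀ t, pairMellin a t = pairMellin b t) : a.1 + b.2 = b.1 + a.2 := by
  obtain ⟨_, _, ha3, ha4, ha5, ha6⟩ := ha
  obtain ⟨_, _, hb3, hb4, hb5, hb6⟩ := hb
  refine measure_ext_of_mellinKernel (by simp [*]) (by simp [*]) ?_ ?_ fun t => ?_
  · rw [lintegral_add_measure]; exact ENNReal.add_ne_top.2 ⟨ha5, hb6⟩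
  · rw [lintegral_add_measure]; exact ENNReal.add_ne_top.2 ⟨hb5, ha6⟩
  · rw [integral_add_measure (integrable_mellinKernel ha5 t) (integrable_mellinKernel hb6 t),
      integral_add_measure (integrable_mellinKernel hb5 t) (integrable_mellinKernel ha6 t)]
    have := h t
    simp only [pairMellin] at this
    linear_combination this

theorem measure_Icc_ne_top_of_mellinWeight {μ : Measure ℝ} (h : ∫⁻ u, mellinWeight u ∂μ ≠ ∞)
    (x : ℝ) : μ (Icc 1 x) ≠ ∞ := by
  have h1 : ENNReal.ofReal (x⁻¹ ^ 2) * μ (Icc 1 x) ≤ ∫⁻ u, mellinWeight u ∂μ := by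
    rw [← setLIntegral_const]
    refine (setLIntegral_mono measurable_mellinWeight fun u hu => ?_).trans
      (setLIntegral_le_lintegral _ _)
    refine ENNReal.ofReal_le_ofReal ?_
    have : 0 < u := lt_of_lt_of_le one_pos hu.1
    have := hu.2
    have : 0 < x := by linarith
    gcongr
  rcases le_or_gt x 0 with hx | hx
  · rw [Icc_eq_empty (by linarith)]; simp
  · intro htop
    rw [htop, ENNReal.mul_top (by simpa using by positivity)] at h1
    exact h (top_le_iff.1 h1)

theorem pairPrimitive_eq_of_pairMellin_eq {a b : Measure ℝ × Measure ℝ} (ha : MellinPair a)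
    (hb : MellinPair b) (h : ∀ t, pairMellin a t = pairMellin b t) (x : ℝ) :
    pairPrimitive a x = pairPrimitive b x := by
  have h1 := congrArg (fun μ : Measure ℝ => μ.real (Icc 1 x)) (add_eq_add_of_pairMellin_eq ha hb h)
  have h2 := measure_Icc_ne_top_of_mellinWeight ha.fst_ne_top x
  have h3 := measure_Icc_ne_top_of_mellinWeight ha.snd_ne_top x
  have h4 := measure_Icc_ne_top_of_mellinWeight hb.fst_ne_top x
  have h5 := measure_Icc_ne_top_of_mellinWeight hb.snd_ne_top x
  simp only [measureReal_add_apply h2 h5, measureReal_add_apply h4 h3] at h1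
  simp only [pairPrimitive]
  linarith

/-- The primitive of a convolution `a * b` at `x` is at most `∫ |A(x / v)| |db(v)|`. -/
theorem enorm_pairPrimitive_convPair_le {a b : Measure ℝ × Measure ℝ} (ha : MellinPair a)
    (hb : MellinPair b) (x : ℝ) :
    ‖pairPrimitive (LSMeasure.convPair a b) x‖ₑ
      ≤ ∫⁻ v, ‖pairPrimitive a (x / v)‖ₑ ∂(b.1 + b.2) := by
  have hconv := ha.convPair hb
  obtain ⟨_, _, ha3, ha4, ha5, ha6⟩ := ha
  obtain ⟨_, _, hb3, hb4, hb5, hb6⟩ := hb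
  have hac := measure_Icc_ne_top_of_mellinWeight ha5
  have hac' := measure_Icc_ne_top_of_mellinWeight ha6
  -- the two positive measures are evaluated by Tonelli
  have hval : ∀ {μ ν : Measure ℝ} [SFinite μ] [SFinite ν], μ (Iio 1) = 0 → ν (Iio 1) = 0 →
      (μ.mconv ν) (Icc 1 x) = ∫⁻ v, μ (Icc 1 (x / v)) ∂ν := by
    intro μ ν _ _ hμ hν
    rw [Measure.mconv_comm, ← lintegral_indicator_one measurableSet_Icc,
      Measure.lintegral_mconv (by measurability)]
    refine lintegral_congr_ae ?_
    filter_upwards [ae_one_le hν] with v hv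
    rw [← lintegral_indicator_one measurableSet_Icc]
    refine lintegral_congr_ae ?_
    filter_upwards [ae_one_le hμ] with u hu
    have hv0 : 0 < v := by linarith
    have : v * u ∈ Icc 1 x ↔ u ∈ Icc 1 (x / v) := by
      rw [mem_Icc, mem_Icc, le_div_iff₀ hv0, mul_comm u v]
      exact ⟨fun h => ⟨hu, h.2⟩, fun h => ⟨by nlinarith, h.2⟩⟩
    by_cases h : u ∈ Icc 1 (x / v)
    · rw [indicator_of_mem h, indicator_of_mem (this.2 h)]; rfl
    · rw [indicator_of_notMem h, indicator_of_notMem (mt this.1 h)]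
  have hmeas : ∀ {μ : Measure ℝ}, (∀ x, μ (Icc 1 x) ≠ ∞) →
      Measurable fun v => μ (Icc 1 (x / v)) := by
    intro μ h
    have hm : Monotone fun y => μ (Icc 1 y) := fun y z hyz => measure_mono (Icc_subset_Icc_right hyz)
    exact hm.measurable.comp (measurable_const.div measurable_id)
  have hreal : ∀ {μ ν : Measure ℝ} [SFinite μ] [SFinite ν], μ (Iio 1) = 0 → ν (Iio 1) = 0 →
      (∀ x, μ (Icc 1 x) ≠ ∞) → (μ.mconv ν) (Icc 1 x) ≠ ∞ →
      Integrable (fun v => μ.real (Icc 1 (x / v))) ν ∧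
        (μ.mconv ν).real (Icc 1 x) = ∫ v, μ.real (Icc 1 (x / v)) ∂ν := by
    intro μ ν _ _ hμ hν hμc hc
    rw [hval hμ hν] at hc
    refine ⟨integrable_toReal_of_lintegral_ne_top (hmeas hμc).aemeasurable hc, ?_⟩
    rw [measureReal_def, hval hμ hν]
    exact (integral_toReal (hmeas hμc).aemeasurable (.of_forall fun v => (hμc _).lt_top)).symm
  have hp := measure_Icc_ne_top_of_mellinWeight hconv.fst_ne_top x
  have hq := measure_Icc_ne_top_of_mellinWeight hconv.snd_ne_top x
  simp only [LSMeasure.convPair, Measure.add_apply] at hp hq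
  have hp1 := (ENNReal.add_ne_top.1 hp).1
  have hp2 := (ENNReal.add_ne_top.1 hp).2
  have hq1 := (ENNReal.add_ne_top.1 hq).1
  have hq2 := (ENNReal.add_ne_top.1 hq).2
  obtain ⟨i11, e11⟩ := hreal ha3 hb3 hac hp1
  obtain ⟨i22, e22⟩ := hreal ha4 hb4 hac' hp2
  obtain ⟨i12, e12⟩ := hreal ha3 hb4 hac hq1
  obtain ⟨i21, e21⟩ := hreal ha4 hb3 hac' hq2
  have hE : pairPrimitive (LSMeasure.convPair a b) x
      = (∫ v, pairPrimitive a (x / v) ∂b.1) - ∫ v, pairPrimitive a (x / v) ∂b.2 := by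
    simp only [pairPrimitive, LSMeasure.convPair]
    rw [measureReal_add_apply hp1 hp2, measureReal_add_apply hq1 hq2, integral_sub i11 i21,
      integral_sub i12 i22, e11, e22, e12, e21]
    ring
  rw [hE, lintegral_add_measure]
  exact (enorm_sub_le).trans (add_le_add (enorm_integral_le_lintegral_enorm _)
    (enorm_integral_le_lintegral_enorm _))

/-! ### The convolution exponential of a signed measure -/

namespace LSMeasure

instance (A : LSMeasure) : IsLocallyFiniteMeasure A.pos := A.locFin_pos

instance (A : LSMeasure) : IsLocallyFiniteMeasure A.neg := A.locFin_neg

instance (A : LSMeasure) : SFinite A.variation := by unfold variation; infer_instance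

theorem variation_Iio (A : LSMeasure) : A.variation (Iio 1) = 0 := by
  simp [variation, A.pos_Iio, A.neg_Iio]

theorem variation_neg (A : LSMeasure) : (-A).variation = A.variation :=
  add_comm A.neg A.pos

theorem variation_Icc_ne_top (A : LSMeasure) (x y : ℝ) : A.variation (Icc x y) ≠ ∞ := by
  rw [variation, Measure.add_apply]
  exact ENNReal.add_ne_top.2 ⟨isCompact_Icc.measure_lt_top.ne, isCompact_Icc.measure_lt_top.ne⟩

theorem variation_Iic_ne_top (A : LSMeasure) (X : ℝ) : A.variation (Iic X) ≠ ∞ := by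
  refine ne_top_of_le_ne_top (A.variation_Icc_ne_top 1 X) ?_
  calc A.variation (Iic X) ≤ A.variation (Iio 1 ∪ Icc 1 X) := by
        refine measure_mono fun u hu => ?_
        by_cases h : u < 1
        · exact .inl h
        · exact .inr ⟨not_lt.1 h, hu⟩
    _ ≤ A.variation (Iio 1) + A.variation (Icc 1 X) := measure_union_le _ _
    _ = _ := by rw [variation_Iio, zero_add]

theorem sFinite_convPow (A : LSMeasure) (n : ℕ) : SFinite (A.convPow n).1 ∧
    SFinite (A.convPow n).2 := by
  induction n with
  | zero => rw [convPow]; exact ⟨inferInstance, inferInstance⟩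
  | succ n ih =>
    obtain ⟨_, _⟩ := ih
    rw [convPow, convPair]
    exact ⟨inferInstance, inferInstance⟩

instance (A : LSMeasure) (n : ℕ) : SFinite (A.convPow n).1 := (A.sFinite_convPow n).1

instance (A : LSMeasure) (n : ℕ) : SFinite (A.convPow n).2 := (A.sFinite_convPow n).2

instance (A : LSMeasure) : SFinite A.expConv.1 := by unfold expConv; infer_instance

instance (A : LSMeasure) : SFinite A.expConv.2 := by unfold expConv; infer_instance

theorem convPow_add (A : LSMeasure) (n : ℕ) :
    (A.convPow n).1 + (A.convPow n).2 = totPow A.variation n := by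
  induction n with
  | zero => simp [convPow, totPow]
  | succ n ih =>
    rw [totPow, ← ih, variation, Measure.mconv_add, Measure.add_mconv, Measure.add_mconv, convPow,
      convPair]
    simp only
    abel

theorem expConv_add (A : LSMeasure) : A.expConv.1 + A.expConv.2 = expTotal A.variation := by
  rw [expConv, expTotal, Measure.sum_add_sum]
  simp only [← smul_add, convPow_add]

theorem expConv_fst_le (A : LSMeasure) : A.expConv.1 ≤ expTotal A.variation := by
  rw [← expConv_add]; exact Measure.le_add_right le_rfl

theorem expConv_snd_le (A : LSMeasure) : A.expConv.2 ≤ expTotal A.variation := by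
  rw [← expConv_add]; exact Measure.le_add_left le_rfl

theorem mellinPair_expConv (A : LSMeasure) (hA : ∫⁻ u, mellinWeight u ∂A.variation ≠ ∞) :
    MellinPair A.expConv := by
  refine .of_le A.expConv_fst_le A.expConv_snd_le (expTotal_Iio A.variation_Iio) ?_
  exact ne_top_of_le_ne_top ENNReal.ofReal_ne_top (lintegral_expTotal_le A.variation_Iio
    measurable_mellinWeight mellinWeight_one.le (fun u v _ _ => (mellinWeight_mul u v).le) hA)

theorem mellinPair (A : LSMeasure) (hA : ∫⁻ u, mellinWeight u ∂A.variation ≠ ∞) :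
    MellinPair (A.pos, A.neg) :=
  .of_le (Measure.le_add_right le_rfl) (Measure.le_add_left le_rfl) A.variation_Iio hA

theorem mellinPair_convPow (A : LSMeasure) (hA : ∫⁻ u, mellinWeight u ∂A.variation ≠ ∞) (n : ℕ) :
    MellinPair (A.convPow n) := by
  induction n with
  | zero =>
    refine .of_le (μ := Measure.dirac 1) le_rfl (Measure.zero_le _) ?_ ?_
    · rw [Measure.dirac_apply' _ measurableSet_Iio]; simp
    · rw [lintegral_dirac, mellinWeight_one]; simp
  | succ n ih => exact ih.convPair (A.mellinPair hA)

theorem pairMellin_convPow (A : LSMeasure) (hA : ∫⁻ u, mellinWeight u ∂A.variation ≠ ∞) (n : ℕ)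
    (t : ℝ) : pairMellin (A.convPow n) t = pairMellin (A.pos, A.neg) t ^ n := by
  induction n with
  | zero => simp [pairMellin, convPow, mellinKernel_one]
  | succ n ih =>
    rw [convPow, pairMellin_convPair (A.mellinPair_convPow hA n) (A.mellinPair hA), ih, pow_succ]

/-- The Mellin transform takes `exp*` to `exp`. -/
theorem pairMellin_expConv (A : LSMeasure) (hA : ∫⁻ u, mellinWeight u ∂A.variation ≠ ∞) (t : ℝ) :
    pairMellin A.expConv t = Complex.exp (pairMellin (A.pos, A.neg) t) := by
  have h := A.mellinPair_expConv hA
  have h1 := hasSum_integral_measure (integrable_mellinKernel h.fst_ne_top t)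
  have h2 := hasSum_integral_measure (integrable_mellinKernel h.snd_ne_top t)
  have h3 := h1.sub h2
  have h4 := NormedSpace.expSeries_div_hasSum_exp (𝔸 := ℂ) (pairMellin (A.pos, A.neg) t)
  rw [Complex.exp_eq_exp_ℂ]
  refine (h3.congr_fun ?_).unique h4 |>.symm ▸ rfl
  intro n
  rw [integral_smul_measure, integral_smul_measure, ← smul_sub, ← pairMellin_convPow A hA]
  simp [pairMellin, div_eq_inv_mul]

/-- The restriction of a signed measure to `(-∞, X]`. -/
def trunc (A : LSMeasure) (X : ℝ) : LSMeasure where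
  pos := A.pos.restrict (Iic X)
  neg := A.neg.restrict (Iic X)
  locFin_pos := inferInstance
  locFin_neg := inferInstance
  pos_Iio := le_antisymm ((Measure.restrict_apply_le _ _).trans A.pos_Iio.le) zero_le
  neg_Iio := le_antisymm ((Measure.restrict_apply_le _ _).trans A.neg_Iio.le) zero_le
  mutuallySingular :=
    A.mutuallySingular.mono Measure.restrict_le_self Measure.restrict_le_self

theorem variation_trunc (A : LSMeasure) (X : ℝ) :
    (A.trunc X).variation = A.variation.restrict (Iic X) := by
  rw [variation, variation, Measure.restrict_add]; rfl

theorem variation_trunc_le (A : LSMeasure) (X : ℝ) : (A.trunc X).variation ≤ A.variation := by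
  rw [variation_trunc]; exact Measure.restrict_le_self

theorem lintegral_mellinWeight_trunc (A : LSMeasure) (X : ℝ) :
    ∫⁻ u, mellinWeight u ∂(A.trunc X).variation ≠ ∞ := by
  have h : (A.trunc X).variation univ ≠ ∞ := by
    rw [variation_trunc, Measure.restrict_apply_univ]
    exact A.variation_Iic_ne_top X
  refine ne_top_of_le_ne_top h ?_
  rw [← lintegral_one]
  refine lintegral_mono_ae ?_
  filter_upwards [ae_one_le (A.trunc X).variation_Iio] with u hu
  rw [mellinWeight, ← ENNReal.ofReal_one]
  exact ENNReal.ofReal_le_ofReal (pow_le_one₀ (by positivity) (inv_le_one_of_one_le₀ hu))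

theorem convPow_Iio (A : LSMeasure) (n : ℕ) :
    (A.convPow n).1 (Iio 1) = 0 ∧ (A.convPow n).2 (Iio 1) = 0 := by
  have h := totPow_Iio A.variation_Iio n
  rw [← convPow_add, Measure.add_apply, add_eq_zero] at h
  exact h

theorem restrict_convPow (A : LSMeasure) (X : ℝ) (n : ℕ) :
    (A.convPow n).1.restrict (Iic X) = ((A.trunc X).convPow n).1.restrict (Iic X) ∧
    (A.convPow n).2.restrict (Iic X) = ((A.trunc X).convPow n).2.restrict (Iic X) := by
  induction n with
  | zero => exact ⟨rfl, rfl⟩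
  | succ n ih =>
    obtain ⟨h1, h2⟩ := ih
    obtain ⟨a1, a2⟩ := A.convPow_Iio n
    obtain ⟨b1, b2⟩ := (A.trunc X).convPow_Iio n
    have hp : (A.trunc X).pos.restrict (Iic X) = A.pos.restrict (Iic X) := by
      rw [trunc, Measure.restrict_restrict measurableSet_Iic, inter_self]
    have hn : (A.trunc X).neg.restrict (Iic X) = A.neg.restrict (Iic X) := by
      rw [trunc, Measure.restrict_restrict measurableSet_Iic, inter_self]
    simp only [convPow, convPair, Measure.restrict_add]
    rw [restrict_mconv a1 A.pos_Iio, restrict_mconv a2 A.neg_Iio, restrict_mconv a1 A.neg_Iio,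
      restrict_mconv a2 A.pos_Iio, restrict_mconv b1 (A.trunc X).pos_Iio,
      restrict_mconv b2 (A.trunc X).neg_Iio, restrict_mconv b1 (A.trunc X).neg_Iio,
      restrict_mconv b2 (A.trunc X).pos_Iio, h1, h2, hp, hn]
    exact ⟨rfl, rfl⟩

/-- On `[1, X]`, the convolution exponential of a signed measure only depends on the measure
on `[1, X]`. -/
theorem expPrimitive_trunc (A : LSMeasure) {x X : ℝ} (hx : x ≤ X) :
    (A.trunc X).expPrimitive x = A.expPrimitive x := by
  have hs : Icc 1 x ⊆ Iic X := fun u hu => hu.2.trans hx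
  have h : ∀ {μ ν : Measure ℝ}, μ.restrict (Iic X) = ν.restrict (Iic X) →
      ν (Icc 1 x) = μ (Icc 1 x) := by
    intro μ ν h
    rw [← inter_eq_self_of_subset_left hs, ← Measure.restrict_apply measurableSet_Icc,
      ← Measure.restrict_apply measurableSet_Icc, h]
  simp only [expPrimitive, expConv, measureReal_def, Measure.sum_apply _ measurableSet_Icc,
    Measure.smul_apply, h (A.restrict_convPow X _).1, h (A.restrict_convPow X _).2]

theorem val_eq_of_add_eq {A B C D : LSMeasure} (X : ℝ) (h : IsSum₃ A B C D) :
    (A.trunc X).pos + (B.trunc X).neg + (C.trunc X).neg + (D.trunc X).neg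
      = (A.trunc X).neg + (B.trunc X).pos + (C.trunc X).pos + (D.trunc X).pos := by
  have hIcc : ∀ {μ : Measure ℝ}, μ (Iio 1) = 0 → ∀ s, MeasurableSet s →
      μ.restrict (Iic X) s = μ (s ∩ Icc 1 X) := by
    intro μ hμ s hs
    rw [Measure.restrict_apply hs]
    refine measure_congr ?_
    filter_upwards [ae_one_le hμ] with u hu
    exact propext ⟨fun h => ⟨h.1, hu, h.2⟩, fun h => ⟨h.1, h.2.2⟩⟩
  ext s hs
  have h1 := h (s ∩ Icc 1 X) (hs.inter measurableSet_Icc)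
    ((Metric.isBounded_Icc 1 X).subset inter_subset_right)
  have hfin : ∀ {μ : Measure ℝ} [IsLocallyFiniteMeasure μ], μ (s ∩ Icc 1 X) ≠ ∞ := fun {μ} _ =>
    measure_ne_top_of_subset inter_subset_right isCompact_Icc.measure_lt_top.ne
  simp only [val, measureReal_def] at h1
  simp only [trunc, Measure.add_apply, hIcc A.pos_Iio s hs, hIcc A.neg_Iio s hs,
    hIcc B.pos_Iio s hs, hIcc B.neg_Iio s hs, hIcc C.pos_Iio s hs, hIcc C.neg_Iio s hs,
    hIcc D.pos_Iio s hs, hIcc D.neg_Iio s hs]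
  rw [← ENNReal.toReal_eq_toReal_iff' (by simp [hfin]) (by simp [hfin]),
    ENNReal.toReal_add (by simp [hfin]) hfin, ENNReal.toReal_add (by simp [hfin]) hfin,
    ENNReal.toReal_add hfin hfin, ENNReal.toReal_add (by simp [hfin]) hfin,
    ENNReal.toReal_add (by simp [hfin]) hfin, ENNReal.toReal_add hfin hfin]
  linarith

/-- If `dP = dP₀ + dE + dR`, then `M_P(x)` is the primitive of
`exp*(-dP₀) * exp*(-dE) * exp*(-dR)`, with all measures cut off at `x`. -/
theorem mobiusSum_eq_pairPrimitive {P P₀ E R : LSMeasure} (h : IsSum₃ P P₀ E R) (x : ℝ) :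
    P.mobiusSum x = pairPrimitive (convPair (convPair (-(P₀.trunc x)).expConv
      (-(E.trunc x)).expConv) (-(R.trunc x)).expConv) x := by
  have hw : ∀ A : LSMeasure, ∫⁻ u, mellinWeight u ∂(-(A.trunc x)).variation ≠ ∞ := fun A => by
    rw [variation_neg]; exact A.lintegral_mellinWeight_trunc x
  have h1 : P.mobiusSum x = pairPrimitive (-(P.trunc x)).expConv x :=
    ((-P).expPrimitive_trunc le_rfl).symm
  have hE := ((-(P₀.trunc x)).mellinPair_expConv (hw _)).convPair
    ((-(E.trunc x)).mellinPair_expConv (hw _))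
  rw [h1]
  refine pairPrimitive_eq_of_pairMellin_eq ((-(P.trunc x)).mellinPair_expConv (hw _))
    (hE.convPair ((-(R.trunc x)).mellinPair_expConv (hw _))) (fun t => ?_) x
  rw [pairMellin_convPair hE ((-(R.trunc x)).mellinPair_expConv (hw _)),
    pairMellin_convPair ((-(P₀.trunc x)).mellinPair_expConv (hw _))
      ((-(E.trunc x)).mellinPair_expConv (hw _)),
    pairMellin_expConv _ (hw _), pairMellin_expConv _ (hw _), pairMellin_expConv _ (hw _),
    pairMellin_expConv _ (hw _), ← Complex.exp_add, ← Complex.exp_add]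
  congr 1
  have hi := congrArg (fun μ => ∫ u, mellinKernel t u ∂μ) (val_eq_of_add_eq x h)
  have hp : ∀ A : LSMeasure, Integrable (mellinKernel t) (A.trunc x).pos := fun A =>
    integrable_mellinKernel ((A.trunc x).mellinPair (A.lintegral_mellinWeight_trunc x)).fst_ne_top t
  have hn : ∀ A : LSMeasure, Integrable (mellinKernel t) (A.trunc x).neg := fun A =>
    integrable_mellinKernel ((A.trunc x).mellinPair (A.lintegral_mellinWeight_trunc x)).snd_ne_top t
  rw [integral_add_measure (((hp P).add_measure (hn P₀)).add_measure (hn E)) (hn R),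
    integral_add_measure ((hp P).add_measure (hn P₀)) (hn E), integral_add_measure (hp P) (hn P₀),
    integral_add_measure (((hn P).add_measure (hp P₀)).add_measure (hp E)) (hp R),
    integral_add_measure ((hn P).add_measure (hp P₀)) (hp E), integral_add_measure (hn P) (hp P₀)]
    at hi
  have hneg : ∀ A : LSMeasure, pairMellin ((-A).pos, (-A).neg) t
      = (∫ u, mellinKernel t u ∂A.neg) - ∫ u, mellinKernel t u ∂A.pos := fun A => rfl
  rw [hneg, hneg, hneg, hneg]
  linear_combination -hi

theorem mobiusSum_eq_zero (P : LSMeasure) {x : ℝ} (hx : x < 1) : P.mobiusSum x = 0 := by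
  simp [mobiusSum, expPrimitive, Icc_eq_empty_of_lt hx]

theorem expTotal_Icc_ne_top (A : LSMeasure) (x : ℝ) : expTotal A.variation (Icc 1 x) ≠ ∞ := by
  have h := lintegral_expTotal_le A.variation_Iio (w := (Iic x).indicator 1)
    (by measurability) (indicator_le_self' (by simp) 1) (fun u v hu hv => by
      by_cases h : u * v ∈ Iic x
      · have h' : u * v ≤ x := h
        have hu' : u ∈ Iic x := show u ≤ x by nlinarith
        have hv' : v ∈ Iic x := show v ≤ x by nlinarith
        rw [indicator_of_mem h, indicator_of_mem hu', indicator_of_mem hv']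
        simp
      · rw [indicator_of_notMem h]; exact zero_le) (by
      rw [lintegral_indicator_one measurableSet_Iic]
      exact A.variation_Iic_ne_top x)
  rw [lintegral_indicator_one measurableSet_Iic] at h
  exact measure_ne_top_of_subset (fun u hu => hu.2) (ne_top_of_le_ne_top ENNReal.ofReal_ne_top h)

/-- The main inequality: `|M_P(x)| ≤ ∬ |M_{P₀}(x / (v w))| d exp*(|dE|)(v) d exp*(|dR|)(w)`. -/
theorem enorm_mobiusSum_le {P P₀ E R : LSMeasure} (h : IsSum₃ P P₀ E R) (x : ℝ) :
    ‖P.mobiusSum x‖ₑ ≤ ∫⁻ w, ∫⁻ v, ‖P₀.mobiusSum (x / w / v)‖ₑ ∂(expTotal E.variation)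
      ∂(expTotal R.variation) := by
  have hw : ∀ A : LSMeasure, ∫⁻ u, mellinWeight u ∂(-(A.trunc x)).variation ≠ ∞ := fun A => by
    rw [variation_neg]; exact A.lintegral_mellinWeight_trunc x
  have h0 := (-(P₀.trunc x)).mellinPair_expConv (hw _)
  have hE := (-(E.trunc x)).mellinPair_expConv (hw _)
  have hR := (-(R.trunc x)).mellinPair_expConv (hw _)
  have hle : ∀ A : LSMeasure, (-(A.trunc x)).expConv.1 + (-(A.trunc x)).expConv.2
      ≤ expTotal A.variation := fun A => by
    rw [expConv_add, variation_neg]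
    exact expTotal_mono (A.variation_trunc_le x)
  rw [mobiusSum_eq_pairPrimitive h]
  refine (enorm_pairPrimitive_convPair_le (h0.convPair hE) hR x).trans ?_
  refine (lintegral_mono' (hle R) le_rfl).trans ?_
  refine lintegral_mono_ae ?_
  filter_upwards [ae_one_le (expTotal_Iio R.variation_Iio)] with w hw1
  refine (enorm_pairPrimitive_convPair_le h0 hE _).trans ?_
  refine (lintegral_mono' (hle E) le_rfl).trans ?_
  refine lintegral_mono_ae ?_
  filter_upwards [ae_one_le (expTotal_Iio E.variation_Iio)] with v hv1
  rcases lt_or_ge (x / w / v) 1 with hlt | hge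
  · simp [pairPrimitive, Icc_eq_empty_of_lt hlt]
  · have hx : x / w / v ≤ x := by
      have h1 : 0 < w := by linarith
      have h2 : 0 < v := by linarith
      have h3 : 0 ≤ x := by
        by_contra hneg
        have : x / w / v < 0 := div_neg_of_neg_of_pos (div_neg_of_neg_of_pos (by linarith) h1) h2
        linarith
      exact (div_le_self (by positivity) hv1).trans (div_le_self h3 hw1)
    exact le_of_eq (congrArg _ ((-P₀).expPrimitive_trunc hx))

end LSMeasure

/-! ### Convolution with the exponential of a sparse measure -/

/-- The majorant `z / (1 + log z) ^ a` on `[1, ∞)`, extended by zero. -/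
def logMajorant (a z : ℝ) : ℝ≥0∞ :=
  if 1 ≤ z then ENNReal.ofReal (z * (1 + Real.log z) ^ (-a)) else 0

@[fun_prop]
theorem measurable_logMajorant (a : ℝ) : Measurable (logMajorant a) := by
  unfold logMajorant
  exact Measurable.ite measurableSet_Ici (by fun_prop) measurable_const

theorem logMajorant_le {a z : ℝ} (ha : 0 ≤ a) : logMajorant a z ≤ ENNReal.ofReal z := by
  unfold logMajorant
  split_ifs with h
  · refine ENNReal.ofReal_le_ofReal ?_
    have h1 : (1 + Real.log z) ^ (-a) ≤ 1 :=
      Real.rpow_le_one_of_one_le_of_nonpos (by linarith [Real.log_nonneg h]) (by linarith)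
    nlinarith
  · exact zero_le

theorem sum_range_rpow_neg_le {a : ℝ} (ha0 : 0 ≤ a) (ha : a < 1) (n : ℕ) :
    ∑ k ∈ Finset.range n, ((k : ℝ) + 1) ^ (-a) ≤ (n : ℝ) ^ (1 - a) / (1 - a) := by
  induction n with
  | zero => simp [Real.zero_rpow (by linarith : (1 - a) ≠ 0)]
  | succ n ih =>
    rw [Finset.sum_range_succ]
    have hn : (0 : ℝ) < n + 1 := by positivity
    have h1 : ((1 : ℝ) + -((n : ℝ) + 1)⁻¹) ^ (1 - a) ≤ 1 + (1 - a) * -((n : ℝ) + 1)⁻¹ :=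
      rpow_one_add_le_one_add_mul_self (by
        have : ((n : ℝ) + 1)⁻¹ ≤ 1 := inv_le_one_of_one_le₀ (by linarith [n.cast_nonneg (α := ℝ)])
        linarith) (by linarith) (by linarith)
    have h2 : (n : ℝ) ^ (1 - a) = ((n : ℝ) + 1) ^ (1 - a) * (1 + -((n : ℝ) + 1)⁻¹) ^ (1 - a) := by
      rw [← Real.mul_rpow hn.le]
      · congr 1; field_simp; ring
      · have : ((n : ℝ) + 1)⁻¹ ≤ 1 := inv_le_one_of_one_le₀ (by linarith [n.cast_nonneg (α := ℝ)])
        linarith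
    have h3 : ((n : ℝ) + 1) ^ (1 - a) * ((n : ℝ) + 1)⁻¹ = ((n : ℝ) + 1) ^ (-a) := by
      rw [← Real.rpow_neg_one, ← Real.rpow_add hn]; congr 1; ring
    have h4 : (n : ℝ) ^ (1 - a) ≤ ((n : ℝ) + 1) ^ (1 - a) - (1 - a) * ((n : ℝ) + 1) ^ (-a) := by
      rw [h2, ← h3]
      have := mul_le_mul_of_nonneg_left h1 (by positivity : 0 ≤ ((n : ℝ) + 1) ^ (1 - a))
      linarith
    have h5 : (0 : ℝ) < 1 - a := by linarith
    rw [le_div_iff₀ h5] at ih ⊢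
    push_cast
    linarith

/-- Dyadic decomposition of the majorant. -/
theorem logMajorant_le_sum {a t : ℝ} (ha0 : 0 ≤ a) (ha : a ≤ 1) {N : ℕ}
    (ht : t < 2 ^ (N + 1)) :
    logMajorant a t ≤ ∑ k ∈ Finset.range (N + 1),
      (Ici ((2 : ℝ) ^ k)).indicator
        (fun _ => ENNReal.ofReal (2 ^ (k + 2) * ((k : ℝ) + 1) ^ (-a))) t := by
  unfold logMajorant
  split_ifs with h1
  swap
  · exact zero_le
  obtain ⟨k, hk1, hk2⟩ := exists_nat_pow_near h1 one_lt_two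
  have hkN : k ∈ Finset.range (N + 1) := by
    rw [Finset.mem_range]
    exact (pow_lt_pow_iff_right₀ (one_lt_two (α := ℝ))).1 (hk1.trans_lt ht)
  refine le_trans ?_ (Finset.single_le_sum (fun i _ => zero_le) hkN)
  rw [indicator_of_mem (show t ∈ Ici ((2 : ℝ) ^ k) from hk1)]
  refine ENNReal.ofReal_le_ofReal ?_
  have hlog : (k : ℝ) * Real.log 2 ≤ Real.log t := by
    rw [← Real.log_pow]; exact Real.log_le_log (by positivity) hk1
  have hl2 : (1 / 2 : ℝ) ≤ Real.log 2 := by linarith [Real.log_two_gt_d9]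
  have hge : ((k : ℝ) + 1) / 2 ≤ 1 + Real.log t := by
    nlinarith [k.cast_nonneg (α := ℝ)]
  have h2 : (1 + Real.log t) ^ (-a) ≤ 2 * ((k : ℝ) + 1) ^ (-a) := by
    calc (1 + Real.log t) ^ (-a) ≤ (((k : ℝ) + 1) / 2) ^ (-a) :=
          Real.rpow_le_rpow_of_nonpos (by positivity) hge (by linarith)
      _ = ((k : ℝ) + 1) ^ (-a) * 2 ^ a := by
          rw [Real.div_rpow (by positivity) (by norm_num), Real.rpow_neg (by norm_num : (0:ℝ) ≤ 2)]
          field_simp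
      _ ≤ ((k : ℝ) + 1) ^ (-a) * 2 := by
          gcongr
          calc (2 : ℝ) ^ a ≤ 2 ^ (1 : ℝ) := Real.rpow_le_rpow_of_exponent_le (by norm_num) ha
            _ = 2 := Real.rpow_one 2
      _ = _ := mul_comm _ _
  calc t * (1 + Real.log t) ^ (-a) ≤ 2 ^ (k + 1) * (2 * ((k : ℝ) + 1) ^ (-a)) := by
        gcongr
        exact Real.rpow_nonneg (by linarith [Real.log_nonneg h1]) _
    _ = _ := by ring

/-- Only the Chebyshev-type bound `∫_{[1,y]} log v dν(v) ≤ C y` is used: it is applied to the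
level sets of the dyadic decomposition, and the terms `(k + 1) ^ (-a)`, `a < 1`, sum to a saving of
`log ^ (-a) z` against the `log z` dyadic intervals. -/
theorem lintegral_logMajorant_mul_log_le {ν : Measure ℝ} {C a : ℝ}
    (ha0 : 0 ≤ a) (ha : a < 1) (hC : 0 ≤ C)
    (hν : ν (Iio 1) = 0)
    (hL : ∀ y, 0 ≤ y → ∫⁻ v in Iic y, ENNReal.ofReal (Real.log v) ∂ν ≤ ENNReal.ofReal (C * y))
    {z : ℝ} {N : ℕ} (hz0 : 0 ≤ z) (hz : z < 2 ^ (N + 1)) :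
    ∫⁻ v, logMajorant a (z / v) * ENNReal.ofReal (Real.log v) ∂ν
      ≤ ENNReal.ofReal (4 * C * z * (((N + 1 : ℕ) : ℝ) ^ (1 - a) / (1 - a))) := by
  have hlog : Measurable fun v : ℝ => ENNReal.ofReal (Real.log v) := by fun_prop
  calc ∫⁻ v, logMajorant a (z / v) * ENNReal.ofReal (Real.log v) ∂ν
      ≤ ∫⁻ v, ∑ k ∈ Finset.range (N + 1), ENNReal.ofReal (2 ^ (k + 2) * ((k : ℝ) + 1) ^ (-a)) *
          (Iic (z / 2 ^ k)).indicator (fun v => ENNReal.ofReal (Real.log v)) v ∂ν := by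
        refine lintegral_mono_ae ?_
        filter_upwards [ae_one_le hν] with v hv
        have hv0 : 0 < v := by linarith
        refine (mul_le_mul_left (logMajorant_le_sum ha0 ha.le (N := N)
          ((div_le_self hz0 hv).trans_lt hz)) _).trans ?_
        rw [Finset.sum_mul]
        refine Finset.sum_le_sum fun k _ => ?_
        by_cases h : z / v ∈ Ici ((2 : ℝ) ^ k)
        · have h' : v ∈ Iic (z / 2 ^ k) := by
            have : (2 : ℝ) ^ k ≤ z / v := h
            rw [mem_Iic, le_div_iff₀ (by positivity), mul_comm]
            rwa [le_div_iff₀ hv0] at this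
          rw [indicator_of_mem h, indicator_of_mem h']
        · rw [indicator_of_notMem h, zero_mul]; exact zero_le
    _ = ∑ k ∈ Finset.range (N + 1), ENNReal.ofReal (2 ^ (k + 2) * ((k : ℝ) + 1) ^ (-a)) *
          ∫⁻ v in Iic (z / 2 ^ k), ENNReal.ofReal (Real.log v) ∂ν := by
        rw [lintegral_finsetSum]
        · refine Finset.sum_congr rfl fun k _ => ?_
          rw [lintegral_const_mul _ (hlog.indicator measurableSet_Iic),
            lintegral_indicator measurableSet_Iic]
        · intro k _
          exact (hlog.indicator measurableSet_Iic).const_mul _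
    _ ≤ ∑ k ∈ Finset.range (N + 1), ENNReal.ofReal (2 ^ (k + 2) * ((k : ℝ) + 1) ^ (-a)) *
          ENNReal.ofReal (C * (z / 2 ^ k)) := by
        gcongr with k _
        exact hL _ (by positivity)
    _ = ENNReal.ofReal (∑ k ∈ Finset.range (N + 1), 4 * C * z * ((k : ℝ) + 1) ^ (-a)) := by
        rw [ENNReal.ofReal_sum_of_nonneg (fun k _ => by positivity)]
        refine Finset.sum_congr rfl fun k _ => ?_
        rw [← ENNReal.ofReal_mul (by positivity)]
        congr 1
        field_simp
        ring
    _ ≤ _ := by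
        rw [← Finset.mul_sum]
        refine ENNReal.ofReal_le_ofReal ?_
        gcongr
        exact sum_range_rpow_neg_le ha0 ha (N + 1)

theorem lintegral_inv_expTotal_le {ν : Measure ℝ} [SFinite ν] (hν : ν (Iio 1) = 0) {y : ℝ}
    (h : ∫⁻ u in Iic y, ENNReal.ofReal u⁻¹ ∂ν ≠ ∞) :
    ∫⁻ u in Iic y, ENNReal.ofReal u⁻¹ ∂(expTotal ν)
      ≤ ENNReal.ofReal (Real.exp (∫⁻ u in Iic y, ENNReal.ofReal u⁻¹ ∂ν).toReal) := by
  have hm : Measurable fun u : ℝ => ENNReal.ofReal u⁻¹ := by fun_prop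
  rw [← lintegral_indicator measurableSet_Iic] at h ⊢
  rw [← lintegral_indicator measurableSet_Iic]
  refine lintegral_expTotal_le hν (hm.indicator measurableSet_Iic) ?_ (fun u v hu hv => ?_) h
  · exact (indicator_le_self _ _ _).trans (by simp)
  · by_cases h : u * v ∈ Iic y
    · have h' : u * v ≤ y := h
      have hu' : u ∈ Iic y := show u ≤ y by nlinarith
      have hv' : v ∈ Iic y := show v ≤ y by nlinarith
      rw [indicator_of_mem h, indicator_of_mem hu', indicator_of_mem hv',
        ← ENNReal.ofReal_mul (by positivity), mul_inv]
    · rw [indicator_of_notMem h]; exact zero_le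

/-- A pointwise splitting at `v = √y`: a small `v` leaves a large argument `y / v`, and for a large
`v` a factor `log v / log y` can be inserted. -/
theorem logMajorant_div_le {a y v : ℝ} (ha0 : 0 ≤ a) (hy : 1 < y) (hv : 1 ≤ v) :
    logMajorant a (y / v) ≤
      ENNReal.ofReal (y * (Real.log y / 2) ^ (-a)) *
        (Iic y).indicator (fun v => ENNReal.ofReal v⁻¹) v
      + ENNReal.ofReal (2 / Real.log y) *
        (logMajorant a (y / v) * ENNReal.ofReal (Real.log v)) := by
  have hly : 0 < Real.log y := Real.log_pos hy
  have hv0 : 0 < v := by linarith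
  by_cases hvy : v ≤ y
  swap
  · have : ¬ 1 ≤ y / v := by rw [le_div_iff₀ hv0]; linarith
    rw [logMajorant, if_neg this]; exact zero_le
  rcases le_or_gt (Real.log v) (Real.log y / 2) with h | h
  · refine le_add_right ?_
    rw [indicator_of_mem (show v ∈ Iic y from hvy), ← ENNReal.ofReal_mul (by positivity),
      logMajorant]
    split_ifs with h1
    · refine ENNReal.ofReal_le_ofReal ?_
      have h2 : Real.log y / 2 ≤ 1 + Real.log (y / v) := by
        rw [Real.log_div (by linarith) hv0.ne']; linarith
      have h3 := Real.rpow_le_rpow_of_nonpos (by positivity) h2 (by linarith : -a ≤ 0)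
      calc y / v * (1 + Real.log (y / v)) ^ (-a) ≤ y / v * (Real.log y / 2) ^ (-a) := by gcongr
        _ = _ := by ring
    · exact zero_le
  · refine le_add_left ?_
    rw [mul_comm (logMajorant a (y / v)), ← mul_assoc, ← ENNReal.ofReal_mul (by positivity)]
    refine le_mul_of_one_le_left' ?_
    rw [ENNReal.one_le_ofReal, div_mul_eq_mul_div, le_div_iff₀ hly]
    linarith

/-- The main estimate for the convolution with `exp*(dν)`: up to the factor
`exp (∫_{[1,y]} dν(u) / u)` the majorant `y / log ^ a y` is preserved. In the range of large `v` the
inserted factor `log v` is passed to `dν` by `log · exp*(dν) = (log · dν) * exp*(dν)`. -/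
theorem lintegral_logMajorant_expTotal_le {ν : Measure ℝ} [SFinite ν] {C a : ℝ}
    (ha0 : 0 ≤ a) (ha : a < 1) (hC : 0 ≤ C)
    (hν : ν (Iio 1) = 0)
    (hL : ∀ y, 0 ≤ y → ∫⁻ v in Iic y, ENNReal.ofReal (Real.log v) ∂ν ≤ ENNReal.ofReal (C * y))
    {y ρ : ℝ} (hy : 3 ≤ y) (hρ : ∫⁻ u in Iic y, ENNReal.ofReal u⁻¹ ∂ν ≤ ENNReal.ofReal ρ)
    (hρ0 : 0 ≤ ρ) :
    ∫⁻ v, logMajorant a (y / v) ∂(expTotal ν)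
      ≤ ENNReal.ofReal ((2 + 24 * C / (1 - a)) * y * Real.log y ^ (-a) * Real.exp ρ) := by
  have hlog : Measurable fun v : ℝ => ENNReal.ofReal (Real.log v) := by fun_prop
  have hinv : Measurable fun v : ℝ => ENNReal.ofReal v⁻¹ := by fun_prop
  have hl1 : 1 ≤ Real.log y := by
    rw [Real.le_log_iff_exp_le (by linarith)]; linarith [Real.exp_one_lt_d9]
  have hT : ∫⁻ u in Iic y, ENNReal.ofReal u⁻¹ ∂(expTotal ν) ≤ ENNReal.ofReal (Real.exp ρ) := by
    refine (lintegral_inv_expTotal_le hν (ne_top_of_le_ne_top ENNReal.ofReal_ne_top hρ)).trans ?_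
    gcongr
    exact ENNReal.toReal_le_of_le_ofReal hρ0 hρ
  obtain ⟨N, hN1, hN2⟩ := exists_nat_pow_near (by linarith : 1 ≤ y) (one_lt_two (α := ℝ))
  have hN : ((N + 1 : ℕ) : ℝ) ≤ 3 * Real.log y := by
    have h1 : (N : ℝ) * Real.log 2 ≤ Real.log y := by
      rw [← Real.log_pow]; exact Real.log_le_log (by positivity) hN1
    have hl2 : (1 / 2 : ℝ) ≤ Real.log 2 := by linarith [Real.log_two_gt_d9]
    push_cast
    nlinarith [N.cast_nonneg (α := ℝ)]
  set S : ℝ := ((N + 1 : ℕ) : ℝ) ^ (1 - a) / (1 - a) with hS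
  have ha1 : 0 < 1 - a := by linarith
  have hS0 : 0 ≤ S := by positivity
  have hSle : S ≤ 3 * Real.log y * Real.log y ^ (-a) / (1 - a) := by
    rw [hS]
    gcongr
    calc (((N + 1 : ℕ) : ℝ)) ^ (1 - a) ≤ (3 * Real.log y) ^ (1 - a) := by gcongr
      _ = 3 ^ (1 - a) * Real.log y ^ (1 - a) := Real.mul_rpow (by norm_num) (by linarith)
      _ ≤ 3 ^ (1 : ℝ) * Real.log y ^ (1 - a) := by
          gcongr
          · norm_num
          · linarith
      _ = _ := by rw [Real.rpow_one, sub_eq_add_neg, Real.rpow_add (by linarith), Real.rpow_one]; ring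
  have hK : ∫⁻ u, ∫⁻ v, logMajorant a (y / (u * v)) * ENNReal.ofReal (Real.log v) ∂ν ∂(expTotal ν)
      ≤ ENNReal.ofReal (4 * C * y * S) * ∫⁻ u in Iic y, ENNReal.ofReal u⁻¹ ∂(expTotal ν) := by
    rw [← lintegral_const_mul _ hinv, ← lintegral_indicator measurableSet_Iic]
    refine lintegral_mono_ae ?_
    filter_upwards [ae_one_le (expTotal_Iio hν)] with u hu
    have hu0 : 0 < u := by linarith
    by_cases huy : u ∈ Iic y
    · rw [indicator_of_mem huy, ← ENNReal.ofReal_mul (by positivity)]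
      have := lintegral_logMajorant_mul_log_le (z := y / u) ha0 ha hC hν hL (by positivity)
        ((div_le_self (by linarith) hu).trans_lt hN2)
      simp_rw [← div_div]
      refine this.trans (le_of_eq ?_)
      congr 1
      rw [hS]
      ring
    · rw [indicator_of_notMem huy]
      refine le_of_eq (lintegral_eq_zero_of_ae_eq_zero ?_)
      filter_upwards [ae_one_le hν] with v hv
      have : ¬ 1 ≤ y / (u * v) := by
        have huy : y < u := not_le.1 huy
        rw [le_div_iff₀ (by positivity)]
        nlinarith
      rw [logMajorant, if_neg this, zero_mul, Pi.zero_apply]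
  calc ∫⁻ v, logMajorant a (y / v) ∂(expTotal ν)
      ≤ ∫⁻ v, (ENNReal.ofReal (y * (Real.log y / 2) ^ (-a)) *
        (Iic y).indicator (fun v => ENNReal.ofReal v⁻¹) v
      + ENNReal.ofReal (2 / Real.log y) *
        (logMajorant a (y / v) * ENNReal.ofReal (Real.log v))) ∂(expTotal ν) := by
        refine lintegral_mono_ae ?_
        filter_upwards [ae_one_le (expTotal_Iio hν)] with v hv
        exact logMajorant_div_le ha0 (by linarith) hv
    _ = ENNReal.ofReal (y * (Real.log y / 2) ^ (-a)) *
          ∫⁻ v in Iic y, ENNReal.ofReal v⁻¹ ∂(expTotal ν)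
        + ENNReal.ofReal (2 / Real.log y) *
          ∫⁻ u, ∫⁻ v, logMajorant a (y / (u * v)) * ENNReal.ofReal (Real.log v) ∂ν
            ∂(expTotal ν) := by
        rw [lintegral_add_left ((hinv.indicator measurableSet_Iic).const_mul _),
          lintegral_const_mul _ (hinv.indicator measurableSet_Iic),
          lintegral_indicator measurableSet_Iic, lintegral_const_mul _ (by fun_prop),
          lintegral_expTotal_mul_log hν (f := fun v => logMajorant a (y / v)) (by fun_prop)]
    _ ≤ ENNReal.ofReal (y * (Real.log y / 2) ^ (-a)) * ENNReal.ofReal (Real.exp ρ)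
        + ENNReal.ofReal (2 / Real.log y) *
          (ENNReal.ofReal (4 * C * y * S) * ENNReal.ofReal (Real.exp ρ)) := by
        gcongr
        exact hK.trans (by gcongr)
    _ = ENNReal.ofReal (y * (Real.log y / 2) ^ (-a) * Real.exp ρ
          + 2 / Real.log y * (4 * C * y * S * Real.exp ρ)) := by
        rw [← ENNReal.ofReal_mul (by positivity), ← ENNReal.ofReal_mul (by positivity),
          ← ENNReal.ofReal_mul (by positivity), ← ENNReal.ofReal_add (by positivity)
          (by positivity)]
    _ ≤ _ := by
        refine ENNReal.ofReal_le_ofReal ?_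
        have h1 : (Real.log y / 2) ^ (-a) ≤ 2 * Real.log y ^ (-a) := by
          rw [Real.div_rpow (by linarith) (by norm_num), Real.rpow_neg (by norm_num : (0:ℝ) ≤ 2),
            div_inv_eq_mul, mul_comm]
          gcongr
          calc (2 : ℝ) ^ a ≤ 2 ^ (1 : ℝ) := Real.rpow_le_rpow_of_exponent_le (by norm_num) ha.le
            _ = 2 := Real.rpow_one 2
        calc _ ≤ y * (2 * Real.log y ^ (-a)) * Real.exp ρ + 2 / Real.log y *
              (4 * C * y * (3 * Real.log y * Real.log y ^ (-a) / (1 - a)) * Real.exp ρ) := by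
              gcongr
          _ = _ := by
              field_simp
              ring

/-- If `∫_{[1,y]} dν(u) / u = o(log log y)`, its exponential is smaller than any power of `log y`, so
that the saving `log ^ (-a) y` survives. -/
theorem tendsto_lintegral_logMajorant_expTotal {ν : Measure ℝ} [SFinite ν] {C a : ℝ}
    (ha0 : 0 < a) (ha : a < 1) (hC : 0 ≤ C) (hν : ν (Iio 1) = 0)
    (hL : ∀ y, 0 ≤ y → ∫⁻ v in Iic y, ENNReal.ofReal (Real.log v) ∂ν ≤ ENNReal.ofReal (C * y))
    (hρ : ∀ ε : ℝ, 0 < ε → ∀ᶠ y in atTop,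
      ∫⁻ u in Iic y, ENNReal.ofReal u⁻¹ ∂ν ≤ ENNReal.ofReal (ε * Real.log (Real.log y))) :
    Tendsto (fun y : ℝ => (∫⁻ v, logMajorant a (y / v) ∂(expTotal ν)) / ENNReal.ofReal y)
      atTop (𝓝 0) := by
  have hlim : Tendsto (fun y : ℝ => ENNReal.ofReal ((2 + 24 * C / (1 - a)) *
      Real.log y ^ (-(a / 2)))) atTop (𝓝 0) := by
    rw [← ENNReal.ofReal_zero]
    refine ENNReal.tendsto_ofReal ?_
    rw [← mul_zero (2 + 24 * C / (1 - a))]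
    exact ((tendsto_rpow_neg_atTop (by positivity)).comp Real.tendsto_log_atTop).const_mul _
  refine tendsto_of_tendsto_of_tendsto_of_le_of_le' tendsto_const_nhds hlim
    (.of_forall fun _ => zero_le) ?_
  filter_upwards [hρ (a / 2) (by positivity), eventually_ge_atTop 3] with y h1 hy
  have hl1 : 1 ≤ Real.log y := by
    rw [Real.le_log_iff_exp_le (by linarith)]; linarith [Real.exp_one_lt_d9]
  have h2 := lintegral_logMajorant_expTotal_le ha0.le ha hC hν hL hy h1
    (mul_nonneg (by positivity) (Real.log_nonneg hl1))
  have h3 : Real.exp (a / 2 * Real.log (Real.log y)) = Real.log y ^ (a / 2) := by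
    rw [Real.rpow_def_of_pos (by linarith), mul_comm]
  rw [h3, mul_assoc, ← Real.rpow_add (by linarith)] at h2
  refine ENNReal.div_le_of_le_mul (h2.trans (le_of_eq ?_))
  rw [← ENNReal.ofReal_mul']
  · congr 1
    rw [show -a + a / 2 = -(a / 2) by ring]
    ring
  · linarith

theorem exists_lintegral_logMajorant_expTotal_le {ν : Measure ℝ} [SFinite ν] {a : ℝ}
    (ha0 : 0 ≤ a) (hν : ν (Iio 1) = 0)
    (hfin : ∀ y, ∫⁻ u in Iic y, ENNReal.ofReal u⁻¹ ∂ν ≠ ∞)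
    (hlim : Tendsto (fun y : ℝ => (∫⁻ v, logMajorant a (y / v) ∂(expTotal ν)) / ENNReal.ofReal y)
      atTop (𝓝 0)) :
    ∃ B : ℝ≥0∞, B ≠ ∞ ∧ ∀ y : ℝ, 0 < y →
      (∫⁻ v, logMajorant a (y / v) ∂(expTotal ν)) / ENNReal.ofReal y ≤ B := by
  obtain ⟨Y, hY⟩ := eventually_atTop.1 (hlim.eventually (ge_mem_nhds zero_lt_one))
  set I : ℝ≥0∞ := ∫⁻ u in Iic Y, ENNReal.ofReal u⁻¹ ∂(expTotal ν) with hI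
  refine ⟨max 1 I, ?_, fun y hy => ?_⟩
  · refine max_ne_top (by simp) ?_
    exact ne_top_of_le_ne_top ENNReal.ofReal_ne_top (lintegral_inv_expTotal_le hν (hfin Y))
  rcases le_or_gt Y y with h | h
  · exact (hY y h).trans (le_max_left _ _)
  · refine le_trans ?_ (le_max_right _ _)
    refine ENNReal.div_le_of_le_mul' ?_
    rw [hI, ← lintegral_const_mul _ (by fun_prop), ← lintegral_indicator measurableSet_Iic]
    refine lintegral_mono_ae ?_
    filter_upwards [ae_one_le (expTotal_Iio hν)] with v hv
    have hv0 : 0 < v := by linarith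
    by_cases hvY : v ∈ Iic Y
    · rw [indicator_of_mem hvY, ← ENNReal.ofReal_mul hy.le]
      exact logMajorant_le ha0
    · have : ¬ 1 ≤ y / v := by
        have hvY : Y < v := not_le.1 hvY
        rw [le_div_iff₀ hv0]; linarith
      rw [logMajorant, if_neg this]
      exact zero_le

namespace LSMeasure

theorem lintegral_inv_variation_ne_top (A : LSMeasure) (y : ℝ) :
    ∫⁻ u in Iic y, ENNReal.ofReal u⁻¹ ∂A.variation ≠ ∞ := by
  refine ne_top_of_le_ne_top (A.variation_Iic_ne_top y) ?_
  rw [← setLIntegral_one]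
  refine lintegral_mono_ae ?_
  filter_upwards [ae_restrict_of_ae (ae_one_le A.variation_Iio)] with u hu
  rw [← ENNReal.ofReal_one]
  exact ENNReal.ofReal_le_ofReal (inv_le_one_of_one_le₀ hu)

/-- A bound `M(x) = O(x / log ^ a x)` may be replaced by one that holds for all `x`, with an
exponent below `1`. -/
theorem exists_enorm_mobiusSum_le {P : LSMeasure} {a : ℝ} (ha : 0 < a)
    (hM : P.mobiusSum =O[atTop] fun x : ℝ => x / Real.log x ^ a) :
    ∃ b C : ℝ, 0 < b ∧ b < 1 ∧ 0 ≤ C ∧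
      ∀ x, ‖P.mobiusSum x‖ₑ ≤ ENNReal.ofReal C * logMajorant b x := by
  obtain ⟨c, hc, h⟩ := hM.exists_pos
  rw [isBigOWith_iff] at h
  obtain ⟨Z, hZ⟩ := eventually_atTop.1 h
  set b := min a (1 / 2) with hb
  have hb0 : 0 < b := by positivity
  have hb1 : b ≤ 1 / 2 := min_le_right _ _
  have hba : b ≤ a := min_le_left _ _
  set Z' := max Z 3 with hZ'
  set B : ℝ := (expTotal P.variation).real (Icc 1 Z') with hB
  refine ⟨b, max (2 ^ a * c) B, hb0, by linarith, le_max_of_le_left (by positivity), fun x => ?_⟩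
  rw [logMajorant]
  split_ifs with hx
  swap
  · rw [mobiusSum_eq_zero P (not_le.1 hx)]; simp
  have hlx : 0 ≤ Real.log x := Real.log_nonneg hx
  rw [← ENNReal.ofReal_mul (le_max_of_le_left (by positivity)), ← ofReal_norm]
  refine ENNReal.ofReal_le_ofReal ?_
  rcases le_or_gt Z' x with hxZ | hxZ
  · have hx3 : 3 ≤ x := (le_max_right _ _).trans hxZ
    have hl1 : 1 ≤ Real.log x := by
      rw [Real.le_log_iff_exp_le (by linarith)]; linarith [Real.exp_one_lt_d9]
    have hlp : 0 < Real.log x := by linarith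
    have h1 := hZ x ((le_max_left _ _).trans hxZ)
    rw [Real.norm_of_nonneg (by positivity : 0 ≤ x / Real.log x ^ a)] at h1
    have h2 : (Real.log x ^ a)⁻¹ ≤ 2 ^ a * (1 + Real.log x) ^ (-b) := by
      calc (Real.log x ^ a)⁻¹ ≤ (((1 + Real.log x) / 2) ^ a)⁻¹ := by
            gcongr
            linarith
        _ = 2 ^ a * (1 + Real.log x) ^ (-a) := by
            rw [Real.div_rpow (by positivity) (by norm_num), Real.rpow_neg (by positivity)]
            field_simp
        _ ≤ _ := by
            gcongr
            linarith
    calc ‖P.mobiusSum x‖ ≤ c * (x / Real.log x ^ a) := h1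
      _ ≤ c * (x * (2 ^ a * (1 + Real.log x) ^ (-b))) := by
          rw [div_eq_mul_inv]; gcongr
      _ = 2 ^ a * c * (x * (1 + Real.log x) ^ (-b)) := by ring
      _ ≤ _ := by
          gcongr
          exact le_max_left _ _
  · have h1 : ‖P.mobiusSum x‖ ≤ B := by
      have hfin := P.expTotal_Icc_ne_top Z'
      have hle : ∀ {μ : Measure ℝ}, μ ≤ expTotal P.variation → μ.real (Icc 1 x) ≤ B := by
        intro μ hμ
        refine ENNReal.toReal_mono hfin ((hμ _).trans (measure_mono ?_))
        exact Icc_subset_Icc_right hxZ.le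
      have h1 := hle (P.variation_neg ▸ (-P).expConv_fst_le)
      have h2 := hle (P.variation_neg ▸ (-P).expConv_snd_le)
      rw [mobiusSum, expPrimitive, Real.norm_eq_abs, abs_le]
      constructor <;> linarith [measureReal_nonneg (μ := (-P).expConv.1) (s := Icc 1 x),
        measureReal_nonneg (μ := (-P).expConv.2) (s := Icc 1 x)]
    have h2 : 1 ≤ x * (1 + Real.log x) ^ (-b) := by
      have h3 : 1 + Real.log x ≤ x := by linarith [Real.log_le_sub_one_of_pos (by linarith : 0 < x)]
      have h4 : (1 + Real.log x) ^ (-(1 : ℝ)) ≤ (1 + Real.log x) ^ (-b) :=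
        Real.rpow_le_rpow_of_exponent_le (by linarith) (by linarith)
      rw [Real.rpow_neg_one] at h4
      calc 1 = (1 + Real.log x) * (1 + Real.log x)⁻¹ := (mul_inv_cancel₀ (by linarith)).symm
        _ ≤ _ := by gcongr
    calc ‖P.mobiusSum x‖ ≤ B * 1 := by linarith
      _ ≤ _ := by
          gcongr
          exact le_max_right _ _

/-- Transfer of a bound for `M_{P₀}` to `M_P`, where `dP = dP₀ + dE + dR`: it is enough that `|dE|`
has a Chebyshev bound and that `∫_{[1,y]} |dE(u)| / u = o(log log y)`. -/
theorem mobiusSum_isLittleO_of_isSum₃ {P P₀ E R : LSMeasure} (h : IsSum₃ P P₀ E R) {a : ℝ}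
    (ha : 0 < a) (hM : P₀.mobiusSum =O[atTop] fun x : ℝ => x / Real.log x ^ a) {C : ℝ} (hC : 0 ≤ C)
    (hL : ∀ y, 0 ≤ y →
      ∫⁻ v in Iic y, ENNReal.ofReal (Real.log v) ∂E.variation ≤ ENNReal.ofReal (C * y))
    (hρ : ∀ ε : ℝ, 0 < ε → ∀ᶠ y in atTop, ∫⁻ u in Iic y, ENNReal.ofReal u⁻¹ ∂E.variation
      ≤ ENNReal.ofReal (ε * Real.log (Real.log y)))
    (hR : (∫⁻ u in Ici (1 : ℝ), ENNReal.ofReal u⁻¹ ∂(R.variation)) < ∞) :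
    P.mobiusSum =o[atTop] fun x : ℝ => x := by
  obtain ⟨b, D, hb0, hb1, hD, hb⟩ := exists_enorm_mobiusSum_le ha hM
  set J : ℝ → ℝ≥0∞ := fun y => ∫⁻ v, logMajorant b (y / v) ∂(expTotal E.variation) with hJ
  have hJm : Measurable J := Measurable.lintegral_prod_right'
    (f := fun p : ℝ × ℝ => logMajorant b (p.1 / p.2)) (by fun_prop)
  have hlim := tendsto_lintegral_logMajorant_expTotal hb0 hb1 hC E.variation_Iio hL hρ
  obtain ⟨B, hB, hJB⟩ := exists_lintegral_logMajorant_expTotal_le hb0.le E.variation_Iio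
    E.lintegral_inv_variation_ne_top hlim
  have hRfin : ∫⁻ w, ENNReal.ofReal w⁻¹ ∂(expTotal R.variation) ≠ ∞ := by
    refine ne_top_of_le_ne_top ENNReal.ofReal_ne_top (lintegral_expTotal_le R.variation_Iio
      (by fun_prop) (by simp) (fun u v hu hv => ?_) ?_)
    · rw [← ENNReal.ofReal_mul (by positivity), mul_inv]
    · rw [← lintegral_add_compl _ (measurableSet_Ici (a := (1 : ℝ))), compl_Ici,
        setLIntegral_measure_zero _ _ R.variation_Iio, add_zero]
      exact hR.ne
  have hdct : Tendsto (fun x : ℝ => ∫⁻ w, J (x / w) / ENNReal.ofReal (x / w) *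
      ENNReal.ofReal w⁻¹ ∂(expTotal R.variation)) atTop (𝓝 0) := by
    rw [← lintegral_zero (μ := expTotal R.variation)]
    refine tendsto_lintegral_filter_of_dominated_convergence
      (fun w => B * ENNReal.ofReal w⁻¹) (.of_forall fun x => ?_) ?_ ?_ ?_
    · exact ((hJm.comp (measurable_const.div measurable_id)).div (by fun_prop)).mul (by fun_prop)
    · filter_upwards [eventually_gt_atTop 0] with x hx
      filter_upwards [ae_one_le (expTotal_Iio R.variation_Iio)] with w hw
      gcongr
      exact hJB _ (div_pos hx (by linarith))
    · rw [lintegral_const_mul _ (by fun_prop)]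
      exact ENNReal.mul_ne_top hB hRfin
    · filter_upwards [ae_one_le (expTotal_Iio R.variation_Iio)] with w hw
      have h1 : Tendsto (fun x : ℝ => x / w) atTop atTop :=
        tendsto_id.atTop_div_const (by linarith)
      have h2 := ENNReal.Tendsto.mul_const (b := ENNReal.ofReal w⁻¹) (hlim.comp h1)
        (.inr ENNReal.ofReal_ne_top)
      rw [zero_mul] at h2
      exact h2
  have hdct' := ENNReal.Tendsto.const_mul (a := ENNReal.ofReal D) hdct (.inr ENNReal.ofReal_ne_top)
  rw [mul_zero] at hdct'
  have hbound : ∀ᶠ x : ℝ in atTop, ‖P.mobiusSum x‖ₑ ≤ (ENNReal.ofReal D *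
      ∫⁻ w, J (x / w) / ENNReal.ofReal (x / w) * ENNReal.ofReal w⁻¹ ∂(expTotal R.variation))
      * ENNReal.ofReal x := by
    filter_upwards [eventually_gt_atTop 0] with x hx
    rw [mul_assoc, ← lintegral_mul_const' _ _ ENNReal.ofReal_ne_top]
    refine (enorm_mobiusSum_le h x).trans ?_
    rw [← lintegral_const_mul' _ _ ENNReal.ofReal_ne_top]
    refine lintegral_mono_ae ?_
    filter_upwards [ae_one_le (expTotal_Iio R.variation_Iio)] with w hw
    have hw0 : 0 < w := by linarith
    calc ∫⁻ v, ‖P₀.mobiusSum (x / w / v)‖ₑ ∂(expTotal E.variation)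
        ≤ ∫⁻ v, ENNReal.ofReal D * logMajorant b (x / w / v) ∂(expTotal E.variation) :=
          lintegral_mono fun v => hb _
      _ = ENNReal.ofReal D * J (x / w) := lintegral_const_mul _ (by fun_prop)
      _ = _ := by
          rw [mul_assoc, ← ENNReal.ofReal_mul (by positivity), mul_comm w⁻¹ x, ← div_eq_mul_inv,
            ENNReal.div_mul_cancel (by simpa using by positivity) ENNReal.ofReal_ne_top]
  rw [isLittleO_iff]
  intro c hc
  filter_upwards [hbound, hdct'.eventually (ge_mem_nhds (ENNReal.ofReal_pos.2 hc)),
    eventually_gt_atTop 0] with x h1 h2 hx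
  have h3 := h1.trans (mul_le_mul_left h2 _)
  rw [← ENNReal.ofReal_mul hc.le, ← ofReal_norm] at h3
  rw [Real.norm_of_nonneg hx.le]
  exact (ENNReal.ofReal_le_ofReal_iff (by positivity)).1 h3

end LSMeasure

/-! ### The logarithmic density and Abelian estimates -/

/-- The density `(1 - u⁻¹) / log u` as an average of powers of `u`. -/
theorem integral_rpow_neg_eq {u : ℝ} (hu : 1 < u) :
    ∫ w in (0 : ℝ)..1, u ^ (-w) = (1 - u⁻¹) / Real.log u := by
  have hl : Real.log u ≠ 0 := (Real.log_pos hu).ne'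
  have h : ∀ w : ℝ, HasDerivAt (fun w : ℝ => -(u ^ (-w)) / Real.log u) (u ^ (-w)) w := by
    intro w
    have h1 := ((hasDerivAt_neg w).const_rpow (a := u) (by linarith))
    have h2 := (h1.neg).div_const (Real.log u)
    refine h2.congr_deriv ?_
    field_simp
  rw [intervalIntegral.integral_eq_sub_of_hasDerivAt (fun w _ => h w)]
  · rw [Real.rpow_neg_one, neg_zero, Real.rpow_zero]; ring
  · refine Continuous.intervalIntegrable ?_ _ _
    exact Real.continuous_const_rpow (by linarith) |>.comp continuous_neg

theorem lintegral_Ioi_rpow_neg {c p : ℝ} (hc : 0 < c) (hp : 1 < p) :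
    ∫⁻ u in Ioi c, ENNReal.ofReal (u ^ (-p)) = ENNReal.ofReal (c ^ (1 - p) / (p - 1)) := by
  rw [← ofReal_integral_eq_lintegral_ofReal]
  · rw [integral_Ioi_rpow_of_lt (by linarith) hc]
    congr 1
    rw [show -p + 1 = -(p - 1) by ring, neg_div_neg_eq, neg_sub]
  · exact integrableOn_Ioi_rpow_of_lt (by linarith) hc
  · filter_upwards [ae_restrict_mem measurableSet_Ioi] with u hu
    exact Real.rpow_nonneg (hc.le.trans (le_of_lt hu)) _

/-- The density of the logarithmic integral. -/
def logDensity (u : ℝ) : ℝ := (1 - u⁻¹) / Real.log u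

@[fun_prop]
theorem measurable_logDensity : Measurable logDensity := by
  unfold logDensity; fun_prop

theorem logDensity_nonneg {u : ℝ} (hu : 1 ≤ u) : 0 ≤ logDensity u :=
  div_nonneg (by linarith [inv_le_one_of_one_le₀ hu]) (Real.log_nonneg hu)

theorem logDensity_le_one {u : ℝ} (hu : 1 ≤ u) : logDensity u ≤ 1 :=
  div_le_one_of_le₀ (Real.one_sub_inv_le_log_of_pos (by linarith)) (Real.log_nonneg hu)

theorem ofReal_logDensity_eq_lintegral {u : ℝ} (hu : 1 < u) :
    ENNReal.ofReal (logDensity u) = ∫⁻ w in Ioc (0 : ℝ) 1, ENNReal.ofReal (u ^ (-w)) := by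
  rw [logDensity, ← integral_rpow_neg_eq hu, intervalIntegral.integral_of_le zero_le_one,
    ofReal_integral_eq_lintegral_ofReal]
  · refine Integrable.mono_measure (ν := volume.restrict (Icc (0 : ℝ) 1)) ?_
      (Measure.restrict_mono Ioc_subset_Icc_self le_rfl)
    refine Continuous.integrableOn_Icc ?_
    exact (Real.continuous_const_rpow (by linarith)).comp continuous_neg
  · exact .of_forall fun w => Real.rpow_nonneg (by linarith) _

/-- The Mellin transform of the logarithmic density on the real axis is `log (s / (s - 1))`. -/
theorem lintegral_logDensity_mul_rpow {δ : ℝ} (hδ : 0 < δ) :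
    ∫⁻ u in Ioi (1 : ℝ), ENNReal.ofReal (logDensity u) * ENNReal.ofReal (u ^ (-(1 + δ)))
      = ENNReal.ofReal (Real.log ((1 + δ) / δ)) := by
  have h1 : ∫⁻ u in Ioi (1 : ℝ), ENNReal.ofReal (logDensity u) * ENNReal.ofReal (u ^ (-(1 + δ)))
      = ∫⁻ u in Ioi (1 : ℝ), ∫⁻ w in Ioc (0 : ℝ) 1, ENNReal.ofReal (u ^ (-(1 + δ + w))) := by
    refine setLIntegral_congr_fun measurableSet_Ioi fun u hu => ?_
    have hu : 1 < u := hu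
    rw [ofReal_logDensity_eq_lintegral hu, ← lintegral_mul_const _ (by fun_prop)]
    refine lintegral_congr fun w => ?_
    rw [← ENNReal.ofReal_mul (by positivity), ← Real.rpow_add (by linarith)]
    congr 2
    ring
  have h2 : ∫⁻ w in Ioc (0 : ℝ) 1, ∫⁻ u in Ioi (1 : ℝ), ENNReal.ofReal (u ^ (-(1 + δ + w)))
      = ∫⁻ w in Ioc (0 : ℝ) 1, ENNReal.ofReal ((δ + w)⁻¹) := by
    refine setLIntegral_congr_fun measurableSet_Ioc fun w hw => ?_
    rw [lintegral_Ioi_rpow_neg one_pos (by linarith [hw.1]), Real.one_rpow, one_div]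
    congr 2
    ring
  rw [h1, lintegral_lintegral_swap (by fun_prop), h2, ← ofReal_integral_eq_lintegral_ofReal,
    ← intervalIntegral.integral_of_le zero_le_one]
  · congr 1
    have := intervalIntegral.integral_comp_add_left (a := (0 : ℝ)) (b := 1)
      (fun x : ℝ => x⁻¹) δ
    rw [this, add_zero, integral_inv_of_pos hδ (by linarith), add_comm]
  · refine Integrable.mono_measure (ν := volume.restrict (Icc (0 : ℝ) 1)) ?_
      (Measure.restrict_mono Ioc_subset_Icc_self le_rfl)
    refine ContinuousOn.integrableOn_Icc ?_
    refine ContinuousOn.inv₀ (by fun_prop) fun w hw => ?_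
    linarith [hw.1]
  · filter_upwards [ae_restrict_mem measurableSet_Ioc] with w hw
    have := hw.1
    positivity

/-- Abelian estimate: a function that is `o(u / log u)` has a Mellin transform that is
`o(log (1 / δ))` at `1 + δ`. -/
theorem eventually_lintegral_mul_rpow_le {f : ℝ → ℝ} (hbdd : ∀ U, ∃ B, ∀ u, 1 < u → u ≤ U →
      |f u| ≤ B) (ho : f =o[atTop] fun u : ℝ => u / Real.log u) {ε : ℝ} (hε : 0 < ε) :
    ∀ᶠ δ : ℝ in 𝓝[>] 0, ∫⁻ u in Ioi (1 : ℝ), ENNReal.ofReal |f u| *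
      ENNReal.ofReal (u ^ (-(2 + δ))) ≤ ENNReal.ofReal (ε * Real.log δ⁻¹) := by
  obtain ⟨U, hU⟩ := eventually_atTop.1 (isLittleO_iff.1 ho (by positivity : 0 < ε / 4))
  obtain ⟨B, hB⟩ := hbdd (max U 2)
  have hbig : ∀ᶠ δ : ℝ in 𝓝[>] 0, |B| + ε / 2 ≤ ε / 2 * Real.log δ⁻¹ := by
    have : Tendsto (fun δ : ℝ => ε / 2 * Real.log δ⁻¹) (𝓝[>] 0) atTop :=
      (Real.tendsto_log_atTop.comp tendsto_inv_nhdsGT_zero).const_mul_atTop (by positivity)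
    exact this.eventually_ge_atTop _
  filter_upwards [hbig, self_mem_nhdsWithin, Ioo_mem_nhdsGT (zero_lt_one (α := ℝ))]
    with δ h1 hδ hδ1
  have hδ : 0 < δ := hδ
  have hpt : ∀ u : ℝ, 1 < u → |f u| * u ^ (-(2 + δ))
      ≤ |B| * u ^ (-(2 : ℝ)) + ε / 2 * (logDensity u * u ^ (-(1 + δ))) := by
    intro u hu
    have hu0 : 0 < u := by linarith
    have hpow : 0 ≤ u ^ (-(2 + δ)) := by positivity
    have hld : 0 ≤ logDensity u := logDensity_nonneg hu.le
    rcases le_or_gt u (max U 2) with h | h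
    · have h2 : |f u| ≤ |B| := (hB u hu h).trans (le_abs_self B)
      have h3 : u ^ (-(2 + δ)) ≤ u ^ (-(2 : ℝ)) :=
        Real.rpow_le_rpow_of_exponent_le hu.le (by linarith)
      have h4 : |f u| * u ^ (-(2 + δ)) ≤ |B| * u ^ (-(2 : ℝ)) := by gcongr
      have h5 : 0 ≤ ε / 2 * (logDensity u * u ^ (-(1 + δ))) := by positivity
      linarith
    · have h2 := hU u ((le_max_left _ _).trans h.le)
      have hu2 : 2 < u := (le_max_right _ _).trans_lt h
      have hl : 0 < Real.log u := Real.log_pos hu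
      rw [Real.norm_eq_abs, Real.norm_of_nonneg (by positivity : 0 ≤ u / Real.log u)] at h2
      have h3 : ε / 4 * (u / Real.log u) ≤ ε / 2 * (u * logDensity u) := by
        rw [logDensity]
        have h4 : u⁻¹ ≤ 1 / 2 := by rw [inv_le_comm₀ hu0 (by norm_num)]; linarith
        have h5 : u / Real.log u * (1 / 2) ≤ u / Real.log u * (1 - u⁻¹) := by
          gcongr; linarith
        have h6 : u * ((1 - u⁻¹) / Real.log u) = u / Real.log u * (1 - u⁻¹) := by ring
        rw [h6]
        nlinarith
      have h4 : u * u ^ (-(2 + δ)) = u ^ (-(1 + δ)) := by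
        nth_rewrite 1 [← Real.rpow_one u]
        rw [← Real.rpow_add hu0]; congr 1; ring
      calc |f u| * u ^ (-(2 + δ)) ≤ ε / 2 * (u * logDensity u) * u ^ (-(2 + δ)) := by
            gcongr; linarith
        _ = ε / 2 * (logDensity u * (u * u ^ (-(2 + δ)))) := by ring
        _ = ε / 2 * (logDensity u * u ^ (-(1 + δ))) := by rw [h4]
        _ ≤ _ := by
            have : 0 ≤ |B| * u ^ (-(2 : ℝ)) := by positivity
            linarith
  calc ∫⁻ u in Ioi (1 : ℝ), ENNReal.ofReal |f u| * ENNReal.ofReal (u ^ (-(2 + δ)))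
      ≤ ∫⁻ u in Ioi (1 : ℝ), (ENNReal.ofReal |B| * ENNReal.ofReal (u ^ (-(2 : ℝ)))
        + ENNReal.ofReal (ε / 2) * (ENNReal.ofReal (logDensity u)
          * ENNReal.ofReal (u ^ (-(1 + δ))))) := by
        refine setLIntegral_mono (by fun_prop) fun u hu => ?_
        have hu : 1 < u := hu
        have hld : 0 ≤ logDensity u := logDensity_nonneg hu.le
        rw [← ENNReal.ofReal_mul (abs_nonneg _), ← ENNReal.ofReal_mul (abs_nonneg _),
          ← ENNReal.ofReal_mul hld, ← ENNReal.ofReal_mul (by positivity),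
          ← ENNReal.ofReal_add (by positivity) (by positivity)]
        exact ENNReal.ofReal_le_ofReal (hpt u hu)
    _ = ENNReal.ofReal |B| * ENNReal.ofReal 1
        + ENNReal.ofReal (ε / 2) * ENNReal.ofReal (Real.log ((1 + δ) / δ)) := by
        rw [lintegral_add_left (by fun_prop), lintegral_const_mul _ (by fun_prop),
          lintegral_const_mul _ (by fun_prop), lintegral_logDensity_mul_rpow hδ,
          lintegral_Ioi_rpow_neg one_pos (by norm_num)]
        norm_num
    _ = ENNReal.ofReal (|B| + ε / 2 * Real.log ((1 + δ) / δ)) := by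
        have : 0 ≤ Real.log ((1 + δ) / δ) :=
          Real.log_nonneg (by rw [le_div_iff₀ hδ]; linarith)
        rw [ENNReal.ofReal_one, mul_one, ← ENNReal.ofReal_mul (by positivity),
          ← ENNReal.ofReal_add (by positivity) (by positivity)]
    _ ≤ _ := by
        refine ENNReal.ofReal_le_ofReal ?_
        rw [Real.log_div (by linarith) hδ.ne', Real.log_inv] at *
        have h3 : Real.log (1 + δ) ≤ 1 := by
          have := Real.log_le_sub_one_of_pos (by linarith : 0 < 1 + δ)
          linarith [hδ1.2]
        nlinarith

/-- Partial summation for a positive measure on `[1, ∞)`. -/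
theorem lintegral_rpow_eq_mul_lintegral {ν : Measure ℝ} [SFinite ν] (hν : ν (Iio 1) = 0) {p : ℝ}
    (hp : 0 < p) :
    ∫⁻ u, ENNReal.ofReal (u ^ (-p)) ∂ν
      = ENNReal.ofReal p * ∫⁻ t in Ioi (1 : ℝ), ν (Iic t) * ENNReal.ofReal (t ^ (-(1 + p))) := by
  have hm : Measurable fun q : ℝ × ℝ =>
      (Ici q.1).indicator (fun t : ℝ => ENNReal.ofReal (t ^ (-(1 + p)))) q.2 := by
    have : (fun q : ℝ × ℝ => (Ici q.1).indicator (fun t : ℝ => ENNReal.ofReal (t ^ (-(1 + p)))) q.2)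
        = {q : ℝ × ℝ | q.1 ≤ q.2}.indicator fun q => ENNReal.ofReal (q.2 ^ (-(1 + p))) := rfl
    rw [this]
    exact Measurable.indicator (by fun_prop) (measurableSet_le measurable_fst measurable_snd)
  have h1 : ∀ t, ν (Iic t) * ENNReal.ofReal (t ^ (-(1 + p)))
      = ∫⁻ u, (Ici u).indicator (fun t : ℝ => ENNReal.ofReal (t ^ (-(1 + p)))) t ∂ν := by
    intro t
    rw [mul_comm, ← lintegral_indicator_const measurableSet_Iic]
    refine lintegral_congr fun u => ?_
    by_cases h : u ≤ t
    · rw [indicator_of_mem (show u ∈ Iic t from h), indicator_of_mem (show t ∈ Ici u from h)]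
    · rw [indicator_of_notMem (show u ∉ Iic t from h), indicator_of_notMem (show t ∉ Ici u from h)]
  simp_rw [h1]
  rw [lintegral_lintegral_swap (by
    refine Measurable.aemeasurable ?_
    exact hm.comp measurable_swap),
    ← lintegral_const_mul' _ _ ENNReal.ofReal_ne_top]
  refine lintegral_congr_ae ?_
  filter_upwards [ae_one_le hν] with u hu
  have hu0 : 0 < u := by linarith
  rw [lintegral_indicator measurableSet_Ici, Measure.restrict_restrict measurableSet_Ici]
  have h2 : (Ici u ∩ Ioi 1 : Set ℝ) =ᵐ[volume] Ioi u := by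
    refine (Ioi_ae_eq_Ici.symm.inter (ae_eq_refl (Ioi (1 : ℝ)))).trans ?_
    rw [Ioi_inter_Ioi, max_eq_left hu]
    exact ae_eq_refl _
  rw [Measure.restrict_congr_set h2, lintegral_Ioi_rpow_neg hu0 (by linarith),
    ← ENNReal.ofReal_mul hp.le]
  congr 1
  rw [show 1 - (1 + p) = -p by ring, show 1 + p - 1 = p by ring]
  field_simp

/-- Rankin's trick with `δ = 1 / log y`. -/
theorem eventually_lintegral_inv_le {ν : Measure ℝ} [SFinite ν] (hν : ν (Iio 1) = 0)
    (h : ∀ ε : ℝ, 0 < ε → ∀ᶠ δ : ℝ in 𝓝[>] 0, ∫⁻ t in Ioi (1 : ℝ), ν (Iic t) *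
      ENNReal.ofReal (t ^ (-(2 + δ))) ≤ ENNReal.ofReal (ε * Real.log δ⁻¹)) {ε : ℝ} (hε : 0 < ε) :
    ∀ᶠ y in atTop, ∫⁻ u in Iic y, ENNReal.ofReal u⁻¹ ∂ν
      ≤ ENNReal.ofReal (ε * Real.log (Real.log y)) := by
  have ht : Tendsto (fun y : ℝ => (Real.log y)⁻¹) atTop (𝓝[>] 0) :=
    tendsto_inv_atTop_nhdsGT_zero.comp Real.tendsto_log_atTop
  filter_upwards [ht.eventually (h (ε / 6) (by positivity)), eventually_ge_atTop 3] with y h1 hy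
  have hl1 : 1 ≤ Real.log y := by
    rw [Real.le_log_iff_exp_le (by linarith)]; linarith [Real.exp_one_lt_d9]
  set δ := (Real.log y)⁻¹ with hδ
  have hδ0 : 0 < δ := by positivity
  have hδ1 : δ ≤ 1 := inv_le_one_of_one_le₀ hl1
  rw [hδ, inv_inv, ← hδ] at h1
  have hm : Measurable fun u : ℝ => ENNReal.ofReal (u ^ (-(1 + δ))) := by fun_prop
  calc ∫⁻ u in Iic y, ENNReal.ofReal u⁻¹ ∂ν
      ≤ ∫⁻ u in Iic y, ENNReal.ofReal (Real.exp 1) * ENNReal.ofReal (u ^ (-(1 + δ))) ∂ν := by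
        refine lintegral_mono_ae ?_
        filter_upwards [ae_restrict_of_ae (ae_one_le hν), ae_restrict_mem measurableSet_Iic]
          with u hu huy
        have hu0 : 0 < u := by linarith
        have huy : u ≤ y := huy
        rw [← ENNReal.ofReal_mul (by positivity)]
        refine ENNReal.ofReal_le_ofReal ?_
        have h2 : u ^ δ ≤ Real.exp 1 := by
          rw [Real.rpow_def_of_pos hu0, Real.exp_le_exp, hδ, ← div_eq_mul_inv,
            div_le_one (by linarith)]
          exact Real.log_le_log hu0 huy
        calc u⁻¹ = u ^ δ * u ^ (-(1 + δ)) := by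
              rw [← Real.rpow_add hu0, ← Real.rpow_neg_one]; congr 1; ring
          _ ≤ _ := by gcongr
    _ ≤ ENNReal.ofReal (Real.exp 1) * ∫⁻ u, ENNReal.ofReal (u ^ (-(1 + δ))) ∂ν := by
        rw [← lintegral_const_mul _ hm]
        exact setLIntegral_le_lintegral _ _
    _ = ENNReal.ofReal (Real.exp 1) * (ENNReal.ofReal (1 + δ) * ∫⁻ t in Ioi (1 : ℝ), ν (Iic t) *
          ENNReal.ofReal (t ^ (-(2 + δ)))) := by
        rw [lintegral_rpow_eq_mul_lintegral hν (by linarith)]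
        simp_rw [show 1 + (1 + δ) = 2 + δ by ring]
    _ ≤ ENNReal.ofReal (Real.exp 1) * (ENNReal.ofReal (1 + δ) *
          ENNReal.ofReal (ε / 6 * Real.log (Real.log y))) := by gcongr
    _ ≤ _ := by
        rw [← ENNReal.ofReal_mul (by positivity), ← ENNReal.ofReal_mul (by positivity)]
        refine ENNReal.ofReal_le_ofReal ?_
        have hll : 0 ≤ Real.log (Real.log y) := Real.log_nonneg hl1
        have h3 : Real.exp 1 * (1 + δ) ≤ 6 := by
          nlinarith [Real.exp_one_lt_d9, Real.exp_pos 1]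
        calc _ = Real.exp 1 * (1 + δ) * (ε / 6 * Real.log (Real.log y)) := by ring
          _ ≤ 6 * (ε / 6 * Real.log (Real.log y)) := by gcongr
          _ = _ := by ring

/-- A Chebyshev bound for a measure bounds its logarithmic moment. -/
theorem lintegral_log_le_of_isBigO {ν : Measure ℝ} (hν : ν (Iio 1) = 0)
    (hfin : ∀ y, ν (Iic y) ≠ ∞)
    (hO : (fun y => ν.real (Iic y)) =O[atTop] fun y : ℝ => y / Real.log y) :
    ∃ C : ℝ, 0 ≤ C ∧ ∀ y, 0 ≤ y →
      ∫⁻ v in Iic y, ENNReal.ofReal (Real.log v) ∂ν ≤ ENNReal.ofReal (C * y) := by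
  obtain ⟨c, hc, h⟩ := hO.exists_pos
  rw [isBigOWith_iff] at h
  obtain ⟨Y, hY⟩ := eventually_atTop.1 h
  set Y' := max Y 2 with hY'
  refine ⟨max c (ν.real (Iic Y')), le_max_of_le_left hc.le, fun y hy => ?_⟩
  have h1 : ∫⁻ v in Iic y, ENNReal.ofReal (Real.log v) ∂ν
      ≤ ENNReal.ofReal (Real.log y * ν.real (Iic y)) := by
    rw [ENNReal.ofReal_mul' measureReal_nonneg, ofReal_measureReal (hfin y), ← setLIntegral_const]
    refine lintegral_mono_ae ?_
    filter_upwards [ae_restrict_of_ae (ae_one_le hν), ae_restrict_mem measurableSet_Iic]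
      with u hu huy
    exact ENNReal.ofReal_le_ofReal (Real.log_le_log (by linarith) huy)
  refine h1.trans (ENNReal.ofReal_le_ofReal ?_)
  rcases le_or_gt Y' y with hy1 | hy1
  · have hy2 : 2 ≤ y := (le_max_right _ _).trans hy1
    have hl : 0 < Real.log y := Real.log_pos (by linarith)
    have h2 := hY y ((le_max_left _ _).trans hy1)
    rw [Real.norm_of_nonneg measureReal_nonneg,
      Real.norm_of_nonneg (by positivity : 0 ≤ y / Real.log y)] at h2
    calc Real.log y * ν.real (Iic y) ≤ Real.log y * (c * (y / Real.log y)) := by gcongr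
      _ = c * y := by field_simp
      _ ≤ _ := by gcongr; exact le_max_left _ _
  · have h2 : ν.real (Iic y) ≤ ν.real (Iic Y') :=
      measureReal_mono (Iic_subset_Iic.2 hy1.le) (hfin _)
    have h3 : Real.log y ≤ y := by
      rcases hy.eq_or_lt with rfl | hy0
      · simp
      · linarith [Real.log_le_sub_one_of_pos hy0]
    calc Real.log y * ν.real (Iic y) ≤ y * ν.real (Iic Y') :=
          mul_le_mul h3 h2 measureReal_nonneg hy
      _ = ν.real (Iic Y') * y := mul_comm _ _
      _ ≤ _ := by gcongr; exact le_max_right _ _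

/-! ### Perturbations of a prime measure -/

theorem measure_Iic_eq_Icc {ν : Measure ℝ} (hν : ν (Iio 1) = 0) (y : ℝ) :
    ν (Iic y) = ν (Icc 1 y) := by
  refine measure_congr ?_
  filter_upwards [ae_one_le hν] with u hu
  exact propext ⟨fun h => ⟨hu, h⟩, fun h => h.2⟩

theorem le_ofReal_sub_of_add_le {X : ℝ≥0∞} {p q : ℝ}
    (h : X + ENNReal.ofReal q ≤ ENNReal.ofReal p) (hq : 0 ≤ q) : X ≤ ENNReal.ofReal (p - q) := by
  rw [ENNReal.ofReal_sub _ hq]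
  exact ENNReal.le_sub_of_add_le_right ENNReal.ofReal_ne_top h

namespace LSMeasure

/-- If `∫_{[1,x]} |dE| = o(x / log x)`, then `|dE|` has a Chebyshev bound, and an Abelian estimate
followed by Rankin's trick gives `∫_{[1,y]} |dE(u)| / u = o(log log y)`. -/
theorem mobiusSum_isLittleO_of_variation_isLittleO {P P₀ E R : LSMeasure} (h : IsSum₃ P P₀ E R)
    {a : ℝ} (ha : 0 < a) (hM : P₀.mobiusSum =O[atTop] fun x : ℝ => x / Real.log x ^ a)
    (hE : (fun x : ℝ => E.variation.real (Icc 1 x)) =o[atTop] fun x : ℝ => x / Real.log x)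
    (hR : (∫⁻ u in Ici (1 : ℝ), ENNReal.ofReal u⁻¹ ∂(R.variation)) < ∞) :
    P.mobiusSum =o[atTop] fun x : ℝ => x := by
  have hE' : (fun x : ℝ => E.variation.real (Iic x)) =o[atTop] fun x : ℝ => x / Real.log x := by
    simp_rw [measureReal_def, measure_Iic_eq_Icc E.variation_Iio]; exact hE
  obtain ⟨C, hC, hL⟩ := lintegral_log_le_of_isBigO E.variation_Iio E.variation_Iic_ne_top
    hE'.isBigO
  refine mobiusSum_isLittleO_of_isSum₃ h ha hM hC hL (fun ε hε => ?_) hR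
  refine eventually_lintegral_inv_le E.variation_Iio (fun ε hε => ?_) hε
  have hA := eventually_lintegral_mul_rpow_le (f := fun x => E.variation.real (Iic x))
    (fun U => ⟨E.variation.real (Iic U), fun u _ hu => ?_⟩) hE' hε
  · simpa only [abs_of_nonneg measureReal_nonneg, ofReal_measureReal (E.variation_Iic_ne_top _)]
      using hA
  · rw [abs_of_nonneg measureReal_nonneg]
    exact measureReal_mono (Iic_subset_Iic.2 hu) (E.variation_Iic_ne_top U)

theorem abs_primitive_le (P : LSMeasure) (x : ℝ) : |P.primitive x| ≤ P.variation.real (Iic x) := by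
  have h1 : P.pos.real (Icc 1 x) ≤ P.variation.real (Iic x) :=
    ENNReal.toReal_mono (P.variation_Iic_ne_top x)
      ((Measure.le_add_right le_rfl : P.pos ≤ P.variation) _ |>.trans
        (measure_mono fun u hu => hu.2))
  have h2 : P.neg.real (Icc 1 x) ≤ P.variation.real (Iic x) :=
    ENNReal.toReal_mono (P.variation_Iic_ne_top x)
      ((Measure.le_add_left le_rfl : P.neg ≤ P.variation) _ |>.trans
        (measure_mono fun u hu => hu.2))
  rw [primitive, val, abs_le]
  constructor <;> linarith [measureReal_nonneg (μ := P.pos) (s := Icc 1 x),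
    measureReal_nonneg (μ := P.neg) (s := Icc 1 x)]

/-- The data on a reference prime measure `dP₀ ≥ 0` that enter the treatment of monotone
perturbations: a bound for `M_{P₀}`, a Chebyshev bound, and the size of the Mellin transform
`∫ u ^ (-(1 + δ)) dP₀(u) = log (1 / δ) + O(1)`. -/
structure IsReference (P₀ : LSMeasure) : Prop where
  neg_eq_zero : P₀.neg = 0
  mobiusSum_isBigO : ∃ a : ℝ, 0 < a ∧ P₀.mobiusSum =O[atTop] fun x : ℝ => x / Real.log x ^ a
  chebyshev : (fun y => P₀.pos.real (Iic y)) =O[atTop] fun y : ℝ => y / Real.log y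
  mellin : ∃ K : ℝ, 0 ≤ K ∧ ∀ δ : ℝ, 0 < δ → δ ≤ 1 →
    ENNReal.ofReal (Real.log δ⁻¹ - K) ≤ ∫⁻ u, ENNReal.ofReal (u ^ (-(1 + δ))) ∂P₀.pos ∧
    ∫⁻ u, ENNReal.ofReal (u ^ (-(1 + δ))) ∂P₀.pos ≤ ENNReal.ofReal (Real.log δ⁻¹ + K)

/-- The prime number theorem, with `x / log x` replaced by a function whose Mellin transform is
explicit. -/
theorem sub_mul_logDensity_isLittleO {P : LSMeasure}
    (hP : P.primitive ~[atTop] fun x : ℝ => x / Real.log x) :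
    (fun u => P.primitive u - u * logDensity u) =o[atTop] fun u : ℝ => u / Real.log u := by
  have h1 : (fun u : ℝ => (Real.log u)⁻¹) =o[atTop] fun u : ℝ => u / Real.log u := by
    have h0 : (fun _ : ℝ => (1 : ℝ)) =o[atTop] fun u : ℝ => u := isLittleO_const_id_atTop 1
    have := h0.mul_isBigO (isBigO_refl (fun u : ℝ => (Real.log u)⁻¹) atTop)
    simpa [div_eq_mul_inv] using this
  refine (hP.isLittleO.add h1).congr' ?_ EventuallyEq.rfl
  filter_upwards [eventually_gt_atTop 1] with u hu
  have hl : Real.log u ≠ 0 := (Real.log_pos hu).ne'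
  simp only [logDensity, Pi.sub_apply]
  field_simp
  ring

/-- For a monotone `E` the variation of `dE` is `± (P - P₀)`, so that no rate in the prime number
theorem is needed for `P₀`: the transforms of `P₀` and of the logarithmic density at `1 + δ` are both
`log (1 / δ) + O(1)`, and that of their difference with `P` is `o(log (1 / δ))`. -/
theorem mobiusSum_isLittleO_of_monotone {P P₀ E : LSMeasure} (h₀ : P₀.IsReference)
    (h : IsSum P P₀ E) (hE : E.neg = 0 ∨ E.pos = 0)
    (hP : P.primitive ~[atTop] fun x : ℝ => x / Real.log x) :
    P.mobiusSum =o[atTop] fun x : ℝ => x := by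
  obtain ⟨hneg, ⟨a, ha, hM⟩, hCh, K, hK0, hK⟩ := h₀
  set R : LSMeasure := .ofMeasure 0 inferInstance rfl with hR
  have hsum : IsSum₃ P P₀ E R := fun s hs hb => by
    rw [h s hs hb]; simp [val, hR, ofMeasure]
  have hPr : ∀ u, P.primitive u = P₀.pos.real (Iic u) + E.primitive u := fun u => by
    rw [primitive, h _ measurableSet_Icc (Metric.isBounded_Icc 1 u), val, hneg]
    simp [primitive, measureReal_def, measure_Iic_eq_Icc P₀.pos_Iio]
  have hEvar : ∀ u, E.variation.real (Iic u) = |E.primitive u| := by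
    intro u
    rw [measureReal_def, measure_Iic_eq_Icc E.variation_Iio, primitive, val, variation]
    rcases hE with h0 | h0
    · rw [h0]; simp [measureReal_def]
    · rw [h0]; simp [measureReal_def]
  have hEO : (fun y => E.variation.real (Iic y)) =O[atTop] fun y : ℝ => y / Real.log y := by
    simp_rw [hEvar]
    refine IsBigO.abs_left ?_
    refine (hP.isBigO.sub hCh).congr_left fun u => ?_
    rw [hPr]; ring
  obtain ⟨C, hC, hL⟩ := lintegral_log_le_of_isBigO E.variation_Iio E.variation_Iic_ne_top hEO
  refine mobiusSum_isLittleO_of_isSum₃ hsum ha hM hC hL (fun ε hε => ?_)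
    (by simp [hR, ofMeasure, variation])
  refine eventually_lintegral_inv_le E.variation_Iio (fun ε hε => ?_) hε
  set f : ℝ → ℝ := fun u => P.primitive u - u * logDensity u with hf
  have hfo := sub_mul_logDensity_isLittleO hP
  have hA := eventually_lintegral_mul_rpow_le (f := f) (fun U => by
    refine ⟨P.variation.real (Iic U) + U, fun u hu1 huU => ?_⟩
    have h1 : |P.primitive u| ≤ P.variation.real (Iic U) :=
      (P.abs_primitive_le u).trans (measureReal_mono (Iic_subset_Iic.2 huU)
        (P.variation_Iic_ne_top U))
    have h2 : |u * logDensity u| ≤ U := by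
      rw [abs_of_nonneg (mul_nonneg (by linarith) (logDensity_nonneg hu1.le))]
      nlinarith [logDensity_le_one hu1.le]
    exact (abs_sub _ _).trans (add_le_add h1 h2)) hfo (by positivity : 0 < ε / 2)
  have hbig : ∀ᶠ δ : ℝ in 𝓝[>] 0, (K + 2) * max 1 (ε / 2)⁻¹ ≤ Real.log δ⁻¹ :=
    (Real.tendsto_log_atTop.comp tendsto_inv_nhdsGT_zero).eventually_ge_atTop _
  filter_upwards [hA, hbig, self_mem_nhdsWithin, Ioo_mem_nhdsGT (zero_lt_one (α := ℝ))]
    with δ hAδ hbδ hδ hδ1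
  have hδ : 0 < δ := hδ
  set L := Real.log δ⁻¹ with hLdef
  have hL1 : K + 2 ≤ L := le_trans (le_mul_of_one_le_right (by positivity) (le_max_left _ _)) hbδ
  have hL2 : K + 2 ≤ ε / 2 * L := by
    have : (K + 2) * (ε / 2)⁻¹ ≤ L :=
      (mul_le_mul_of_nonneg_left (le_max_right _ _) (by positivity)).trans hbδ
    rw [← div_eq_mul_inv, div_le_iff₀ (by positivity)] at this
    linarith
  have hδL : δ * L ≤ 1 := by
    have := Real.log_le_sub_one_of_pos (inv_pos.2 hδ)
    calc δ * L ≤ δ * δ⁻¹ := by gcongr; linarith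
      _ = 1 := mul_inv_cancel₀ hδ.ne'
  -- the two transforms of size `log (1 / δ) + O(1)`
  set A₀ := ∫⁻ t in Ioi (1 : ℝ), P₀.pos (Iic t) * ENNReal.ofReal (t ^ (-(2 + δ))) with hA₀
  have hA₀eq : ∫⁻ u, ENNReal.ofReal (u ^ (-(1 + δ))) ∂P₀.pos = ENNReal.ofReal (1 + δ) * A₀ := by
    rw [lintegral_rpow_eq_mul_lintegral P₀.pos_Iio (by linarith), hA₀]
    simp_rw [show 1 + (1 + δ) = 2 + δ by ring]
  obtain ⟨hK1, hK2⟩ := hK δ hδ hδ1.2.le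
  rw [hA₀eq] at hK1 hK2
  have hA₀le : A₀ ≤ ENNReal.ofReal (L + K) := by
    refine le_trans ?_ hK2
    exact le_mul_of_one_le_left' (by rw [ENNReal.one_le_ofReal]; linarith)
  have hA₀ge : ENNReal.ofReal (L - K - 1) ≤ A₀ := by
    have h1 : ENNReal.ofReal (1 + δ) * ENNReal.ofReal (L - K - 1) ≤ ENNReal.ofReal (1 + δ) * A₀ := by
      refine le_trans ?_ hK1
      rw [← ENNReal.ofReal_mul (by linarith)]
      refine ENNReal.ofReal_le_ofReal ?_
      nlinarith
    exact (ENNReal.mul_le_mul_iff_right (by simpa using by linarith) ENNReal.ofReal_ne_top).1 h1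
  set A₁ := ∫⁻ t in Ioi (1 : ℝ), ENNReal.ofReal (t * logDensity t) *
    ENNReal.ofReal (t ^ (-(2 + δ))) with hA₁
  have hA₁eq : A₁ = ENNReal.ofReal (Real.log ((1 + δ) / δ)) := by
    rw [hA₁, ← lintegral_logDensity_mul_rpow hδ]
    refine setLIntegral_congr_fun measurableSet_Ioi fun t ht => ?_
    have ht1 : 1 < t := ht
    have hld := logDensity_nonneg ht1.le
    rw [← ENNReal.ofReal_mul (by positivity), ← ENNReal.ofReal_mul hld]
    congr 1
    rw [mul_comm t, mul_assoc]
    congr 1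
    nth_rewrite 1 [← Real.rpow_one t]
    rw [← Real.rpow_add (by linarith)]; congr 1; ring
  have hlog : Real.log ((1 + δ) / δ) = Real.log (1 + δ) + L := by
    rw [hLdef, div_eq_mul_inv, Real.log_mul (by linarith) (by positivity)]
  have hA₁le : A₁ ≤ ENNReal.ofReal (L + 1) := by
    rw [hA₁eq, hlog]
    refine ENNReal.ofReal_le_ofReal ?_
    have := Real.log_le_sub_one_of_pos (by linarith : 0 < 1 + δ)
    linarith [hδ1.2]
  have hA₁ge : ENNReal.ofReal L ≤ A₁ := by
    rw [hA₁eq, hlog]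
    refine ENNReal.ofReal_le_ofReal ?_
    have := Real.log_nonneg (by linarith : 1 ≤ 1 + δ)
    linarith
  set X := ∫⁻ t in Ioi (1 : ℝ), E.variation (Iic t) * ENNReal.ofReal (t ^ (-(2 + δ))) with hX
  set F := ∫⁻ u in Ioi (1 : ℝ), ENNReal.ofReal |f u| * ENNReal.ofReal (u ^ (-(2 + δ))) with hF
  have hmono : ∀ (μ : Measure ℝ), Measurable fun t : ℝ =>
      μ (Iic t) * ENNReal.ofReal (t ^ (-(2 + δ))) := fun μ => by
    have h : Measurable fun t : ℝ => μ (Iic t) :=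
      Monotone.measurable fun s t hst => measure_mono (Iic_subset_Iic.2 hst)
    exact h.mul (by fun_prop)
  have hEofReal : ∀ t, E.variation (Iic t) = ENNReal.ofReal |E.primitive t| := fun t => by
    rw [← hEvar, ofReal_measureReal (E.variation_Iic_ne_top t)]
  have hP₀fin : ∀ t, P₀.pos (Iic t) ≠ ∞ := fun t => ne_top_of_le_ne_top
    (P₀.variation_Iic_ne_top t) ((Measure.le_add_right le_rfl : P₀.pos ≤ P₀.variation) _)
  have hP₀ofReal : ∀ t, P₀.pos (Iic t) = ENNReal.ofReal (P₀.pos.real (Iic t)) := fun t => by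
    rw [ofReal_measureReal (hP₀fin t)]
  have hfE : ∀ t, f t = P₀.pos.real (Iic t) + E.primitive t - t * logDensity t := fun t => by
    rw [hf, ← hPr]
  rcases hE with h0 | h0
  · have hpos : ∀ t, 0 ≤ E.primitive t := fun t => by
      rw [primitive, val, h0]; simp
    have hXF : X + A₀ ≤ F + A₁ := by
      rw [hX, hA₀, hF, hA₁, ← lintegral_add_left (hmono _),
        ← lintegral_add_right _ (by fun_prop)]
      refine setLIntegral_mono' measurableSet_Ioi fun t ht => ?_
      have ht1 : 1 < t := ht
      have hld := logDensity_nonneg ht1.le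
      rw [← add_mul, ← add_mul, hEofReal, hP₀ofReal, abs_of_nonneg (hpos t),
        ← ENNReal.ofReal_add (hpos t) measureReal_nonneg,
        ← ENNReal.ofReal_add (abs_nonneg _) (by positivity)]
      refine mul_le_mul_left (ENNReal.ofReal_le_ofReal ?_) _
      have := le_abs_self (f t)
      rw [hfE] at this
      rw [hfE]
      linarith
    have h1 : X + ENNReal.ofReal (L - K - 1) ≤ ENNReal.ofReal (ε / 2 * L + (L + 1)) := by
      rw [ENNReal.ofReal_add (by linarith) (by linarith)]
      exact (add_le_add_right hA₀ge _).trans (hXF.trans (add_le_add hAδ hA₁le))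
    refine (le_ofReal_sub_of_add_le h1 (by linarith)).trans (ENNReal.ofReal_le_ofReal ?_)
    linarith
  · have hnp : ∀ t, E.primitive t ≤ 0 := fun t => by
      rw [primitive, val, h0]; simp
    have hXF : X + A₁ ≤ F + A₀ := by
      rw [hX, hA₀, hF, hA₁, ← lintegral_add_left (hmono _),
        ← lintegral_add_right _ (hmono _)]
      refine setLIntegral_mono' measurableSet_Ioi fun t ht => ?_
      have ht1 : 1 < t := ht
      have hld := logDensity_nonneg ht1.le
      rw [← add_mul, ← add_mul, hEofReal, hP₀ofReal, abs_of_nonpos (hnp t),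
        ← ENNReal.ofReal_add (by linarith [hnp t]) (by positivity),
        ← ENNReal.ofReal_add (abs_nonneg _) measureReal_nonneg]
      refine mul_le_mul_left (ENNReal.ofReal_le_ofReal ?_) _
      have := neg_abs_le (f t)
      rw [hfE] at this
      rw [hfE]
      linarith
    have h1 : X + ENNReal.ofReal L ≤ ENNReal.ofReal (ε / 2 * L + (L + K)) := by
      rw [ENNReal.ofReal_add (by linarith) (by linarith)]
      exact (add_le_add_right hA₁ge _).trans (hXF.trans (add_le_add hAδ hA₀le))
    refine (le_ofReal_sub_of_add_le h1 (by linarith)).trans (ENNReal.ofReal_le_ofReal ?_)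
    linarith

end LSMeasure

/-! ### The logarithmic integral -/

theorem mellinKernel_eq_cpow (t : ℝ) {u : ℝ} (hu : 0 < u) :
    mellinKernel t u = (u : ℂ) ^ (-(2 - t * Complex.I)) := by
  rw [Complex.cpow_def_of_ne_zero (by exact_mod_cast hu.ne'), mellinKernel, ← Complex.ofReal_log hu.le,
    show (Real.log u : ℂ) * -(2 - t * Complex.I)
      = (-Real.log u : ℝ) + (-Real.log u : ℝ) + t * Real.log u * Complex.I by push_cast; ring,
    Complex.exp_add, Complex.exp_add, ← Complex.ofReal_exp, Real.exp_neg, Real.exp_log hu]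
  push_cast
  ring

theorem mellinWeight_eq_rpow {u : ℝ} (hu : 0 < u) :
    mellinWeight u = ENNReal.ofReal (u ^ (-(2 : ℝ))) := by
  rw [mellinWeight, Real.rpow_neg hu.le, inv_pow]
  norm_cast

theorem lintegral_logIntegralMeasure {f : ℝ → ℝ≥0∞} (hf : Measurable f) :
    ∫⁻ u, f u ∂logIntegralMeasure = ∫⁻ u in Ioi 1, ENNReal.ofReal (logDensity u) * f u := by
  rw [logIntegralMeasure, lintegral_withDensity_eq_lintegral_mul _ (by fun_prop) hf]
  rfl

theorem lintegral_rpow_logIntegralMeasure {δ : ℝ} (hδ : 0 < δ) :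
    ∫⁻ u, ENNReal.ofReal (u ^ (-(1 + δ))) ∂logIntegralMeasure
      = ENNReal.ofReal (Real.log ((1 + δ) / δ)) := by
  rw [lintegral_logIntegralMeasure (by fun_prop), lintegral_logDensity_mul_rpow hδ]

theorem lintegral_mellinWeight_logIntegralMeasure :
    ∫⁻ u, mellinWeight u ∂logIntegralMeasure ≠ ∞ := by
  have h := lintegral_rpow_logIntegralMeasure (one_pos)
  rw [lintegral_congr_ae (g := fun u => ENNReal.ofReal (u ^ (-(1 + 1 : ℝ)))), h]
  · exact ENNReal.ofReal_ne_top
  · filter_upwards [ae_one_le logIntegralMeasure_Iio] with u hu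
    rw [mellinWeight_eq_rpow (by linarith)]
    norm_num

theorem integral_inv_add_sub_one {s : ℂ} (hs : 1 < s.re) :
    ∫ w in (0 : ℝ)..1, (s + w - 1)⁻¹ = Complex.log s - Complex.log (s - 1) := by
  have hslit : ∀ w : ℝ, 0 ≤ w → s + w - 1 ∈ Complex.slitPlane := fun w hw => by
    refine .inl ?_
    simp only [Complex.sub_re, Complex.add_re, Complex.ofReal_re, Complex.one_re]
    linarith
  have hd : ∀ w ∈ uIcc (0 : ℝ) 1,
      HasDerivAt (fun w : ℝ => Complex.log (s + w - 1)) ((s + w - 1)⁻¹) w := by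
    intro w hw
    rw [uIcc_of_le zero_le_one] at hw
    have h1 : HasDerivAt (fun w : ℝ => s + (w : ℂ) - 1) 1 w :=
      ((Complex.ofRealCLM.hasDerivAt).const_add s).sub_const 1
    have h2 := h1.clog_real (hslit w hw.1)
    rwa [one_div] at h2
  rw [intervalIntegral.integral_eq_sub_of_hasDerivAt hd]
  · simp
  · refine ContinuousOn.intervalIntegrable ?_
    intro w hw
    rw [uIcc_of_le zero_le_one] at hw
    refine ContinuousAt.continuousWithinAt ?_
    exact ContinuousAt.inv₀ (by fun_prop) (Complex.slitPlane_ne_zero (hslit w hw.1))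

theorem integral_mellinKernel_logIntegralMeasure (t : ℝ) :
    ∫ u, mellinKernel t u ∂logIntegralMeasure
      = Complex.log (2 - t * Complex.I) - Complex.log (2 - t * Complex.I - 1) := by
  set s : ℂ := 2 - t * Complex.I with hs
  have hsre : s.re = 2 := by simp [hs]
  rw [logIntegralMeasure, integral_withDensity_eq_integral_toReal_smul (by fun_prop)
    (.of_forall fun u => ENNReal.ofReal_lt_top)]
  have h1 : ∫ u in Ioi (1 : ℝ), (ENNReal.ofReal ((1 - u⁻¹) / Real.log u)).toReal • mellinKernel t u
      = ∫ u in Ioi (1 : ℝ), ∫ w in Ioc (0 : ℝ) 1, ((u ^ (-w) : ℝ) : ℂ) * mellinKernel t u := by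
    refine setIntegral_congr_fun measurableSet_Ioi fun u hu => ?_
    have hu1 : 1 < u := hu
    have h0 := logDensity_nonneg hu1.le
    rw [logDensity] at h0
    rw [ENNReal.toReal_ofReal h0, Complex.real_smul, integral_mul_const, integral_complex_ofReal,
      ← intervalIntegral.integral_of_le zero_le_one, integral_rpow_neg_eq hu1]
  have hprod : ∀ w : ℝ, ∀ u : ℝ, 0 < u →
      ((u ^ (-w) : ℝ) : ℂ) * mellinKernel t u = (u : ℂ) ^ (-(s + w)) := by
    intro w u hu
    rw [mellinKernel_eq_cpow t hu, Complex.ofReal_cpow hu.le,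
      ← Complex.cpow_add _ _ (by exact_mod_cast hu.ne')]
    congr 1
    push_cast
    ring
  have hint : Integrable (fun p : ℝ × ℝ => ((p.1 ^ (-p.2) : ℝ) : ℂ) * mellinKernel t p.1)
      ((volume.restrict (Ioi 1)).prod (volume.restrict (Ioc 0 1))) := by
    have hi : Integrable (fun u : ℝ => u ^ (-(2 : ℝ))) (volume.restrict (Ioi 1)) :=
      integrableOn_Ioi_rpow_of_lt (by norm_num) one_pos
    have h1 : Integrable (fun _ : ℝ => (1 : ℝ)) (volume.restrict (Ioc 0 1)) := integrable_const _
    refine (hi.mul_prod h1).mono' ?_ ?_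
    · refine Measurable.aestronglyMeasurable ?_
      have : Measurable fun p : ℝ × ℝ => p.1 ^ (-p.2) := by fun_prop
      exact (Complex.measurable_ofReal.comp this).mul (by fun_prop)
    · rw [Measure.prod_restrict]
      filter_upwards [ae_restrict_mem (measurableSet_Ioi.prod measurableSet_Ioc)] with p hp
      have hp1 : 1 < p.1 := hp.1
      have hp2 : 0 < p.2 := hp.2.1
      rw [hprod _ _ (by linarith), Complex.norm_cpow_eq_rpow_re_of_pos (by linarith), mul_one]
      refine Real.rpow_le_rpow_of_exponent_le hp1.le ?_
      simp [hsre]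
      linarith
  rw [h1, integral_integral_swap hint, ← integral_inv_add_sub_one (by rw [hsre]; norm_num),
    intervalIntegral.integral_of_le zero_le_one]
  refine setIntegral_congr_fun measurableSet_Ioc fun w hw => ?_
  have hw0 : 0 < w := hw.1
  have hre : (-(s + w)).re < -1 := by simp [hsre]; linarith
  calc ∫ u in Ioi (1 : ℝ), ((u ^ (-w) : ℝ) : ℂ) * mellinKernel t u
      = ∫ u in Ioi (1 : ℝ), (u : ℂ) ^ (-(s + w)) :=
        setIntegral_congr_fun measurableSet_Ioi fun u hu => hprod w u (by
          have : 1 < u := hu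
          linarith)
    _ = _ := by
        rw [integral_Ioi_cpow_of_lt hre one_pos, Complex.ofReal_one, Complex.one_cpow,
          show -(s + w) + 1 = -(s + w - 1) by ring, neg_div_neg_eq, one_div]

namespace LSMeasure

/-- The measure `δ₁ - du / u` on `[1, ∞)`, as a difference of positive measures. -/
def diracSubInv : Measure ℝ × Measure ℝ :=
  (Measure.dirac 1, (volume.restrict (Ioi 1)).withDensity fun u => ENNReal.ofReal u⁻¹)

theorem mellinPair_diracSubInv : MellinPair diracSubInv := by
  refine ⟨by unfold diracSubInv; infer_instance, by unfold diracSubInv; infer_instance,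
    ?_, ?_, ?_, ?_⟩
  · rw [diracSubInv, Measure.dirac_apply' _ measurableSet_Iio]; simp
  · refine withDensity_absolutelyContinuous _ _ ?_
    rw [Measure.restrict_apply measurableSet_Iio, (disjoint_left.2 fun x h1 h2 => lt_asymm (a := x)
      (b := 1) h1 h2 : Disjoint (Iio (1 : ℝ)) (Ioi 1)).inter_eq, measure_empty]
  · rw [diracSubInv, lintegral_dirac, mellinWeight_one]; simp
  · rw [diracSubInv, lintegral_withDensity_eq_lintegral_mul _ (by fun_prop) (by fun_prop)]
    refine ne_top_of_le_ne_top (b := ENNReal.ofReal (1 ^ (1 - (2 : ℝ)) / (2 - 1)))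
      ENNReal.ofReal_ne_top ?_
    rw [← lintegral_Ioi_rpow_neg one_pos (by norm_num)]
    refine setLIntegral_mono (by fun_prop) fun u hu => ?_
    have hu1 : 1 < u := hu
    rw [← mellinWeight_eq_rpow (by linarith)]
    simp only [Pi.mul_apply]
    refine mul_le_of_le_one_left' ?_
    rw [ENNReal.ofReal_le_one]
    exact inv_le_one_of_one_le₀ hu1.le

theorem pairMellin_diracSubInv (t : ℝ) :
    pairMellin diracSubInv t = 1 - (2 - t * Complex.I)⁻¹ := by
  set s : ℂ := 2 - t * Complex.I with hs
  have hsre : s.re = 2 := by simp [hs]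
  rw [pairMellin, diracSubInv, integral_dirac, mellinKernel_one,
    integral_withDensity_eq_integral_toReal_smul (by fun_prop)
    (.of_forall fun u => ENNReal.ofReal_lt_top)]
  congr 1
  calc ∫ u in Ioi (1 : ℝ), (ENNReal.ofReal u⁻¹).toReal • mellinKernel t u
      = ∫ u in Ioi (1 : ℝ), (u : ℂ) ^ (-(s + 1)) := by
        refine setIntegral_congr_fun measurableSet_Ioi fun u hu => ?_
        have hu0 : 0 < u := one_pos.trans hu
        rw [ENNReal.toReal_ofReal (by positivity), mellinKernel_eq_cpow t hu0, Complex.real_smul,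
          neg_add, Complex.cpow_add _ _ (by exact_mod_cast hu0.ne'), Complex.cpow_neg_one]
        push_cast
        ring
    _ = _ := by
        rw [integral_Ioi_cpow_of_lt (by simp [hsre]) one_pos, Complex.ofReal_one,
          Complex.one_cpow, show -(s + 1) + 1 = -s by ring, neg_div_neg_eq, one_div]

/-- `M(x) = 1 - log x` for the logarithmic integral. -/
theorem mobiusSum_logIntegral {x : ℝ} (hx : 1 ≤ x) :
    logIntegral.mobiusSum x = 1 - Real.log x := by
  have hw : ∫⁻ u, mellinWeight u ∂(-logIntegral).variation ≠ ∞ := by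
    rw [variation_neg]
    simpa [logIntegral, ofMeasure, variation] using lintegral_mellinWeight_logIntegralMeasure
  have h : logIntegral.mobiusSum x = pairPrimitive diracSubInv x := by
    refine pairPrimitive_eq_of_pairMellin_eq ((-logIntegral).mellinPair_expConv hw)
      mellinPair_diracSubInv (fun t => ?_) x
    have hre : (2 - t * Complex.I : ℂ).re = 2 := by simp
    have h1 : (2 - t * Complex.I : ℂ) ≠ 0 := fun h0 => by
      rw [h0] at hre; norm_num at hre
    have h2 : (2 - t * Complex.I - 1 : ℂ) ≠ 0 := fun h0 => by
      have := congrArg Complex.re h0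
      rw [Complex.sub_re, hre] at this
      norm_num at this
    have h3 : pairMellin ((-logIntegral).pos, (-logIntegral).neg) t
        = Complex.log (2 - t * Complex.I - 1) - Complex.log (2 - t * Complex.I) := by
      rw [← neg_sub, ← integral_mellinKernel_logIntegralMeasure]
      show (∫ u, mellinKernel t u ∂(0 : Measure ℝ)) - _ = _
      rw [integral_zero_measure, zero_sub]
      rfl
    rw [pairMellin_expConv _ hw, h3, pairMellin_diracSubInv, Complex.exp_sub, Complex.exp_log h1,
      Complex.exp_log h2]
    field_simp
  rw [h, pairPrimitive, diracSubInv]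
  have hx0 : 0 < x := by linarith
  have e1 : (Measure.dirac (1 : ℝ)).real (Icc 1 x) = 1 := by
    rw [measureReal_def, Measure.dirac_apply' _ measurableSet_Icc]
    simp [hx]
  have e2 : ((volume.restrict (Ioi 1)).withDensity fun u : ℝ => ENNReal.ofReal u⁻¹).real (Icc 1 x)
      = Real.log x := by
    have hint : IntegrableOn (fun u : ℝ => u⁻¹) (Ioc 1 x) := by
      refine (ContinuousOn.integrableOn_Icc ?_).mono_set Ioc_subset_Icc_self
      exact continuousOn_inv₀.mono fun u hu => (one_pos.trans_le hu.1).ne'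
    rw [measureReal_def, withDensity_apply _ measurableSet_Icc,
      Measure.restrict_restrict measurableSet_Icc, show Icc 1 x ∩ Ioi (1 : ℝ) = Ioc 1 x by
        ext u; simp only [mem_inter_iff, mem_Icc, mem_Ioi, mem_Ioc]
        exact ⟨fun h => ⟨h.2, h.1.2⟩, fun h => ⟨⟨h.1.le, h.2⟩, h.1⟩⟩,
      ← ofReal_integral_eq_lintegral_ofReal hint, ← intervalIntegral.integral_of_le hx,
      integral_inv_of_pos one_pos hx0, div_one, ENNReal.toReal_ofReal (Real.log_nonneg hx)]
    filter_upwards [ae_restrict_mem measurableSet_Ioc] with u hu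
    exact inv_nonneg.2 (one_pos.trans hu.1).le
  simp only
  rw [e1, e2]

theorem isReference_logIntegral : logIntegral.IsReference where
  neg_eq_zero := rfl
  mobiusSum_isBigO := by
    refine ⟨1, one_pos, ?_⟩
    have h1 : (fun x : ℝ => 1 - Real.log x) =O[atTop] Real.log :=
      ((Real.isLittleO_const_log_atTop (c := (1 : ℝ))).isBigO).sub (isBigO_refl _ _)
    have h2 : (fun x : ℝ => Real.log x) =O[atTop] fun x : ℝ => x / Real.log x ^ (1 : ℝ) := by
      have h3 := (Real.isLittleO_pow_log_id_atTop (n := 2)).isBigO.mul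
        (isBigO_refl (fun x : ℝ => (Real.log x)⁻¹) atTop)
      refine h3.congr' ?_ ?_
      · filter_upwards [eventually_gt_atTop 1] with x hx
        have := (Real.log_pos hx).ne'
        field_simp
      · filter_upwards with x
        rw [Real.rpow_one, div_eq_mul_inv]; rfl
    refine (h1.trans h2).congr' ?_ EventuallyEq.rfl
    filter_upwards [eventually_ge_atTop 1] with x hx
    exact (mobiusSum_logIntegral hx).symm
  chebyshev := by
    refine IsBigO.of_bound 4 ?_
    filter_upwards [eventually_gt_atTop 1] with y hy
    have hl : 0 < Real.log y := Real.log_pos hy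
    have hy0 : 0 < y := by linarith
    rw [Real.norm_of_nonneg measureReal_nonneg,
      Real.norm_of_nonneg (by positivity : 0 ≤ y / Real.log y)]
    refine ENNReal.toReal_le_of_le_ofReal (by positivity) ?_
    have hsqrt : Real.sqrt y ≤ 2 * (y / Real.log y) := by
      have h1 : Real.log (Real.sqrt y) ≤ Real.sqrt y := by
        linarith [Real.log_le_sub_one_of_pos (Real.sqrt_pos.2 hy0)]
      rw [Real.log_sqrt hy0.le] at h1
      rw [mul_div_assoc', le_div_iff₀ hl]
      nlinarith [Real.mul_self_sqrt hy0.le, Real.sqrt_nonneg y]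
    calc logIntegralMeasure (Iic y)
        = ∫⁻ u in Ioi 1, ENNReal.ofReal (logDensity u) * (Iic y).indicator 1 u := by
          rw [← lintegral_indicator_one measurableSet_Iic, lintegral_logIntegralMeasure
            (measurable_one.indicator measurableSet_Iic)]
      _ ≤ ∫⁻ u in Ioi 1, ((Ioc 1 (Real.sqrt y)).indicator 1 u
            + ENNReal.ofReal (2 / Real.log y) * (Ioc 1 y).indicator 1 u) := by
          refine setLIntegral_mono' measurableSet_Ioi fun u hu => ?_
          have hu1 : 1 < u := hu
          have hld := logDensity_le_one hu1.le
          by_cases huy : u ∈ Iic y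
          swap
          · rw [indicator_of_notMem huy, mul_zero]; exact zero_le
          rw [indicator_of_mem huy, Pi.one_apply, mul_one]
          rcases le_or_gt u (Real.sqrt y) with h | h
          · rw [indicator_of_mem (show u ∈ Ioc 1 (Real.sqrt y) from ⟨hu1, h⟩)]
            refine le_add_right ?_
            rw [Pi.one_apply, ENNReal.ofReal_le_one]
            exact hld
          · rw [indicator_of_mem (show u ∈ Ioc 1 y from ⟨hu1, huy⟩), Pi.one_apply, mul_one]
            refine le_add_left (ENNReal.ofReal_le_ofReal ?_)
            have h1 : Real.log y / 2 ≤ Real.log u := by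
              rw [← Real.log_sqrt hy0.le]
              exact Real.log_le_log (Real.sqrt_pos.2 hy0) h.le
            have h2 : 0 < u⁻¹ := by positivity
            rw [logDensity, div_le_div_iff₀ (by linarith) hl]
            nlinarith
      _ ≤ ∫⁻ u, ((Ioc 1 (Real.sqrt y)).indicator 1 u
            + ENNReal.ofReal (2 / Real.log y) * (Ioc 1 y).indicator 1 u) :=
          setLIntegral_le_lintegral _ _
      _ = ENNReal.ofReal (Real.sqrt y - 1)
            + ENNReal.ofReal (2 / Real.log y) * ENNReal.ofReal (y - 1) := by
          rw [lintegral_add_left (measurable_one.indicator measurableSet_Ioc),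
            lintegral_const_mul _ (measurable_one.indicator measurableSet_Ioc),
            lintegral_indicator_one measurableSet_Ioc, lintegral_indicator_one measurableSet_Ioc,
            Real.volume_Ioc, Real.volume_Ioc]
      _ ≤ ENNReal.ofReal (Real.sqrt y) + ENNReal.ofReal (2 / Real.log y) * ENNReal.ofReal y := by
          gcongr <;> linarith
      _ = ENNReal.ofReal (Real.sqrt y + 2 / Real.log y * y) := by
          rw [← ENNReal.ofReal_mul (by positivity), ← ENNReal.ofReal_add (by positivity)
            (by positivity)]
      _ ≤ _ := by
          refine ENNReal.ofReal_le_ofReal ?_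
          have : 2 / Real.log y * y = 2 * (y / Real.log y) := by ring
          linarith
  mellin := by
    refine ⟨1, zero_le_one, fun δ hδ hδ1 => ?_⟩
    have h : ∫⁻ u, ENNReal.ofReal (u ^ (-(1 + δ))) ∂logIntegral.pos
        = ENNReal.ofReal (Real.log (1 + δ) + Real.log δ⁻¹) := by
      rw [← Real.log_mul (by linarith) (by positivity), ← div_eq_mul_inv]
      exact lintegral_rpow_logIntegralMeasure hδ
    have h1 := Real.log_nonneg (by linarith : 1 ≤ 1 + δ)
    have h2 := Real.log_le_sub_one_of_pos (by linarith : 0 < 1 + δ)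
    rw [h]
    exact ⟨ENNReal.ofReal_le_ofReal (by linarith), ENNReal.ofReal_le_ofReal (by linarith)⟩

end LSMeasure

/-! ### Bounds for the Riemann zeta function to the right of the line `Re s = 1` -/

/-- Comparison of a sum with an integral. The two bounds for `f n - f u`, `n ≤ u ≤ n + 1`, through
the size of `f` and through its derivative, are interpolated. -/
theorem norm_tsum_sub_integral_le :
    ∃ C : ℝ, 1 ≤ C ∧ ∀ (f f' : ℝ → ℂ) (A T : ℝ), 0 ≤ A → 1 ≤ T →
      (∀ u, 1 ≤ u → HasDerivAt f (f' u) u) →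
      (∀ u, 1 ≤ u → ‖f u‖ ≤ A * u ^ (-(19 / 20) : ℝ)) →
      (∀ u, 1 ≤ u → ‖f' u‖ ≤ A * T * u ^ (-(39 / 20) : ℝ)) →
      Summable (fun n : ℕ => f (n + 1)) → IntegrableOn f (Ioi 1) →
      ‖(∑' n : ℕ, f (n + 1)) - ∫ u in Ioi 1, f u‖ ≤ C * A * T ^ (1 / 10 : ℝ) := by
  have hsum : Summable fun n : ℕ => 2 * ((n : ℝ) + 1) ^ (-(21 / 20) : ℝ) := by
    have h := (summable_nat_add_iff 1).2 (Real.summable_nat_rpow.2 (by norm_num : -(21 / 20 : ℝ) < -1))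
    exact (h.mul_left 2).congr fun n => by push_cast; rfl
  refine ⟨max 1 (∑' n : ℕ, 2 * ((n : ℝ) + 1) ^ (-(21 / 20) : ℝ)), le_max_left _ _, ?_⟩
  intro f f' A T hA hT hd hf hf' hs hi
  have hcont : ∀ u, 1 ≤ u → ContinuousAt f u := fun u hu => (hd u hu).continuousAt
  have hint : ∀ a b : ℝ, 1 ≤ a → 1 ≤ b → IntervalIntegrable f volume a b := by
    intro a b ha hb
    refine ContinuousOn.intervalIntegrable fun u hu => (hcont u ?_).continuousWithinAt
    exact (le_min ha hb).trans hu.1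
  -- the bound for one term
  have hterm : ∀ n : ℕ, ‖f (n + 1) - ∫ u in ((n : ℝ) + 1)..((n + 1 : ℕ) + 1), f u‖
      ≤ A * T ^ (1 / 10 : ℝ) * (2 * ((n : ℝ) + 1) ^ (-(21 / 20) : ℝ)) := by
    intro n
    set m : ℝ := (n : ℝ) + 1 with hm
    have hm1 : 1 ≤ m := by rw [hm]; linarith [n.cast_nonneg (α := ℝ)]
    have hm0 : 0 < m := by linarith
    have hm' : (((n + 1 : ℕ) : ℝ) + 1) = m + 1 := by rw [hm]; push_cast; ring
    rw [hm']
    have hdiff : f m - ∫ u in m..(m + 1), f u = ∫ u in m..(m + 1), (f m - f u) := by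
      rw [intervalIntegral.integral_sub (by simp) (hint _ _ hm1 (by linarith))]
      simp
    rw [hdiff]
    have hpt : ∀ u ∈ uIoc m (m + 1), ‖f m - f u‖
        ≤ A * T ^ (1 / 10 : ℝ) * (2 * m ^ (-(21 / 20) : ℝ)) := by
      intro u hu
      rw [uIoc_of_le (by linarith)] at hu
      have hu1 : 1 ≤ u := by linarith [hu.1]
      have b1 : ‖f m - f u‖ ≤ 2 * A * m ^ (-(19 / 20) : ℝ) := by
        have h1 := hf m hm1
        have h2 := hf u hu1
        have h3 : u ^ (-(19 / 20) : ℝ) ≤ m ^ (-(19 / 20) : ℝ) :=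
          Real.rpow_le_rpow_of_nonpos hm0 hu.1.le (by norm_num)
        have h4 := norm_sub_le (f m) (f u)
        nlinarith [mul_le_mul_of_nonneg_left h3 hA]
      have b2 : ‖f m - f u‖ ≤ A * T * m ^ (-(39 / 20) : ℝ) := by
        have hconv : Convex ℝ (Icc m (m + 1)) := convex_Icc _ _
        have h1 := hconv.norm_image_sub_le_of_norm_hasDerivWithin_le (f := f) (f' := f')
          (C := A * T * m ^ (-(39 / 20) : ℝ)) (x := u) (y := m)
          (fun v hv => (hd v (by linarith [hv.1])).hasDerivWithinAt) (fun v hv => by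
            refine (hf' v (by linarith [hv.1])).trans ?_
            have h3 : v ^ (-(39 / 20) : ℝ) ≤ m ^ (-(39 / 20) : ℝ) :=
              Real.rpow_le_rpow_of_nonpos hm0 hv.1 (by norm_num)
            gcongr) ⟨hu.1.le, hu.2⟩ ⟨le_rfl, by linarith⟩
        refine h1.trans ?_
        have h2 : ‖m - u‖ ≤ 1 := by
          rw [Real.norm_eq_abs, abs_le]; constructor <;> linarith [hu.1, hu.2]
        exact mul_le_of_le_one_right (by positivity) h2
      have hsplit : m ^ (-(21 / 20) : ℝ) = m ^ (-(19 / 20) : ℝ) * m ^ (-(1 / 10) : ℝ) := by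
        rw [← Real.rpow_add hm0]; norm_num
      have hsplit2 : m ^ (-(39 / 20) : ℝ) = m ^ (-(19 / 20) : ℝ) * m⁻¹ := by
        rw [← Real.rpow_neg_one m, ← Real.rpow_add hm0]; norm_num
      have hratio : (T / m) ^ (1 / 10 : ℝ) = T ^ (1 / 10 : ℝ) * m ^ (-(1 / 10) : ℝ) := by
        rw [Real.div_rpow (by linarith) hm0.le, Real.rpow_neg hm0.le, div_eq_mul_inv]
      have hgoal : A * T ^ (1 / 10 : ℝ) * (2 * m ^ (-(21 / 20) : ℝ))
          = 2 * A * m ^ (-(19 / 20) : ℝ) * (T / m) ^ (1 / 10 : ℝ) := by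
        rw [hratio, hsplit]; ring
      rw [hgoal]
      rcases le_or_gt 1 (T / m) with h | h
      · exact b1.trans (le_mul_of_one_le_right (by positivity) (Real.one_le_rpow h (by norm_num)))
      · have h0 : 0 < T / m := by positivity
        have h1 : T / m ≤ (T / m) ^ (1 / 10 : ℝ) := by
          nth_rewrite 1 [← Real.rpow_one (T / m)]
          exact Real.rpow_le_rpow_of_exponent_ge h0 h.le (by norm_num)
        calc ‖f m - f u‖ ≤ A * m ^ (-(19 / 20) : ℝ) * (T / m) := by
              refine b2.trans (le_of_eq ?_)
              rw [hsplit2]; ring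
          _ ≤ 2 * A * m ^ (-(19 / 20) : ℝ) * (T / m) ^ (1 / 10 : ℝ) := by
              have h2 : 0 ≤ A * m ^ (-(19 / 20) : ℝ) := by positivity
              nlinarith
    have := intervalIntegral.norm_integral_le_of_norm_le_const hpt
    simpa using this
  -- partial sums
  have hpart : ∀ N : ℕ, ∑ n ∈ Finset.range N, (f (n + 1)
      - ∫ u in ((n : ℝ) + 1)..((n + 1 : ℕ) + 1), f u)
      = (∑ n ∈ Finset.range N, f (n + 1)) - ∫ u in (1 : ℝ)..((N : ℝ) + 1), f u := by
    intro N
    rw [Finset.sum_sub_distrib]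
    congr 1
    have h := intervalIntegral.sum_integral_adjacent_intervals (f := f) (μ := volume)
      (a := fun n : ℕ => (n : ℝ) + 1) (n := N) (fun k _ => hint _ _
        (by linarith [k.cast_nonneg (α := ℝ)]) (by linarith [(k + 1).cast_nonneg (α := ℝ)]))
    simpa using h
  have hlim : Tendsto (fun N : ℕ => (∑ n ∈ Finset.range N, f (n + 1))
      - ∫ u in (1 : ℝ)..((N : ℝ) + 1), f u) atTop
      (𝓝 ((∑' n : ℕ, f (n + 1)) - ∫ u in Ioi 1, f u)) := by
    refine hs.hasSum.tendsto_sum_nat.sub ?_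
    exact intervalIntegral_tendsto_integral_Ioi 1 hi
      (tendsto_atTop_add_const_right _ _ tendsto_natCast_atTop_atTop)
  refine le_of_tendsto hlim.norm (.of_forall fun N => ?_)
  rw [← hpart N]
  calc _ ≤ ∑ n ∈ Finset.range N, A * T ^ (1 / 10 : ℝ) * (2 * ((n : ℝ) + 1) ^ (-(21 / 20) : ℝ)) :=
        (norm_sum_le _ _).trans (Finset.sum_le_sum fun n _ => hterm n)
    _ = A * T ^ (1 / 10 : ℝ) * ∑ n ∈ Finset.range N, 2 * ((n : ℝ) + 1) ^ (-(21 / 20) : ℝ) := by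
        rw [Finset.mul_sum]
    _ ≤ A * T ^ (1 / 10 : ℝ) * max 1 (∑' n : ℕ, 2 * ((n : ℝ) + 1) ^ (-(21 / 20) : ℝ)) := by
        gcongr
        exact (hsum.sum_le_tsum _ fun n _ => by positivity).trans (le_max_right _ _)
    _ = _ := by ring

theorem hasDerivAt_ofReal_cpow_neg (s : ℂ) {u : ℝ} (hu : 0 < u) :
    HasDerivAt (fun u : ℝ => (u : ℂ) ^ (-s)) (-s * (u : ℂ) ^ (-s - 1)) u := by
  rcases eq_or_ne s 0 with rfl | hs
  · simpa using hasDerivAt_const u (1 : ℂ)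
  · exact (hasDerivAt_ofReal_cpow_const hu.ne' (neg_ne_zero.2 hs))

/-- The polar part of `ζ` is the integral `∫_1^∞ u ^ (-s) du`, and the error in replacing the Dirichlet
series by it is small uniformly up to the line `Re s = 1`. -/
theorem norm_riemannZeta_sub_le : ∃ C : ℝ, 1 ≤ C ∧ ∀ s : ℂ, 1 < s.re →
    ‖riemannZeta s - (s - 1)⁻¹‖ ≤ C * ‖s‖ ^ (1 / 10 : ℝ) := by
  obtain ⟨C, hC, h⟩ := norm_tsum_sub_integral_le
  refine ⟨C, hC, fun s hs => ?_⟩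
  have hT : 1 ≤ ‖s‖ := hs.le.trans (Complex.re_le_norm s)
  have hnorm : ∀ {u : ℝ}, 1 ≤ u → ∀ z : ℂ, ‖(u : ℂ) ^ z‖ = u ^ z.re := fun hu z =>
    Complex.norm_cpow_eq_rpow_re_of_pos (by linarith) z
  have h1 := h (fun u => (u : ℂ) ^ (-s)) (fun u => -s * (u : ℂ) ^ (-s - 1)) 1 ‖s‖ zero_le_one hT
    (fun u hu => hasDerivAt_ofReal_cpow_neg s (by linarith))
    (fun u hu => by
      rw [hnorm hu, one_mul]
      exact Real.rpow_le_rpow_of_exponent_le hu (by rw [Complex.neg_re]; linarith))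
    (fun u hu => by
      rw [norm_mul, norm_neg, hnorm hu, one_mul]
      gcongr
      rw [Complex.sub_re, Complex.neg_re, Complex.one_re]; linarith)
    (by
      have := (summable_nat_add_iff 1).2 (Complex.summable_one_div_nat_cpow.2 hs)
      refine this.congr fun n => ?_
      rw [Complex.cpow_neg, one_div]; push_cast; rfl)
    (integrableOn_Ioi_cpow_of_lt (by rw [Complex.neg_re]; linarith) one_pos)
  have e1 : ∑' n : ℕ, (((n : ℝ) + 1 : ℝ) : ℂ) ^ (-s) = riemannZeta s := by
    rw [zeta_eq_tsum_one_div_nat_add_one_cpow hs]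
    refine tsum_congr fun n => ?_
    rw [Complex.cpow_neg, one_div]; push_cast; rfl
  have e2 : ∫ u in Ioi (1 : ℝ), (u : ℂ) ^ (-s) = (s - 1)⁻¹ := by
    rw [integral_Ioi_cpow_of_lt (by rw [Complex.neg_re]; linarith) one_pos, Complex.ofReal_one,
      Complex.one_cpow, show -s + 1 = -(s - 1) by ring, neg_div_neg_eq, one_div]
  rw [e1, e2, mul_one] at h1
  exact h1

theorem integral_Ioi_log_mul_cpow_neg {s : ℂ} (hs : 1 < s.re) :
    IntegrableOn (fun u : ℝ => (Real.log u : ℂ) * (u : ℂ) ^ (-s)) (Ioi 1) ∧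
      ∫ u in Ioi (1 : ℝ), (Real.log u : ℂ) * (u : ℂ) ^ (-s) = ((s - 1)⁻¹) ^ 2 := by
  have hs1 : s - 1 ≠ 0 := by
    intro h
    rw [sub_eq_zero.1 h] at hs
    simp at hs
  have hd : ∀ u : ℝ, 0 < u → HasDerivAt (fun u : ℝ =>
      -(((Real.log u : ℝ) : ℂ) * (s - 1)⁻¹ + ((s - 1)⁻¹) ^ 2) * (u : ℂ) ^ (-(s - 1)))
      ((Real.log u : ℂ) * (u : ℂ) ^ (-s)) u := by
    intro u hu
    have h1 := (((Real.hasDerivAt_log hu.ne').ofReal_comp.mul_const (s - 1)⁻¹).add_const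
      (((s - 1)⁻¹) ^ 2)).neg.mul (hasDerivAt_ofReal_cpow_neg (s - 1) hu)
    refine h1.congr_deriv ?_
    have hu' : (u : ℂ) ≠ 0 := by exact_mod_cast hu.ne'
    have e1 : (u : ℂ) ^ (-(s - 1)) = u * (u : ℂ) ^ (-s) := by
      rw [show -(s - 1) = 1 + -s by ring, Complex.cpow_add _ _ hu', Complex.cpow_one]
    have e2 : (u : ℂ) ^ (-(s - 1) - 1) = (u : ℂ) ^ (-s) := by congr 1; ring
    simp only [Pi.neg_apply]
    rw [e2, e1]
    push_cast
    field_simp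
    ring
  have hint : IntegrableOn (fun u : ℝ => (Real.log u : ℂ) * (u : ℂ) ^ (-s)) (Ioi 1) := by
    set ε : ℝ := (s.re - 1) / 2 with hε
    have hε0 : 0 < ε := by rw [hε]; linarith
    have hdom : IntegrableOn (fun u : ℝ => ε⁻¹ * u ^ (ε - s.re)) (Ioi 1) :=
      (integrableOn_Ioi_rpow_of_lt (by rw [hε]; linarith) one_pos).const_mul _
    refine hdom.mono' ?_ ?_
    · refine ContinuousOn.aestronglyMeasurable (fun u hu => ?_) measurableSet_Ioi
      have hu0 : (0 : ℝ) < u := one_pos.trans hu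
      exact ((Complex.continuous_ofReal.continuousAt.comp
        (Real.continuousAt_log hu0.ne')).mul
          (hasDerivAt_ofReal_cpow_neg s hu0).continuousAt).continuousWithinAt
    · filter_upwards [ae_restrict_mem measurableSet_Ioi] with u hu
      have hu1 : (1 : ℝ) < u := hu
      have hu0 : (0 : ℝ) < u := one_pos.trans hu1
      rw [norm_mul, Complex.norm_cpow_eq_rpow_re_of_pos hu0, Complex.norm_real,
        Real.norm_of_nonneg (Real.log_nonneg hu1.le), Complex.neg_re, sub_eq_add_neg,
        Real.rpow_add hu0, ← mul_assoc]
      gcongr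
      rw [inv_mul_eq_div]
      exact Real.log_le_rpow_div hu0.le hε0
  refine ⟨hint, ?_⟩
  have hlim : Tendsto (fun u : ℝ =>
      -(((Real.log u : ℝ) : ℂ) * (s - 1)⁻¹ + ((s - 1)⁻¹) ^ 2) * (u : ℂ) ^ (-(s - 1))) atTop (𝓝 0) := by
    have hpos : 0 < s.re - 1 := by linarith
    have h1 : Tendsto (fun u : ℝ => Real.log u * u ^ (-(s.re - 1))) atTop (𝓝 0) := by
      refine ((isLittleO_log_rpow_atTop hpos).tendsto_div_nhds_zero).congr' ?_
      filter_upwards [eventually_gt_atTop 0] with u hu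
      rw [Real.rpow_neg hu.le, div_eq_mul_inv]
    have h2 : Tendsto (fun u : ℝ => u ^ (-(s.re - 1))) atTop (𝓝 0) :=
      tendsto_rpow_neg_atTop hpos
    have h3 : Tendsto (fun u : ℝ => Real.log u * u ^ (-(s.re - 1)) * ‖(s - 1)⁻¹‖
        + ‖((s - 1)⁻¹) ^ 2‖ * u ^ (-(s.re - 1))) atTop (𝓝 0) := by
      have h := (h1.mul_const ‖(s - 1)⁻¹‖).add (h2.const_mul ‖((s - 1)⁻¹) ^ 2‖)
      rwa [zero_mul, mul_zero, add_zero] at h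
    refine squeeze_zero_norm' ?_ h3
    filter_upwards [eventually_gt_atTop 1] with u hu
    have hu0 : (0 : ℝ) < u := one_pos.trans hu
    rw [norm_mul, norm_neg, Complex.norm_cpow_eq_rpow_re_of_pos hu0, Complex.neg_re, Complex.sub_re,
      Complex.one_re]
    have h4 : ‖(Real.log u : ℂ)‖ = Real.log u := by
      rw [Complex.norm_real, Real.norm_of_nonneg (Real.log_nonneg hu.le)]
    have h5 := norm_add_le ((Real.log u : ℂ) * (s - 1)⁻¹) (((s - 1)⁻¹) ^ 2)
    rw [norm_mul, h4] at h5
    calc _ ≤ (Real.log u * ‖(s - 1)⁻¹‖ + ‖((s - 1)⁻¹) ^ 2‖) * u ^ (-(s.re - 1)) := by gcongr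
      _ = _ := by ring
  have := integral_Ioi_of_hasDerivAt_of_tendsto' (a := (1 : ℝ))
    (fun u hu => hd u (one_pos.trans_le hu)) hint hlim
  rw [this]
  simp

theorem norm_deriv_riemannZeta_add_le : ∃ C : ℝ, 1 ≤ C ∧ ∀ s : ℂ, 1 < s.re →
    ‖deriv riemannZeta s + ((s - 1)⁻¹) ^ 2‖ ≤ C * ‖s‖ ^ (1 / 10 : ℝ) := by
  obtain ⟨C, hC, h⟩ := norm_tsum_sub_integral_le
  refine ⟨C * 21, by linarith, fun s hs => ?_⟩
  have hT : 1 ≤ ‖s‖ := hs.le.trans (Complex.re_le_norm s)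
  have hnorm : ∀ {u : ℝ}, 1 ≤ u → ∀ z : ℂ, ‖(u : ℂ) ^ z‖ = u ^ z.re := fun hu z =>
    Complex.norm_cpow_eq_rpow_re_of_pos (by linarith) z
  have hlog : ∀ {u : ℝ}, 1 ≤ u → Real.log u ≤ 20 * u ^ (1 / 20 : ℝ) := fun {u} hu => by
    have := Real.log_le_rpow_div (x := u) (by linarith) (by norm_num : (0 : ℝ) < 1 / 20)
    linarith
  have hlogn : ∀ {u : ℝ}, 1 ≤ u → ‖(Real.log u : ℂ)‖ = Real.log u := fun hu => by
    rw [Complex.norm_real, Real.norm_of_nonneg (Real.log_nonneg hu)]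
  have habs : LSeries.abscissaOfAbsConv 1 < s.re := by
    rw [LSeries.abscissaOfAbsConv_one]; exact_mod_cast hs
  have hsum := LSeriesSummable_logMul_of_lt_re habs
  have hterm : ∀ n : ℕ, LSeries.term (LSeries.logMul 1) s (n + 1)
      = (Real.log ((n : ℝ) + 1) : ℂ) * (((n : ℝ) + 1 : ℝ) : ℂ) ^ (-s) := by
    intro n
    rw [LSeries.term_of_ne_zero (Nat.succ_ne_zero n), LSeries.logMul, Complex.cpow_neg,
      div_eq_mul_inv, Complex.ofReal_log (by positivity)]
    push_cast
    simp
  have h1 := h (fun u => (Real.log u : ℂ) * (u : ℂ) ^ (-s))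
    (fun u => ((u⁻¹ : ℝ) : ℂ) * (u : ℂ) ^ (-s) + (Real.log u : ℂ) * (-s * (u : ℂ) ^ (-s - 1)))
    21 ‖s‖ (by norm_num) hT
    (fun u hu => (Real.hasDerivAt_log (by linarith)).ofReal_comp.mul
      (hasDerivAt_ofReal_cpow_neg s (by linarith)))
    (fun u hu => by
      have hu0 : 0 < u := by linarith
      rw [norm_mul, hnorm hu, hlogn hu]
      have e : u ^ (-(19 / 20) : ℝ) = u ^ (1 / 20 : ℝ) * u ^ (-1 : ℝ) := by
        rw [← Real.rpow_add hu0]; norm_num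
      have h2 : u ^ (-s).re ≤ u ^ (-1 : ℝ) :=
        Real.rpow_le_rpow_of_exponent_le hu (by rw [Complex.neg_re]; linarith)
      rw [e, ← mul_assoc]
      have h3 := hlog hu
      have h4 : 0 ≤ u ^ (1 / 20 : ℝ) := by positivity
      gcongr
      linarith)
    (fun u hu => by
      have hu0 : 0 < u := by linarith
      have h2 : u ^ (-s).re ≤ u ^ (-1 : ℝ) :=
        Real.rpow_le_rpow_of_exponent_le hu (by rw [Complex.neg_re]; linarith)
      have h3 : u ^ (-s - 1).re ≤ u ^ (-2 : ℝ) :=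
        Real.rpow_le_rpow_of_exponent_le hu (by
          rw [Complex.sub_re, Complex.neg_re, Complex.one_re]; linarith)
      have e1 : u⁻¹ * u ^ (-1 : ℝ) = u ^ (-2 : ℝ) := by
        rw [← Real.rpow_neg_one, ← Real.rpow_add hu0]; norm_num
      have e2 : u ^ (1 / 20 : ℝ) * u ^ (-2 : ℝ) = u ^ (-(39 / 20) : ℝ) := by
        rw [← Real.rpow_add hu0]; norm_num
      have e3 : u ^ (-2 : ℝ) ≤ u ^ (-(39 / 20) : ℝ) :=
        Real.rpow_le_rpow_of_exponent_le hu (by norm_num)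
      have e4 : 0 ≤ u ^ (-(39 / 20) : ℝ) := by positivity
      refine (norm_add_le _ _).trans ?_
      rw [norm_mul, norm_mul, norm_mul, norm_neg, hnorm hu, hnorm hu, hlogn hu, Complex.norm_real,
        Real.norm_of_nonneg (by positivity : 0 ≤ u⁻¹)]
      have p1 : u⁻¹ * u ^ (-s).re ≤ u ^ (-(39 / 20) : ℝ) := by
        calc u⁻¹ * u ^ (-s).re ≤ u⁻¹ * u ^ (-1 : ℝ) := by gcongr
          _ ≤ _ := by rw [e1]; exact e3
      have p2 : Real.log u * (‖s‖ * u ^ (-s - 1).re) ≤ 20 * ‖s‖ * u ^ (-(39 / 20) : ℝ) := by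
        calc _ ≤ (20 * u ^ (1 / 20 : ℝ)) * (‖s‖ * u ^ (-2 : ℝ)) := by
              have := hlog hu
              gcongr
          _ = _ := by rw [← e2]; ring
      nlinarith [mul_le_mul_of_nonneg_right hT e4])
    (by
      refine ((summable_nat_add_iff 1).2 hsum).congr fun n => ?_
      exact hterm n)
    (integral_Ioi_log_mul_cpow_neg hs).1
  have e1 : ∑' n : ℕ, (Real.log ((n : ℝ) + 1) : ℂ) * (((n : ℝ) + 1 : ℝ) : ℂ) ^ (-s)
      = -deriv riemannZeta s := by
    have h2 : deriv riemannZeta s = deriv (LSeries 1) s := by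
      refine Filter.EventuallyEq.deriv_eq ?_
      filter_upwards [(isOpen_lt continuous_const Complex.continuous_re).mem_nhds hs] with z hz
      exact (LSeries_one_eq_riemannZeta hz).symm
    rw [h2, LSeries_deriv habs, neg_neg, LSeries, Summable.tsum_eq_zero_add hsum,
      LSeries.term_zero, zero_add]
    exact (tsum_congr hterm).symm
  rw [e1, (integral_Ioi_log_mul_cpow_neg hs).2] at h1
  rw [← norm_neg, neg_add, ← sub_eq_add_neg]
  exact h1

/-- The bound for `ζ' / ζ²` away from the real axis. The lower bound for `ζ` comes from
`ζ(σ)³ |ζ(σ + it)|⁴ |ζ(σ + 2it)| ≥ 1` for `σ ≥ 1 + η`, with `η` a small multiple of `|t|^(-1/2)`,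
and from the bound for `ζ'` for `1 < σ ≤ 1 + η`. -/
theorem norm_deriv_riemannZeta_div_sq_le_of_one_le_abs_im : ∃ C : ℝ, ∀ s : ℂ, 1 < s.re →
    s.re ≤ 2 → 1 ≤ |s.im| →
    ‖deriv riemannZeta s / riemannZeta s ^ 2‖ ≤ C * (|s.im| + 3) ^ (9 / 10 : ℝ) := by
  obtain ⟨C₁, hC₁, h₁⟩ := norm_riemannZeta_sub_le
  obtain ⟨C₂, hC₂, h₂⟩ := norm_deriv_riemannZeta_add_le
  set B : ℝ := 3 * max C₁ C₂ with hB
  have hB1 : C₁ ≤ max C₁ C₂ := le_max_left _ _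
  have hB2 : C₂ ≤ max C₁ C₂ := le_max_right _ _
  have hB3 : 3 ≤ B := by linarith
  have hB0 : 0 < B := by linarith
  -- this `κ` makes the lower bound at distance `η = κ / T ^ 5` from the line, which is
  -- `(κ ^ 3 / (B ^ 4 T ^ 16)) ^ (1 / 4)`, equal to twice the possible variation `B T η` below `η`
  set κ : ℝ := 1 / (16 * B ^ 8) with hκ
  have hκ0 : 0 < κ := by positivity
  have hκ1 : κ ≤ 1 := by
    rw [hκ, div_le_one (by positivity)]
    nlinarith [one_le_pow₀ (n := 8) (by linarith : 1 ≤ B)]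
  refine ⟨1 / (B * κ ^ 2), fun s hs1 hs2 ht => ?_⟩
  set t : ℝ := s.im with htdef
  set W : ℝ := |t| + 3 with hW
  have hW1 : 1 ≤ W := by linarith [abs_nonneg t]
  set T : ℝ := W ^ (1 / 10 : ℝ) with hT
  have hT1 : 1 ≤ T := Real.one_le_rpow hW1 (by norm_num)
  have hT0 : 0 < T := by linarith
  have him : ∀ z : ℂ, 1 ≤ |z.im| → ‖(z - 1)⁻¹‖ ≤ 1 := fun z hz => by
    rw [norm_inv]
    refine inv_le_one_of_one_le₀ (hz.trans ?_)
    simpa using Complex.abs_im_le_norm (z - 1)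
  have hbig : ∀ z : ℂ, 1 < z.re → z.re ≤ 2 → |z.im| ≤ 2 * |t| →
      ‖z‖ ^ (1 / 10 : ℝ) ≤ 2 * T := fun z hz1 hz2 hz => by
    have h := Complex.norm_le_abs_re_add_abs_im z
    rw [abs_of_pos (by linarith : 0 < z.re)] at h
    calc ‖z‖ ^ (1 / 10 : ℝ) ≤ (2 * W) ^ (1 / 10 : ℝ) := by
          gcongr
          linarith
      _ = 2 ^ (1 / 10 : ℝ) * T := by rw [Real.mul_rpow (by norm_num) (by linarith)]
      _ ≤ 2 * T := by
          gcongr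
          calc (2 : ℝ) ^ (1 / 10 : ℝ) ≤ 2 ^ (1 : ℝ) :=
                Real.rpow_le_rpow_of_exponent_le (by norm_num) (by norm_num)
            _ = 2 := Real.rpow_one 2
  have hzeta : ∀ z : ℂ, 1 < z.re → z.re ≤ 2 → 1 ≤ |z.im| → |z.im| ≤ 2 * |t| →
      ‖riemannZeta z‖ ≤ B * T := fun z hz1 hz2 hz3 hz4 => by
    have a1 := h₁ z hz1
    have a2 := him z hz3
    have a3 := hbig z hz1 hz2 hz4
    have a4 : ‖riemannZeta z‖ ≤ ‖riemannZeta z - (z - 1)⁻¹‖ + ‖(z - 1)⁻¹‖ := by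
      simpa using norm_add_le (riemannZeta z - (z - 1)⁻¹) ((z - 1)⁻¹)
    nlinarith [mul_le_mul_of_nonneg_left a3 (by linarith : (0 : ℝ) ≤ C₁)]
  have hderiv : ∀ z : ℂ, 1 < z.re → z.re ≤ 2 → z.im = t → ‖deriv riemannZeta z‖ ≤ B * T :=
    fun z hz1 hz2 hz3 => by
    have a1 := h₂ z hz1
    have a2 := him z (by rw [hz3]; exact ht)
    have a3 := hbig z hz1 hz2 (by rw [hz3]; linarith)
    have a4 : ‖deriv riemannZeta z‖
        ≤ ‖deriv riemannZeta z + ((z - 1)⁻¹) ^ 2‖ + ‖(z - 1)⁻¹‖ ^ 2 := by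
      rw [← norm_pow]
      have h := norm_sub_le (deriv riemannZeta z + ((z - 1)⁻¹) ^ 2) (((z - 1)⁻¹) ^ 2)
      rwa [add_sub_cancel_right] at h
    have a5 : ‖(z - 1)⁻¹‖ ^ 2 ≤ 1 := pow_le_one₀ (norm_nonneg _) a2
    nlinarith [mul_le_mul_of_nonneg_left a3 (by linarith : (0 : ℝ) ≤ C₂)]
  have hreal : ∀ x : ℝ, 0 < x → x ≤ 1 → ‖riemannZeta (1 + x)‖ ≤ B / x := fun x hx0 hx1 => by
    have a1 := h₁ (1 + x) (by simpa using hx0)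
    have a2 : ‖((1 : ℂ) + x - 1)⁻¹‖ = x⁻¹ := by
      rw [add_sub_cancel_left, norm_inv, Complex.norm_real, Real.norm_of_nonneg hx0.le]
    have a3 : ‖((1 : ℂ) + x)‖ = 1 + x := by
      rw [← Complex.ofReal_one, ← Complex.ofReal_add, Complex.norm_real,
        Real.norm_of_nonneg (by linarith)]
    have a4 : (1 + x) ^ (1 / 10 : ℝ) ≤ 2 := by
      calc (1 + x) ^ (1 / 10 : ℝ) ≤ (1 + x) ^ (1 : ℝ) :=
            Real.rpow_le_rpow_of_exponent_le (by linarith) (by norm_num)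
        _ ≤ 2 := by rw [Real.rpow_one]; linarith
    have a5 : ‖riemannZeta (1 + x)‖
        ≤ ‖riemannZeta (1 + x) - ((1 : ℂ) + x - 1)⁻¹‖ + ‖((1 : ℂ) + x - 1)⁻¹‖ := by
      simpa using norm_add_le (riemannZeta (1 + x) - ((1 : ℂ) + x - 1)⁻¹) (((1 : ℂ) + x - 1)⁻¹)
    rw [a3] at a1
    rw [a2] at a5
    have a6 : 1 ≤ x⁻¹ := (one_le_inv₀ hx0).2 hx1
    rw [div_eq_mul_inv]
    nlinarith [mul_le_mul_of_nonneg_left a4 (by linarith : (0 : ℝ) ≤ C₁)]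
  -- the lower bound at a distance from the line
  set η : ℝ := κ / T ^ 5 with hη
  have hη0 : 0 < η := by positivity
  have hη1 : η ≤ 1 := by
    rw [hη, div_le_one (by positivity)]
    exact hκ1.trans (one_le_pow₀ hT1)
  have hfar : ∀ x : ℝ, η ≤ x → x ≤ 1 →
      2 * (B * κ / T ^ 4) ≤ ‖riemannZeta (1 + x + Complex.I * t)‖ := fun x hx hx1 => by
    have hx0 : 0 < x := hη0.trans_le hx
    have h := DirichletCharacter.norm_LFunction_product_ge_one (1 : DirichletCharacter ℂ 1) hx0 t
    rw [one_pow, DirichletCharacter.LFunctionTrivChar, DirichletCharacter.LFunction_modOne_eq,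
      norm_mul, norm_mul, norm_pow, norm_pow] at h
    have b1 := hreal x hx0 hx1
    have b2 : ‖riemannZeta (1 + x + 2 * Complex.I * t)‖ ≤ B * T := by
      refine hzeta _ ?_ ?_ ?_ ?_
      · simpa using hx0
      · simp; linarith
      · simp [abs_mul]; linarith
      · simp [abs_mul]
    set Z := ‖riemannZeta (1 + x + Complex.I * t)‖ with hZ
    have b3 : 1 ≤ (B / x) ^ 3 * Z ^ 4 * (B * T) := by
      refine (ge_iff_le.1 h).trans ?_
      gcongr
    have b4 : x ^ 3 ≤ B ^ 4 * T * Z ^ 4 := by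
      have : (B / x) ^ 3 * Z ^ 4 * (B * T) = B ^ 4 * T * Z ^ 4 / x ^ 3 := by
        field_simp
      rw [this, le_div_iff₀ (by positivity), one_mul] at b3
      exact b3
    have b5 : η ^ 3 ≤ B ^ 4 * T * Z ^ 4 := (by gcongr : η ^ 3 ≤ x ^ 3).trans b4
    have b6 : B ^ 4 * T * (2 * (B * κ / T ^ 4)) ^ 4 = η ^ 3 := by
      have : κ * (16 * B ^ 8) = 1 := by rw [hκ]; field_simp
      calc B ^ 4 * T * (2 * (B * κ / T ^ 4)) ^ 4 = (κ * (16 * B ^ 8)) * κ ^ 3 / T ^ 15 := by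
            field_simp
            norm_num
        _ = η ^ 3 := by rw [this, hη]; field_simp
    rw [← b6] at b5
    have b7 : (2 * (B * κ / T ^ 4)) ^ 4 ≤ Z ^ 4 := le_of_mul_le_mul_left b5 (by positivity)
    exact le_of_pow_le_pow_left₀ (by norm_num) (norm_nonneg _) b7
  have hs : s = 1 + ((s.re - 1 : ℝ) : ℂ) + Complex.I * t := by
    apply Complex.ext <;> simp [htdef]
  have hlow : B * κ / T ^ 4 ≤ ‖riemannZeta s‖ := by
    rcases le_or_gt η (s.re - 1) with hx | hx
    · have h := hfar (s.re - 1) hx (by linarith)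
      rw [← hs] at h
      have : 0 < B * κ / T ^ 4 := by positivity
      linarith
    · have h := hfar η le_rfl hη1
      set w : ℂ := 1 + η + Complex.I * t with hw
      have hseg : ‖riemannZeta w - riemannZeta s‖ ≤ B * T * ‖w - s‖ := by
        refine Convex.norm_image_sub_le_of_norm_deriv_le
          (s := {z : ℂ | 1 < z.re ∧ z.re ≤ 2 ∧ z.im = t}) ?_ ?_ ?_ ?_ ?_
        · rintro z ⟨hz, -, -⟩
          exact differentiableAt_riemannZeta (by rintro rfl; simp at hz)
        · rintro z ⟨hz1, hz2, hz3⟩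
          exact hderiv z hz1 hz2 hz3
        · exact ((convex_halfSpace_re_gt 1).inter ((convex_halfSpace_re_le 2).inter
            (convex_hyperplane (𝕜 := ℝ) Complex.imLm.isLinear t)))
        · exact ⟨hs1, hs2, rfl⟩
        · refine ⟨?_, ?_, ?_⟩ <;> simp [hw, hη0]
          linarith
      have hws : ‖w - s‖ ≤ η := by
        have : w - s = ((η - (s.re - 1) : ℝ) : ℂ) := by
          rw [hw]; nth_rewrite 1 [hs]; push_cast; ring
        rw [this, Complex.norm_real, Real.norm_of_nonneg (by linarith)]
        linarith
      have h3 : B * T * ‖w - s‖ ≤ B * κ / T ^ 4 := by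
        calc B * T * ‖w - s‖ ≤ B * T * η := by gcongr
          _ = B * κ / T ^ 4 := by rw [hη]; field_simp
      have h4 := norm_sub_norm_le (riemannZeta w) (riemannZeta s)
      linarith
  rw [norm_div, norm_pow]
  have hTW : W ^ (9 / 10 : ℝ) = T ^ 9 := by
    rw [hT, ← Real.rpow_natCast, ← Real.rpow_mul (by linarith)]; norm_num
  rw [hTW]
  calc ‖deriv riemannZeta s‖ / ‖riemannZeta s‖ ^ 2 ≤ (B * T) / (B * κ / T ^ 4) ^ 2 := by
        gcongr
        exact hderiv s hs1 hs2 rfl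
    _ = _ := by field_simp

/-- The bound for `ζ' / ζ²` near the line `Re s = 1`. Close to the real axis, the pole of `ζ` cancels
in the quotient, which is continuous on a compact set. -/
theorem norm_deriv_riemannZeta_div_sq_le : ∃ C : ℝ, 0 ≤ C ∧ ∀ s : ℂ, 1 < s.re → s.re ≤ 2 →
    ‖deriv riemannZeta s / riemannZeta s ^ 2‖ ≤ C * (|s.im| + 3) ^ (9 / 10 : ℝ) := by
  obtain ⟨C₁, h₁⟩ := norm_deriv_riemannZeta_div_sq_le_of_one_le_abs_im
  have hne : ∀ s : ℂ, 1 ≤ s.re → riemannZeta₁ s ≠ 0 := fun s hs h => by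
    rcases eq_or_ne s 1 with rfl | h1
    · simp at h
    · exact riemannZeta_ne_zero_of_one_le_re hs (by
        rw [riemannZeta_eq_inv_sub_mul h1, h, mul_zero])
  have hcomp : IsCompact (Icc (1 : ℝ) 2 ×ℂ Icc (-1 : ℝ) 1) := isCompact_Icc.reProdIm isCompact_Icc
  have hcont : ContinuousOn (fun s : ℂ => (-riemannZeta₁ s + (s - 1) * deriv riemannZeta₁ s)
      / riemannZeta₁ s ^ 2) (Icc (1 : ℝ) 2 ×ℂ Icc (-1 : ℝ) 1) := by
    have c1 : Continuous riemannZeta₁ := differentiable_riemannZeta₁.continuous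
    have c2 : Continuous (deriv riemannZeta₁) := differentiable_riemannZeta₁.deriv.continuous
    refine ContinuousOn.div (by fun_prop) (by fun_prop) fun s hs => pow_ne_zero _ (hne s ?_)
    exact hs.1.1
  obtain ⟨C₂, h₂⟩ := hcomp.exists_bound_of_continuousOn hcont
  refine ⟨max 0 (max C₁ C₂), le_max_left _ _, fun s hs1 hs2 => ?_⟩
  have hW : 1 ≤ (|s.im| + 3) ^ (9 / 10 : ℝ) :=
    Real.one_le_rpow (by linarith [abs_nonneg s.im]) (by norm_num)
  rcases le_or_gt 1 |s.im| with h | h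
  · refine (h₁ s hs1 hs2 h).trans ?_
    gcongr
    exact (le_max_left _ _).trans (le_max_right _ _)
  · have hs : s ≠ 1 := by rintro rfl; simp at hs1
    have hs' : s - 1 ≠ 0 := sub_ne_zero.2 hs
    have h0 := hne s hs1.le
    have e : deriv riemannZeta s / riemannZeta s ^ 2
        = (-riemannZeta₁ s + (s - 1) * deriv riemannZeta₁ s) / riemannZeta₁ s ^ 2 := by
      rw [deriv_riemannZeta_eq_neg_inv_sub_sq_mul_add hs, riemannZeta_eq_inv_sub_mul hs]
      field_simp
    rw [e]
    have h3 := h₂ s ⟨⟨hs1.le, hs2⟩, abs_le.1 h.le⟩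
    have h4 : C₂ ≤ max 0 (max C₁ C₂) := (le_max_right _ _).trans (le_max_right _ _)
    have h5 : 0 ≤ max 0 (max C₁ C₂) := le_max_left _ _
    nlinarith

/-! ### The sum function of the Möbius function -/

theorem mellin_max_one_sub {s : ℂ} (hs : 0 < s.re) :
    MellinConvergent (fun u : ℝ => ((max (1 - u) 0 : ℝ) : ℂ)) s ∧
      mellin (fun u : ℝ => ((max (1 - u) 0 : ℝ) : ℂ)) s = (s * (s + 1))⁻¹ := by
  have h0 : s ≠ 0 := by rintro rfl; simp at hs
  have h1 : s + 1 ≠ 0 := by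
    intro h
    have := congrArg Complex.re h
    simp at this
    linarith
  have hi1 : IntervalIntegrable (fun u : ℝ => (u : ℂ) ^ (s - 1)) volume 0 1 :=
    intervalIntegral.intervalIntegrable_cpow' (by simpa using hs)
  have hi2 : IntervalIntegrable (fun u : ℝ => (u : ℂ) ^ s) volume 0 1 :=
    intervalIntegral.intervalIntegrable_cpow' (by linarith)
  have hcongr : ∀ u ∈ Ioc (0 : ℝ) 1, (u : ℂ) ^ (s - 1) - (u : ℂ) ^ s
      = (u : ℂ) ^ (s - 1) • ((max (1 - u) 0 : ℝ) : ℂ) := by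
    intro u hu
    have hu' : (u : ℂ) ≠ 0 := by exact_mod_cast hu.1.ne'
    rw [max_eq_left (by linarith [hu.2]), smul_eq_mul, Complex.cpow_sub _ _ hu', Complex.cpow_one]
    push_cast
    field_simp
  have hsub : IntegrableOn (fun u : ℝ => (u : ℂ) ^ (s - 1) • ((max (1 - u) 0 : ℝ) : ℂ)) (Ioc 0 1) :=
    ((intervalIntegrable_iff_integrableOn_Ioc_of_le zero_le_one).1 (hi1.sub hi2)).congr_fun hcongr
      measurableSet_Ioc
  have hzero : ∀ u ∈ Ioi (0 : ℝ) \ Ioc 0 1,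
      (u : ℂ) ^ (s - 1) • ((max (1 - u) 0 : ℝ) : ℂ) = 0 := by
    intro u hu
    have : 1 < u := by
      by_contra h
      exact hu.2 ⟨hu.1, not_lt.1 h⟩
    rw [max_eq_right (by linarith)]
    simp
  refine ⟨?_, ?_⟩
  · exact hsub.of_forall_sdiff_eq_zero measurableSet_Ioi hzero
  · rw [mellin, setIntegral_eq_of_subset_of_forall_sdiff_eq_zero measurableSet_Ioi
      (fun u hu => hu.1) hzero, ← setIntegral_congr_fun measurableSet_Ioc hcongr,
      ← intervalIntegral.integral_of_le zero_le_one, intervalIntegral.integral_sub hi1 hi2,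
      integral_cpow (Or.inl (by simpa using hs)), integral_cpow (Or.inl (by linarith))]
    rw [sub_add_cancel, Complex.ofReal_one, Complex.one_cpow, Complex.one_cpow, Complex.ofReal_zero,
      Complex.zero_cpow h0, Complex.zero_cpow h1]
    field_simp
    ring

theorem norm_inv_mul_add_one_le {σ y : ℝ} (hσ : 1 ≤ σ) :
    ‖(((σ : ℂ) + y * Complex.I) * ((σ : ℂ) + y * Complex.I + 1))⁻¹‖ ≤ (1 + y ^ 2)⁻¹ := by
  have h1 : 1 + y ^ 2 ≤ ‖(σ : ℂ) + y * Complex.I‖ ^ 2 := by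
    rw [← Complex.normSq_eq_norm_sq, Complex.normSq_add_mul_I]
    nlinarith
  have h2 : ‖(σ : ℂ) + y * Complex.I‖ ≤ ‖(σ : ℂ) + y * Complex.I + 1‖ := by
    have e : (σ : ℂ) + y * Complex.I + 1 = ((σ + 1 : ℝ) : ℂ) + y * Complex.I := by push_cast; ring
    rw [e, ← sq_le_sq₀ (norm_nonneg _) (norm_nonneg _), ← Complex.normSq_eq_norm_sq,
      ← Complex.normSq_eq_norm_sq, Complex.normSq_add_mul_I, Complex.normSq_add_mul_I]
    nlinarith
  rw [norm_inv, norm_mul]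
  refine inv_anti₀ (by positivity) (h1.trans ?_)
  rw [pow_two]
  gcongr

/-- The Perron formula with the weight `1 - n / x`. -/
theorem tsum_mul_max_one_sub_div {a : ℕ → ℂ} (ha0 : a 0 = 0) {σ x : ℝ} (hσ : 1 ≤ σ) (hx : 0 < x)
    (ha : LSeriesSummable a σ) :
    ∑' n, a n * ((max (1 - n / x) 0 : ℝ) : ℂ) = (1 / (2 * Real.pi)) • ∫ y : ℝ,
      LSeries a (σ + y * Complex.I) * ((x : ℂ) ^ ((σ : ℂ) + y * Complex.I)
        * (((σ : ℂ) + y * Complex.I) * ((σ : ℂ) + y * Complex.I + 1))⁻¹) := by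
  have hre : ∀ y : ℝ, ((σ : ℂ) + y * Complex.I).re = σ := fun y => by simp
  set K : ℝ → ℂ := fun y => (x : ℂ) ^ ((σ : ℂ) + y * Complex.I)
    * (((σ : ℂ) + y * Complex.I) * ((σ : ℂ) + y * Complex.I + 1))⁻¹ with hK
  have hx' : (x : ℂ) ≠ 0 := by exact_mod_cast hx.ne'
  have hs0 : ∀ y : ℝ, (σ : ℂ) + y * Complex.I ≠ 0 := fun y h => by
    have := hre y; rw [h, Complex.zero_re] at this; linarith
  have hs1 : ∀ y : ℝ, (σ : ℂ) + y * Complex.I + 1 ≠ 0 := fun y h => by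
    have := hre y
    rw [eq_neg_of_add_eq_zero_left h, Complex.neg_re, Complex.one_re] at this; linarith
  have hcontI : Continuous fun y : ℝ =>
      (((σ : ℂ) + y * Complex.I) * ((σ : ℂ) + y * Complex.I + 1))⁻¹ :=
    Continuous.inv₀ (by fun_prop) fun y => mul_ne_zero (hs0 y) (hs1 y)
  have hintI : Integrable fun y : ℝ =>
      (((σ : ℂ) + y * Complex.I) * ((σ : ℂ) + y * Complex.I + 1))⁻¹ :=
    integrable_inv_one_add_sq.mono' hcontI.aestronglyMeasurable
      (.of_forall fun y => norm_inv_mul_add_one_le hσ)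
  have hcpow : ∀ z : ℝ, 0 < z → Continuous fun y : ℝ => (z : ℂ) ^ ((σ : ℂ) + y * Complex.I) :=
    fun z hz => Continuous.const_cpow (by fun_prop) (Or.inl (by exact_mod_cast hz.ne'))
  have hKi : Integrable K := by
    refine (hintI.norm.const_mul (x ^ σ)).mono' ((hcpow x hx).mul hcontI).aestronglyMeasurable
      (.of_forall fun y => ?_)
    rw [hK]
    simp only
    rw [norm_mul, Complex.norm_cpow_eq_rpow_re_of_pos hx, hre]
  have hterm : ∀ n : ℕ, ∀ y : ℝ, ‖LSeries.term a (σ + y * Complex.I) n‖ = ‖LSeries.term a σ n‖ :=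
    fun n y => by
    rw [LSeries.norm_term_eq, LSeries.norm_term_eq, hre, Complex.ofReal_re]
  have hcontT : ∀ n : ℕ, Continuous fun y : ℝ => LSeries.term a (σ + y * Complex.I) n := fun n => by
    rcases Nat.eq_zero_or_pos n with rfl | hn
    · simpa using continuous_const
    · simp_rw [LSeries.term_of_ne_zero hn.ne']
      refine Continuous.div continuous_const ?_ fun y => ?_
      · have := hcpow n (by exact_mod_cast hn)
        simpa using this
      · rw [Complex.cpow_ne_zero_iff]
        exact Or.inl (by exact_mod_cast hn.ne')
  have hFi : ∀ n : ℕ, Integrable fun y : ℝ => LSeries.term a (σ + y * Complex.I) n * K y := fun n =>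
    hKi.bdd_mul (c := ‖LSeries.term a σ n‖) (hcontT n).aestronglyMeasurable
      (.of_forall fun y => (hterm n y).le)
  have hFs : Summable fun n : ℕ => ∫ y : ℝ, ‖LSeries.term a (σ + y * Complex.I) n * K y‖ := by
    have : ∀ n : ℕ, ∫ y : ℝ, ‖LSeries.term a (σ + y * Complex.I) n * K y‖
        = ‖LSeries.term a σ n‖ * ∫ y : ℝ, ‖K y‖ := fun n => by
      rw [← integral_const_mul]
      exact integral_congr_ae (.of_forall fun y => by simp only [norm_mul, hterm])
    simp_rw [this]
    exact (Summable.norm ha).mul_right _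
  have hfub := (hasSum_integral_of_summable_integral_norm hFi hFs).tsum_eq
  have hL : ∀ y : ℝ, ∑' n, LSeries.term a (σ + y * Complex.I) n * K y
      = LSeries a (σ + y * Complex.I) * K y := fun y => tsum_mul_right
  simp_rw [hL] at hfub
  rw [← hfub, ← tsum_const_smul'']
  refine tsum_congr fun n => ?_
  rcases Nat.eq_zero_or_pos n with rfl | hn
  · simp [ha0]
  have hn0 : (0 : ℝ) < n := by exact_mod_cast hn
  have hσ0 : 0 < σ := by linarith
  have hinv := mellinInv_mellin_eq σ (fun u : ℝ => ((max (1 - u) 0 : ℝ) : ℂ)) (div_pos hn0 hx)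
    (mellin_max_one_sub (by simpa using hσ0)).1 (by
      refine hintI.congr (.of_forall fun y => ?_)
      exact (mellin_max_one_sub (by rw [hre]; exact hσ0)).2.symm) (by fun_prop)
  rw [← hinv, mellinInv, mul_smul_comm, ← integral_const_mul]
  congr 1
  refine integral_congr_ae (.of_forall fun y => ?_)
  simp only [hK]
  rw [LSeries.term_of_ne_zero hn.ne', (mellin_max_one_sub (by rw [hre]; exact hσ0)).2, smul_eq_mul,
    Complex.ofReal_div, Complex.cpow_neg, Complex.div_cpow_ofReal_nonneg hn0.le hx.le, inv_div,
    Complex.ofReal_natCast]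
  ring

open scoped ArithmeticFunction.Moebius in
theorem LSeries_logMul_moebius {s : ℂ} (hs : 1 < s.re) :
    LSeriesSummable (LSeries.logMul fun n => (μ n : ℂ)) s ∧
      LSeries (LSeries.logMul fun n => (μ n : ℂ)) s = deriv riemannZeta s / riemannZeta s ^ 2 := by
  have habs : LSeries.abscissaOfAbsConv (fun n => (μ n : ℂ)) < s.re := by
    rw [ArithmeticFunction.abscissaOfAbsConv_moebius]; exact_mod_cast hs
  refine ⟨LSeriesSummable_logMul_of_lt_re habs, ?_⟩
  have h1 := LSeries_deriv habs
  have h2 : deriv (LSeries fun n => (μ n : ℂ)) s = deriv (fun z => (riemannZeta z)⁻¹) s := by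
    refine Filter.EventuallyEq.deriv_eq ?_
    filter_upwards [(isOpen_lt continuous_const Complex.continuous_re).mem_nhds hs] with z hz
    have := ArithmeticFunction.LSeries_zeta_mul_Lseries_moebius hz
    rw [ArithmeticFunction.LSeries_zeta_eq_riemannZeta hz] at this
    exact eq_inv_of_mul_eq_one_right this
  have h3 : deriv (fun z => (riemannZeta z)⁻¹) s = -deriv riemannZeta s / riemannZeta s ^ 2 :=
    deriv_fun_inv'' (differentiableAt_riemannZeta (by rintro rfl; simp at hs))
      (riemannZeta_ne_zero_of_one_lt_re hs)
  rw [← neg_eq_iff_eq_neg.2 h1, h2, h3, neg_div, neg_neg]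

theorem integrable_abs_add_three_rpow_mul_inv : Integrable fun y : ℝ => (|y| + 3) ^ (9 / 10 : ℝ) * (1 + y ^ 2)⁻¹ := by
  have hdom : Integrable fun y : ℝ => 4 * (1 + ‖y‖ ^ 2) ^ (-(11 / 10) / 2 : ℝ) :=
    (integrable_rpow_neg_one_add_norm_sq (by simp; norm_num)).const_mul 4
  refine hdom.mono' ?_ (.of_forall fun y => ?_)
  · refine Continuous.aestronglyMeasurable ?_
    refine Continuous.mul ?_ ?_
    · exact (continuous_abs.add continuous_const).rpow_const fun y => Or.inr (by norm_num)
    · exact Continuous.inv₀ (by fun_prop) fun y => by positivity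
  · have hy : 0 < 1 + y ^ 2 := by positivity
    rw [Real.norm_of_nonneg (by positivity), Real.norm_eq_abs, sq_abs]
    have h1 : |y| + 3 ≤ 4 * (1 + y ^ 2) ^ (1 / 2 : ℝ) := by
      rw [← Real.sqrt_eq_rpow]
      have a1 : |y| ≤ √(1 + y ^ 2) := Real.abs_le_sqrt (by linarith)
      have a2 : 1 ≤ √(1 + y ^ 2) := Real.one_le_sqrt.2 (by nlinarith [sq_nonneg y])
      linarith
    have h2 : (|y| + 3) ^ (9 / 10 : ℝ) ≤ 4 * (1 + y ^ 2) ^ (9 / 20 : ℝ) := by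
      calc (|y| + 3) ^ (9 / 10 : ℝ) ≤ (4 * (1 + y ^ 2) ^ (1 / 2 : ℝ)) ^ (9 / 10 : ℝ) := by gcongr
        _ = 4 ^ (9 / 10 : ℝ) * (1 + y ^ 2) ^ (9 / 20 : ℝ) := by
            rw [Real.mul_rpow (by norm_num) (by positivity), ← Real.rpow_mul hy.le]; norm_num
        _ ≤ 4 * (1 + y ^ 2) ^ (9 / 20 : ℝ) := by
            gcongr
            calc (4 : ℝ) ^ (9 / 10 : ℝ) ≤ 4 ^ (1 : ℝ) :=
                  Real.rpow_le_rpow_of_exponent_le (by norm_num) (by norm_num)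
              _ = 4 := Real.rpow_one 4
    calc _ ≤ 4 * (1 + y ^ 2) ^ (9 / 20 : ℝ) * (1 + y ^ 2)⁻¹ := by gcongr
      _ = 4 * (1 + y ^ 2) ^ (-(11 / 10) / 2 : ℝ) := by
          rw [mul_assoc, ← Real.rpow_neg_one, ← Real.rpow_add hy]; norm_num

open scoped ArithmeticFunction.Moebius in
/-- The Perron integral is taken on the line `σ = 1 + 1 / log x`, where `|x ^ s| = e x`. -/
theorem abs_sum_moebius_mul_log_mul_le : ∃ C : ℝ, 0 ≤ C ∧ ∀ x : ℝ, Real.exp 1 ≤ x →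
    |∑ n ∈ Finset.Icc 1 ⌊x⌋₊, (μ n : ℝ) * Real.log n * (1 - n / x)| ≤ C * x := by
  obtain ⟨C, hC, h⟩ := norm_deriv_riemannZeta_div_sq_le
  set J : ℝ := ∫ y : ℝ, (|y| + 3) ^ (9 / 10 : ℝ) * (1 + y ^ 2)⁻¹ with hJ
  have hJ0 : 0 ≤ J := integral_nonneg fun y => by positivity
  refine ⟨1 / (2 * Real.pi) * (C * Real.exp 1 * J), by positivity, fun x hx => ?_⟩
  have hx0 : 0 < x := (Real.exp_pos 1).trans_le hx
  have hlog : 1 ≤ Real.log x := (Real.le_log_iff_exp_le hx0).2 hx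
  have hlog0 : 0 < Real.log x := by linarith
  set σ : ℝ := 1 + (Real.log x)⁻¹ with hσ
  have hσ1 : 1 < σ := by rw [hσ]; linarith [inv_pos.2 hlog0]
  have hσ2 : σ ≤ 2 := by rw [hσ]; linarith [inv_le_one_of_one_le₀ hlog]
  have hre : ∀ y : ℝ, ((σ : ℂ) + y * Complex.I).re = σ := fun y => by simp
  have him : ∀ y : ℝ, ((σ : ℂ) + y * Complex.I).im = y := fun y => by simp
  set a : ℕ → ℂ := LSeries.logMul fun n => (μ n : ℂ) with ha
  have hperron := tsum_mul_max_one_sub_div (a := a) (by simp [ha, LSeries.logMul]) hσ1.le hx0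
    (LSeries_logMul_moebius (s := (σ : ℂ)) (by simpa using hσ1)).1
  have hsum : ∑' n, a n * ((max (1 - n / x) 0 : ℝ) : ℂ)
      = ((∑ n ∈ Finset.Icc 1 ⌊x⌋₊, (μ n : ℝ) * Real.log n * (1 - n / x) : ℝ) : ℂ) := by
    rw [tsum_eq_sum (s := Finset.Icc 1 ⌊x⌋₊)]
    · rw [Complex.ofReal_sum]
      refine Finset.sum_congr rfl fun n hn => ?_
      have hn2 := (Nat.le_floor_iff hx0.le).1 (Finset.mem_Icc.1 hn).2
      rw [max_eq_left (by rw [sub_nonneg, div_le_one hx0]; exact hn2), ha, LSeries.logMul,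
        Complex.ofReal_mul, Complex.ofReal_mul, Complex.natCast_log]
      push_cast
      ring
    · intro n hn
      rcases Nat.eq_zero_or_pos n with rfl | hn0
      · simp [ha, LSeries.logMul]
      · have : x < n := by
          by_contra hcon
          exact hn (Finset.mem_Icc.2 ⟨hn0, Nat.le_floor (not_lt.1 hcon)⟩)
        rw [max_eq_right (by rw [sub_nonpos, one_le_div hx0]; exact this.le)]
        simp
  rw [hsum] at hperron
  rw [← Real.norm_eq_abs, ← Complex.norm_real, hperron, norm_smul,
    Real.norm_of_nonneg (by positivity)]
  have hxσ : x ^ σ = Real.exp 1 * x := by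
    rw [hσ, Real.rpow_add hx0, Real.rpow_one, Real.rpow_def_of_pos hx0,
      mul_inv_cancel₀ hlog0.ne', mul_comm]
  rw [mul_assoc (1 / (2 * Real.pi))]
  gcongr
  refine (norm_integral_le_of_norm_le (integrable_abs_add_three_rpow_mul_inv.const_mul (C * (Real.exp 1 * x)))
    (.of_forall fun y => ?_)).trans (le_of_eq ?_)
  · rw [(LSeries_logMul_moebius (by rw [hre]; exact hσ1)).2, norm_mul, norm_mul,
      Complex.norm_cpow_eq_rpow_re_of_pos hx0, hre, hxσ]
    have b1 := h ((σ : ℂ) + y * Complex.I) (by rw [hre]; exact hσ1) (by rw [hre]; exact hσ2)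
    rw [him] at b1
    have b2 := norm_inv_mul_add_one_le (y := y) hσ1.le
    calc _ ≤ (C * (|y| + 3) ^ (9 / 10 : ℝ)) * (Real.exp 1 * x * (1 + y ^ 2)⁻¹) := by gcongr
      _ = _ := by ring
  · rw [integral_const_mul, ← hJ]
    ring

theorem sum_log_div_le {x : ℝ} (hx : 0 < x) :
    ∑ n ∈ Finset.Icc 1 ⌊x⌋₊, Real.log (x / n) ≤ x := by
  have h : ∀ N : ℕ, ∑ n ∈ Finset.Icc 1 N, Real.log (x / n) = Real.log (x ^ N / N !) := by
    intro N
    induction N with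
    | zero => simp
    | succ k ih =>
      have hk : ((k ! : ℕ) : ℝ) ≠ 0 := by exact_mod_cast (Nat.factorial_pos k).ne'
      have hk' : ((k + 1 : ℕ) : ℝ) ≠ 0 := by positivity
      rw [Finset.sum_Icc_succ_top (by omega), ih, ← Real.log_mul (by positivity) (by positivity)]
      congr 1
      rw [Nat.factorial_succ]
      push_cast
      field_simp
      ring
  rw [h]
  calc Real.log (x ^ ⌊x⌋₊ / ⌊x⌋₊ !) ≤ Real.log (Real.exp x) := by
        refine Real.log_le_log (by positivity) (Real.pow_div_factorial_le_exp x hx.le _)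
    _ = x := Real.log_exp x

open scoped ArithmeticFunction.Moebius in
/-- The weight `log n` is replaced by `log x`, at the cost of `∑ log (x / n) ≤ x`. -/
theorem abs_sum_moebius_mul_max_le : ∃ C : ℝ, 0 ≤ C ∧ ∀ x : ℝ, Real.exp 1 ≤ x → ∀ N : ℕ, ⌊x⌋₊ ≤ N →
    |∑ n ∈ Finset.Icc 1 N, (μ n : ℝ) * max (x - n) 0| ≤ C * (x ^ 2 / Real.log x) := by
  obtain ⟨C, hC, h⟩ := abs_sum_moebius_mul_log_mul_le
  refine ⟨C + 1, by linarith, fun x hx N hN => ?_⟩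
  have hx0 : 0 < x := (Real.exp_pos 1).trans_le hx
  have hlog : 1 ≤ Real.log x := (Real.le_log_iff_exp_le hx0).2 hx
  have hlog0 : 0 < Real.log x := by linarith
  have e1 : ∑ n ∈ Finset.Icc 1 N, (μ n : ℝ) * max (x - n) 0
      = ∑ n ∈ Finset.Icc 1 ⌊x⌋₊, (μ n : ℝ) * (x - n) := by
    rw [← Finset.sum_subset (Finset.Icc_subset_Icc_right hN)]
    · refine Finset.sum_congr rfl fun n hn => ?_
      have hn2 := (Nat.le_floor_iff hx0.le).1 (Finset.mem_Icc.1 hn).2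
      rw [max_eq_left (by linarith)]
    · intro n hn hn'
      have : x < n := by
        by_contra hcon
        exact hn' (Finset.mem_Icc.2 ⟨(Finset.mem_Icc.1 hn).1, Nat.le_floor (not_lt.1 hcon)⟩)
      rw [max_eq_right (by linarith), mul_zero]
  have e2 : Real.log x * ∑ n ∈ Finset.Icc 1 ⌊x⌋₊, (μ n : ℝ) * (x - n)
      = x * (∑ n ∈ Finset.Icc 1 ⌊x⌋₊, (μ n : ℝ) * Real.log n * (1 - n / x)
        + ∑ n ∈ Finset.Icc 1 ⌊x⌋₊, (μ n : ℝ) * Real.log (x / n) * (1 - n / x)) := by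
    rw [← Finset.sum_add_distrib, Finset.mul_sum, Finset.mul_sum]
    refine Finset.sum_congr rfl fun n hn => ?_
    have hn0 : (n : ℝ) ≠ 0 := by
      have := (Finset.mem_Icc.1 hn).1
      positivity
    rw [Real.log_div hx0.ne' hn0]
    field_simp
    ring
  have e3 : |∑ n ∈ Finset.Icc 1 ⌊x⌋₊, (μ n : ℝ) * Real.log (x / n) * (1 - n / x)| ≤ x := by
    refine (Finset.abs_sum_le_sum_abs _ _).trans (le_trans ?_ (sum_log_div_le hx0))
    refine Finset.sum_le_sum fun n hn => ?_
    have hn1 : (1 : ℝ) ≤ n := by exact_mod_cast (Finset.mem_Icc.1 hn).1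
    have hn2 := (Nat.le_floor_iff hx0.le).1 (Finset.mem_Icc.1 hn).2
    have a1 : |(μ n : ℝ)| ≤ 1 := by exact_mod_cast ArithmeticFunction.abs_moebius_le_one
    have a2 : 0 ≤ Real.log (x / n) := Real.log_nonneg (by rw [one_le_div (by linarith)]; exact hn2)
    have a3 : n / x ≤ 1 := (div_le_one hx0).2 hn2
    have a4 : 0 ≤ n / x := by positivity
    rw [abs_mul, abs_mul, abs_of_nonneg a2, abs_of_nonneg (by linarith : 0 ≤ 1 - n / x)]
    calc _ ≤ 1 * Real.log (x / n) * 1 := by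
          gcongr
          linarith
      _ = _ := by ring
  rw [e1]
  have e4 : |Real.log x * ∑ n ∈ Finset.Icc 1 ⌊x⌋₊, (μ n : ℝ) * (x - n)| ≤ x * (C * x + x) := by
    rw [e2, abs_mul, abs_of_pos hx0]
    gcongr
    exact (abs_add_le _ _).trans (add_le_add (h x hx) e3)
  rw [abs_mul, abs_of_pos hlog0] at e4
  rw [← mul_div_assoc, le_div_iff₀ hlog0]
  linarith

open scoped ArithmeticFunction.Moebius in
/-- A rate in `∑_{n ≤ x} μ(n) = o(x)`. The smooth weight `x - n` is removed by a difference quotient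
with step `x / √(log x)`. -/
theorem sum_moebius_isBigO : (fun x : ℝ => ∑ n ∈ Finset.Icc 1 ⌊x⌋₊, (μ n : ℝ)) =O[atTop]
    fun x : ℝ => x / Real.log x ^ (1 / 2 : ℝ) := by
  obtain ⟨C, hC, h⟩ := abs_sum_moebius_mul_max_le
  refine IsBigO.of_bound (2 + 5 * C) ?_
  filter_upwards [eventually_ge_atTop (Real.exp 1)] with x hx
  have hx0 : 0 < x := (Real.exp_pos 1).trans_le hx
  have hx1 : 1 ≤ x := (Real.one_le_exp zero_le_one).trans hx
  have hlog : 1 ≤ Real.log x := (Real.le_log_iff_exp_le hx0).2 hx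
  have hlog0 : 0 < Real.log x := by linarith
  rw [← Real.sqrt_eq_rpow]
  set q : ℝ := √(Real.log x) with hq
  have hq1 : 1 ≤ q := Real.one_le_sqrt.2 hlog
  have hq0 : 0 < q := by linarith
  have hq2 : q ^ 2 = Real.log x := Real.sq_sqrt hlog0.le
  have hqx : q ≤ x := by
    have := Real.log_le_sub_one_of_pos hx0
    nlinarith
  set d : ℝ := x / q with hd
  have hd0 : 0 < d := by positivity
  have hd1 : 1 ≤ d := (one_le_div hq0).2 hqx
  have hdx : d ≤ x := div_le_self hx0.le hq1
  set N : ℕ := ⌊x + d⌋₊ with hN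
  have hxN : ⌊x⌋₊ ≤ N := Nat.floor_le_floor (by linarith)
  have b1 := h x hx N hxN
  have b2 := h (x + d) (by linarith) N le_rfl
  set G₁ := ∑ n ∈ Finset.Icc 1 N, (μ n : ℝ) * max (x - n) 0 with hG₁
  set G₂ := ∑ n ∈ Finset.Icc 1 N, (μ n : ℝ) * max (x + d - n) 0 with hG₂
  set M := ∑ n ∈ Finset.Icc 1 ⌊x⌋₊, (μ n : ℝ) with hM
  have b3 : (x + d) ^ 2 / Real.log (x + d) ≤ 4 * (x ^ 2 / Real.log x) := by
    rw [← mul_div_assoc]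
    have : Real.log x ≤ Real.log (x + d) := Real.log_le_log hx0 (by linarith)
    gcongr
    nlinarith
  have hIoc : Finset.Icc 1 N = Finset.Icc 1 ⌊x⌋₊ ∪ Finset.Ioc ⌊x⌋₊ N := by
    ext n; simp only [Finset.mem_union, Finset.mem_Icc, Finset.mem_Ioc]; omega
  have hdisj : Disjoint (Finset.Icc 1 ⌊x⌋₊) (Finset.Ioc ⌊x⌋₊ N) := by
    rw [Finset.disjoint_left]; intro n hn hn'
    simp only [Finset.mem_Icc, Finset.mem_Ioc] at hn hn'; omega
  have b4 : G₂ - G₁ - d * M = ∑ n ∈ Finset.Ioc ⌊x⌋₊ N, (μ n : ℝ) * (x + d - n) := by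
    rw [hG₂, hG₁, ← Finset.sum_sub_distrib, hIoc, Finset.sum_union hdisj, hM, Finset.mul_sum,
      add_sub_right_comm, ← Finset.sum_sub_distrib, Finset.sum_eq_zero, zero_add]
    · refine Finset.sum_congr rfl fun n hn => ?_
      rw [Finset.mem_Ioc] at hn
      have c1 : x < n := (Nat.floor_lt hx0.le).1 hn.1
      have c2 : (n : ℝ) ≤ x + d := (Nat.le_floor_iff (by linarith)).1 hn.2
      rw [max_eq_left (by linarith), max_eq_right (by linarith)]
      ring
    · intro n hn
      have hn2 := (Nat.le_floor_iff hx0.le).1 (Finset.mem_Icc.1 hn).2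
      rw [max_eq_left (by linarith), max_eq_left (by linarith)]
      ring
  have b5 : |G₂ - G₁ - d * M| ≤ (d + 1) * d := by
    rw [b4]
    refine (Finset.abs_sum_le_sum_abs _ _).trans ?_
    have c0 : ∀ n ∈ Finset.Ioc ⌊x⌋₊ N, |(μ n : ℝ) * (x + d - n)| ≤ d := by
      intro n hn
      rw [Finset.mem_Ioc] at hn
      have c1 : x < n := (Nat.floor_lt hx0.le).1 hn.1
      have c2 : (n : ℝ) ≤ x + d := (Nat.le_floor_iff (by linarith)).1 hn.2
      have a1 : |(μ n : ℝ)| ≤ 1 := by exact_mod_cast ArithmeticFunction.abs_moebius_le_one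
      rw [abs_mul, abs_of_nonneg (by linarith : 0 ≤ x + d - n)]
      nlinarith [abs_nonneg (μ n : ℝ)]
    refine (Finset.sum_le_card_nsmul _ _ _ c0).trans ?_
    rw [nsmul_eq_mul, Nat.card_Ioc, Nat.cast_sub hxN]
    have c3 : (N : ℝ) ≤ x + d := Nat.floor_le (by linarith)
    have c4 := Nat.lt_floor_add_one x
    gcongr
    linarith
  have b6 : d * |M| ≤ (d + 1) * d + 5 * C * (x ^ 2 / Real.log x) := by
    have c1 : d * |M| = |d * M| := by rw [abs_mul, abs_of_pos hd0]
    have c2 : |d * M| ≤ |G₂ - G₁ - d * M| + |G₂| + |G₁| := by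
      have : d * M = -(G₂ - G₁ - d * M) + G₂ + -G₁ := by ring
      calc |d * M| = |-(G₂ - G₁ - d * M) + G₂ + -G₁| := by rw [← this]
        _ ≤ |-(G₂ - G₁ - d * M)| + |G₂| + |-G₁| := abs_add_three _ _ _
        _ = _ := by rw [abs_neg, abs_neg]
    have c3 := mul_le_mul_of_nonneg_left b3 hC
    rw [c1]
    linarith
  have b7 : x ^ 2 / Real.log x = d * d := by rw [← hq2, hd]; field_simp
  rw [b7] at b6
  have b8 : |M| ≤ d + 1 + 5 * C * d := by
    refine le_of_mul_le_mul_left ?_ hd0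
    linarith
  rw [Real.norm_eq_abs, Real.norm_of_nonneg hd0.le]
  linarith

/-! ### The rational primes -/

/-- The measure with mass `c n` at each natural number `n`. -/
def natMeasure (c : ℕ → ℝ≥0∞) : Measure ℝ := Measure.sum fun n => c n • Measure.dirac (n : ℝ)

instance (c : ℕ → ℝ≥0∞) : SFinite (natMeasure c) := by unfold natMeasure; infer_instance

theorem lintegral_natMeasure (c : ℕ → ℝ≥0∞) (f : ℝ → ℝ≥0∞) :
    ∫⁻ u, f u ∂natMeasure c = ∑' n, c n * f n := by
  rw [natMeasure, lintegral_sum_measure]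
  simp_rw [lintegral_smul_measure, lintegral_dirac, smul_eq_mul]

theorem natMeasure_apply (c : ℕ → ℝ≥0∞) {s : Set ℝ} (hs : MeasurableSet s) :
    natMeasure c s = ∑' n, c n * s.indicator 1 (n : ℝ) := by
  rw [← lintegral_indicator_one hs, lintegral_natMeasure]

theorem natMeasure_Iio {c : ℕ → ℝ≥0∞} (h0 : c 0 = 0) : natMeasure c (Iio 1) = 0 := by
  rw [natMeasure_apply c measurableSet_Iio, ENNReal.tsum_eq_zero]
  intro n
  rcases Nat.eq_zero_or_pos n with rfl | hn
  · simp [h0]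
  · have : (n : ℝ) ∉ Iio (1 : ℝ) := by simpa using hn.ne'
    rw [indicator_of_notMem this, mul_zero]

theorem natMeasure_real_Icc {c : ℕ → ℝ≥0∞} (hc : ∀ n, c n ≠ ∞) {x : ℝ} (hx : 0 ≤ x) :
    (natMeasure c).real (Icc 1 x) = ∑ n ∈ Finset.Icc 1 ⌊x⌋₊, (c n).toReal := by
  have hmem : ∀ n : ℕ, n ∈ Finset.Icc 1 ⌊x⌋₊ ↔ (n : ℝ) ∈ Icc 1 x := fun n => by
    rw [Finset.mem_Icc, mem_Icc, Nat.le_floor_iff hx]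
    norm_cast
  rw [measureReal_def, natMeasure_apply c measurableSet_Icc,
    tsum_eq_sum (s := Finset.Icc 1 ⌊x⌋₊), ENNReal.toReal_sum]
  · refine Finset.sum_congr rfl fun n hn => ?_
    rw [indicator_of_mem ((hmem n).1 hn), Pi.one_apply, mul_one]
  · intro n hn
    rw [indicator_of_mem ((hmem n).1 hn), Pi.one_apply, mul_one]
    exact hc n
  · intro n hn
    rw [indicator_of_notMem (mt (hmem n).2 hn), mul_zero]

theorem lintegral_mellinWeight_natMeasure {c : ℕ → ℝ≥0∞} (hc : ∀ n, c n ≤ 1) :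
    ∫⁻ u, mellinWeight u ∂natMeasure c ≠ ∞ := by
  rw [lintegral_natMeasure]
  have hs : Summable fun n : ℕ => ((n : ℝ)⁻¹) ^ 2 :=
    (Real.summable_one_div_nat_pow.2 one_lt_two).congr fun n => by rw [one_div, inv_pow]
  refine ne_top_of_le_ne_top (ENNReal.ofReal_ne_top (r := ∑' n : ℕ, ((n : ℝ)⁻¹) ^ 2)) ?_
  rw [ENNReal.ofReal_tsum_of_nonneg (fun n => by positivity) hs]
  exact ENNReal.tsum_le_tsum fun n => mul_le_of_le_one_left' (hc n)

theorem hasSum_mellinKernel_natMeasure {c : ℕ → ℝ≥0∞} (h0 : c 0 = 0) (hc : ∀ n, c n ≤ 1) (t : ℝ) :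
    HasSum (LSeries.term (fun n => ((c n).toReal : ℂ)) (2 - t * Complex.I))
      (∫ u, mellinKernel t u ∂natMeasure c) := by
  have h := hasSum_integral_measure
    (integrable_mellinKernel (lintegral_mellinWeight_natMeasure hc) t)
  refine h.congr_fun fun n => ?_
  rw [integral_smul_measure, integral_dirac, Complex.real_smul]
  rcases Nat.eq_zero_or_pos n with rfl | hn
  · simp [h0]
  · rw [LSeries.term_of_ne_zero hn.ne', mellinKernel_eq_cpow t (by exact_mod_cast hn),
      Complex.cpow_neg, Complex.ofReal_natCast, div_eq_mul_inv]

open scoped ArithmeticFunction.vonMangoldt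

theorem vonMangoldt_div_log_nonneg (n : ℕ) : 0 ≤ Λ n / Real.log n :=
  div_nonneg ArithmeticFunction.vonMangoldt_nonneg (Real.log_natCast_nonneg n)

theorem vonMangoldt_div_log_le_one (n : ℕ) : Λ n / Real.log n ≤ 1 :=
  div_le_one_of_le₀ ArithmeticFunction.vonMangoldt_le_log (Real.log_natCast_nonneg n)

theorem vonMangoldt_div_log_primePow (p : Nat.Primes) (k : ℕ) :
    Λ ((p : ℕ) ^ (k + 1)) / Real.log ((p : ℕ) ^ (k + 1) : ℕ) = ((k + 1 : ℕ) : ℝ)⁻¹ := by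
  have hp : Real.log (p : ℕ) ≠ 0 := (Real.log_pos (by exact_mod_cast p.2.one_lt)).ne'
  rw [ArithmeticFunction.vonMangoldt_apply_pow k.succ_ne_zero,
    ArithmeticFunction.vonMangoldt_apply_prime p.2, Nat.cast_pow, Real.log_pow]
  field_simp

/-- Riemann's prime measure has mass `Λ(n) / log n` at `n`. -/
theorem classicalPrimeMeasure_eq :
    classicalPrimeMeasure = natMeasure fun n => ENNReal.ofReal (Λ n / Real.log n) := by
  ext s hs
  rw [natMeasure_apply _ hs, classicalPrimeMeasure, Measure.sum_apply _ hs]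
  set g : ℕ → ℝ≥0∞ := fun n => ENNReal.ofReal (Λ n / Real.log n) * s.indicator 1 (n : ℝ) with hg
  have h1 : ∑' n, g n = ∑' n : {n : ℕ // IsPrimePow n}, g n := by
    refine (tsum_subtype_eq_of_support_subset (s := {n : ℕ | IsPrimePow n}) fun n hn => ?_).symm
    by_contra h
    refine hn ?_
    rw [hg]
    simp only
    rw [ArithmeticFunction.vonMangoldt_eq_zero_iff.2 h]
    simp
  rw [h1, ← Nat.Primes.prodNatEquiv.tsum_eq]
  refine tsum_congr fun i => ?_
  obtain ⟨p, k⟩ := i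
  rw [Nat.Primes.prodNatEquiv_apply, hg]
  simp only
  rw [vonMangoldt_div_log_primePow, Measure.smul_apply, Measure.dirac_apply' _ hs, smul_eq_mul,
    ENNReal.ofReal_inv_of_pos (by positivity), ENNReal.ofReal_natCast, Nat.cast_pow]

theorem exp_LSeries_vonMangoldt_div_log {s : ℂ} (hs : 1 < s.re) :
    Complex.exp (LSeries (fun n => ((Λ n / Real.log n : ℝ) : ℂ)) s) = riemannZeta s := by
  rw [← riemannZeta_eq_exp_LSeries hs]
  congr 2
  funext n
  push_cast
  rfl

theorem lintegral_mellinWeight_classicalPrimeMeasure :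
    ∫⁻ u, mellinWeight u ∂classicalPrimeMeasure ≠ ∞ := by
  rw [classicalPrimeMeasure_eq]
  exact lintegral_mellinWeight_natMeasure fun n =>
    ENNReal.ofReal_le_one.2 (vonMangoldt_div_log_le_one n)

theorem exp_integral_mellinKernel_classicalPrimeMeasure (t : ℝ) :
    Complex.exp (∫ u, mellinKernel t u ∂classicalPrimeMeasure)
      = riemannZeta (2 - t * Complex.I) := by
  rw [← exp_LSeries_vonMangoldt_div_log (by simp), classicalPrimeMeasure_eq,
    ← (hasSum_mellinKernel_natMeasure (by simp) (fun n =>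
      ENNReal.ofReal_le_one.2 (vonMangoldt_div_log_le_one n)) t).tsum_eq]
  simp_rw [ENNReal.toReal_ofReal (vonMangoldt_div_log_nonneg _)]
  rfl

theorem lintegral_rpow_classicalPrimeMeasure {δ : ℝ} (hδ : 0 < δ) :
    ∫⁻ u, ENNReal.ofReal (u ^ (-(1 + δ))) ∂classicalPrimeMeasure
      = ENNReal.ofReal (Real.log (riemannZeta ((1 + δ : ℝ) : ℂ)).re) := by
  have hs : Summable fun n : ℕ => Λ n / Real.log n * (n : ℝ) ^ (-(1 + δ)) := by
    refine Summable.of_nonneg_of_le (fun n => mul_nonneg (vonMangoldt_div_log_nonneg n)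
      (by positivity)) (fun n => mul_le_of_le_one_left (by positivity)
      (vonMangoldt_div_log_le_one n)) (Real.summable_nat_rpow.2 (by linarith))
  have h1 : Real.log (riemannZeta ((1 + δ : ℝ) : ℂ)).re
      = ∑' n : ℕ, Λ n / Real.log n * (n : ℝ) ^ (-(1 + δ)) := by
    rw [log_riemannZeta_eq (by linarith : 1 < 1 + δ)]
    refine tsum_congr fun n => ?_
    rw [Real.rpow_neg n.cast_nonneg]
    field_simp
  rw [h1, classicalPrimeMeasure_eq, lintegral_natMeasure,
    ENNReal.ofReal_tsum_of_nonneg (fun n => mul_nonneg (vonMangoldt_div_log_nonneg n)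
      (by positivity)) hs]
  refine tsum_congr fun n => ?_
  rw [ENNReal.ofReal_mul (vonMangoldt_div_log_nonneg n)]

/-- `log ζ(1 + δ) = log (1 / δ) + O(1)`. -/
theorem abs_log_riemannZeta_sub_le : ∃ K : ℝ, 0 ≤ K ∧ ∀ δ : ℝ, 0 < δ → δ ≤ 1 →
    |Real.log (riemannZeta ((1 + δ : ℝ) : ℂ)).re - Real.log δ⁻¹| ≤ K := by
  have hpos : ∀ s ∈ Icc (1 : ℝ) 2, (riemannZeta₁ (s : ℂ)).re ≠ 0 := by
    intro s hs
    rcases eq_or_lt_of_le hs.1 with rfl | h1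
    · simp
    · intro h
      have h2 := riemannZeta_re_pos_of_one_lt h1
      rw [riemannZeta_eq_inv_sub_mul (by exact_mod_cast h1.ne'), ← Complex.ofReal_one,
        ← Complex.ofReal_sub, ← Complex.ofReal_inv, Complex.re_ofReal_mul, h, mul_zero] at h2
      exact h2.false
  have hcont : ContinuousOn (fun s : ℝ => Real.log (riemannZeta₁ (s : ℂ)).re) (Icc 1 2) := by
    refine ContinuousOn.log (Continuous.continuousOn ?_) hpos
    exact Complex.continuous_re.comp
      (differentiable_riemannZeta₁.continuous.comp Complex.continuous_ofReal)
  obtain ⟨K, hK⟩ := isCompact_Icc.exists_bound_of_continuousOn hcont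
  refine ⟨max K 0, le_max_right _ _, fun δ h0 h1 => ?_⟩
  rw [log_riemannZeta_eq_neg_log_sub_add_ofReal (by linarith : 1 + δ > 1), add_sub_cancel_left,
    Real.log_inv, add_sub_cancel_left]
  exact (hK (1 + δ) ⟨by linarith, by linarith⟩).trans (le_max_left _ _)

open scoped ArithmeticFunction.Moebius in
/-- The measure `∑ μ(n) δ_n`, as a difference of positive measures. -/
def moebiusPair : Measure ℝ × Measure ℝ :=
  (natMeasure fun n => ENNReal.ofReal (μ n), natMeasure fun n => ENNReal.ofReal (-μ n))

open scoped ArithmeticFunction.Moebius in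
theorem ofReal_moebius_le_one (n : ℕ) :
    ENNReal.ofReal (μ n) ≤ 1 ∧ ENNReal.ofReal (-μ n) ≤ 1 := by
  have h : |(μ n : ℝ)| ≤ 1 := by exact_mod_cast ArithmeticFunction.abs_moebius_le_one
  rw [ENNReal.ofReal_le_one, ENNReal.ofReal_le_one]
  exact ⟨(le_abs_self _).trans h, (neg_le_abs _).trans h⟩

theorem mellinPair_moebiusPair : MellinPair moebiusPair where
  sFinite_fst := by unfold moebiusPair; infer_instance
  sFinite_snd := by unfold moebiusPair; infer_instance
  fst_Iio := natMeasure_Iio (by simp)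
  snd_Iio := natMeasure_Iio (by simp)
  fst_ne_top := lintegral_mellinWeight_natMeasure fun n => (ofReal_moebius_le_one n).1
  snd_ne_top := lintegral_mellinWeight_natMeasure fun n => (ofReal_moebius_le_one n).2

open scoped ArithmeticFunction.Moebius in
theorem toReal_ofReal_moebius_sub (n : ℕ) :
    (ENNReal.ofReal (μ n)).toReal - (ENNReal.ofReal (-μ n)).toReal = μ n := by
  rw [ENNReal.toReal_ofReal', ENNReal.toReal_ofReal', max_zero_sub_max_neg_zero_eq_self]

open scoped ArithmeticFunction.Moebius in
theorem pairMellin_moebiusPair (t : ℝ) :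
    pairMellin moebiusPair t = (riemannZeta (2 - t * Complex.I))⁻¹ := by
  have h1 := hasSum_mellinKernel_natMeasure (c := fun n => ENNReal.ofReal (μ n)) (by simp)
    (fun n => (ofReal_moebius_le_one n).1) t
  have h2 := hasSum_mellinKernel_natMeasure (c := fun n => ENNReal.ofReal (-μ n)) (by simp)
    (fun n => (ofReal_moebius_le_one n).2) t
  have hs : 1 < (2 - t * Complex.I : ℂ).re := by simp
  have h3 := ArithmeticFunction.LSeries_zeta_mul_Lseries_moebius hs
  rw [ArithmeticFunction.LSeries_zeta_eq_riemannZeta hs] at h3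
  rw [← eq_inv_of_mul_eq_one_right h3, pairMellin, moebiusPair, ← (h1.sub h2).tsum_eq, LSeries]
  refine tsum_congr fun n => ?_
  rcases Nat.eq_zero_or_pos n with rfl | hn
  · simp
  · rw [LSeries.term_of_ne_zero hn.ne', LSeries.term_of_ne_zero hn.ne',
      LSeries.term_of_ne_zero hn.ne', ← sub_div, ← Complex.ofReal_sub, toReal_ofReal_moebius_sub,
      Complex.ofReal_intCast]

namespace LSMeasure

open scoped ArithmeticFunction.Moebius in
/-- For the rational primes, `exp*(-dΠ₀) = ∑ μ(n) δ_n`. -/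
theorem mobiusSum_classicalPrimes {x : ℝ} (hx : 0 ≤ x) :
    classicalPrimes.mobiusSum x = ∑ n ∈ Finset.Icc 1 ⌊x⌋₊, (μ n : ℝ) := by
  have hw : ∫⁻ u, mellinWeight u ∂(-classicalPrimes).variation ≠ ∞ := by
    rw [variation_neg]
    simpa [classicalPrimes, ofMeasure, variation] using lintegral_mellinWeight_classicalPrimeMeasure
  have h : classicalPrimes.mobiusSum x = pairPrimitive moebiusPair x := by
    refine pairPrimitive_eq_of_pairMellin_eq ((-classicalPrimes).mellinPair_expConv hw)
      mellinPair_moebiusPair (fun t => ?_) x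
    have h3 : pairMellin ((-classicalPrimes).pos, (-classicalPrimes).neg) t
        = -∫ u, mellinKernel t u ∂classicalPrimeMeasure := by
      show (∫ u, mellinKernel t u ∂(0 : Measure ℝ)) - _ = _
      rw [integral_zero_measure, zero_sub]
      rfl
    rw [pairMellin_expConv _ hw, h3, pairMellin_moebiusPair, Complex.exp_neg,
      exp_integral_mellinKernel_classicalPrimeMeasure]
  rw [h, pairPrimitive, moebiusPair, natMeasure_real_Icc (fun n => ENNReal.ofReal_ne_top) hx,
    natMeasure_real_Icc (fun n => ENNReal.ofReal_ne_top) hx, ← Finset.sum_sub_distrib]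
  exact Finset.sum_congr rfl fun n _ => toReal_ofReal_moebius_sub n

/-- The integers up to `√y` have mass at most `1`, and `1 / log n ≤ 2 / log y` for the others. -/
theorem classicalPrimeMeasure_Iic_le {y : ℝ} (hy : 1 < y) :
    classicalPrimeMeasure.real (Iic y) ≤ √y + 2 / Real.log y * Chebyshev.psi y := by
  have hy0 : 0 < y := by linarith
  have hl : 0 < Real.log y := Real.log_pos hy
  rw [measureReal_def, measure_Iic_eq_Icc classicalPrimeMeasure_Iio, ← measureReal_def,
    classicalPrimeMeasure_eq, natMeasure_real_Icc (fun n => ENNReal.ofReal_ne_top) hy0.le]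
  simp_rw [ENNReal.toReal_ofReal (vonMangoldt_div_log_nonneg _)]
  have hterm : ∀ n ∈ Finset.Icc 1 ⌊y⌋₊, Λ n / Real.log n
      ≤ (if n ∈ Finset.Icc 1 ⌊√y⌋₊ then (1 : ℝ) else 0) + 2 / Real.log y * Λ n := by
    intro n hn
    have hΛ : 0 ≤ Λ n := ArithmeticFunction.vonMangoldt_nonneg
    split_ifs with h
    · have := vonMangoldt_div_log_le_one n
      have : 0 ≤ 2 / Real.log y * Λ n := by positivity
      linarith
    · have h1 : √y < n := by
        by_contra hcon
        exact h (Finset.mem_Icc.2 ⟨(Finset.mem_Icc.1 hn).1, Nat.le_floor (not_lt.1 hcon)⟩)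
      have h2 : Real.log y / 2 ≤ Real.log n := by
        rw [← Real.log_sqrt hy0.le]
        exact Real.log_le_log (Real.sqrt_pos.2 hy0) h1.le
      rw [zero_add, div_mul_eq_mul_div, mul_comm 2, mul_div_assoc, div_eq_mul_inv]
      gcongr
      rw [inv_le_comm₀ (by linarith) (by positivity), inv_div]
      exact h2
  refine (Finset.sum_le_sum hterm).trans ?_
  rw [Finset.sum_add_distrib, ← Finset.mul_sum, Chebyshev.psi_eq_sum_Icc]
  gcongr ?_ + 2 / Real.log y * ?_
  · rw [Finset.sum_ite_mem, Finset.sum_const, nsmul_eq_mul, mul_one]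
    calc (((Finset.Icc 1 ⌊y⌋₊ ∩ Finset.Icc 1 ⌊√y⌋₊).card : ℕ) : ℝ)
        ≤ ((Finset.Icc 1 ⌊√y⌋₊).card : ℕ) := by
          exact_mod_cast Finset.card_le_card Finset.inter_subset_right
      _ ≤ √y := by
          rw [Nat.card_Icc, Nat.add_sub_cancel]
          exact Nat.floor_le (Real.sqrt_nonneg y)
  · exact Finset.sum_le_sum_of_subset_of_nonneg
      (Finset.Icc_subset_Icc_left zero_le_one) fun _ _ _ => ArithmeticFunction.vonMangoldt_nonneg

theorem isReference_classicalPrimes : classicalPrimes.IsReference where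
  neg_eq_zero := rfl
  mobiusSum_isBigO := by
    refine ⟨1 / 2, by norm_num, sum_moebius_isBigO.congr' ?_ EventuallyEq.rfl⟩
    filter_upwards [eventually_ge_atTop 0] with x hx
    exact (mobiusSum_classicalPrimes hx).symm
  chebyshev := by
    refine IsBigO.of_bound (2 + 2 * (Real.log 4 + 4)) ?_
    filter_upwards [eventually_gt_atTop 1] with y hy
    have hl : 0 < Real.log y := Real.log_pos hy
    have hy0 : 0 < y := by linarith
    rw [Real.norm_of_nonneg measureReal_nonneg,
      Real.norm_of_nonneg (by positivity : 0 ≤ y / Real.log y)]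
    have hsqrt : √y ≤ 2 * (y / Real.log y) := by
      have h1 : Real.log (√y) ≤ √y := by
        linarith [Real.log_le_sub_one_of_pos (Real.sqrt_pos.2 hy0)]
      rw [Real.log_sqrt hy0.le] at h1
      rw [mul_div_assoc', le_div_iff₀ hl]
      nlinarith [Real.mul_self_sqrt hy0.le, Real.sqrt_nonneg y]
    have h2 : 2 / Real.log y * Chebyshev.psi y ≤ 2 / Real.log y * ((Real.log 4 + 4) * y) := by
      gcongr
      exact Chebyshev.psi_le_const_mul_self hy0.le
    have h3 : 2 / Real.log y * ((Real.log 4 + 4) * y)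
        = 2 * (Real.log 4 + 4) * (y / Real.log y) := by ring
    have h4 := classicalPrimeMeasure_Iic_le hy
    rw [add_mul]
    exact h4.trans (add_le_add hsqrt (h2.trans h3.le))
  mellin := by
    obtain ⟨K, hK0, hK⟩ := abs_log_riemannZeta_sub_le
    refine ⟨K, hK0, fun δ h0 h1 => ?_⟩
    have h := abs_le.1 (hK δ h0 h1)
    have e : ∫⁻ u, ENNReal.ofReal (u ^ (-(1 + δ))) ∂classicalPrimes.pos
        = ENNReal.ofReal (Real.log (riemannZeta ((1 + δ : ℝ) : ℂ)).re) :=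
      lintegral_rpow_classicalPrimeMeasure h0
    rw [e]
    exact ⟨ENNReal.ofReal_le_ofReal (by linarith), ENNReal.ofReal_le_ofReal (by linarith)⟩

end LSMeasure

theorem theorem1 :
    (∀ P P₀ E R : LSMeasure, LSMeasure.IsSum₃ P P₀ E R →
      (∃ a : ℝ, 0 < a ∧ P₀.mobiusSum =O[atTop] fun x : ℝ => x / Real.log x ^ a) →
      ((fun x : ℝ => E.variation.real (Icc 1 x)) =o[atTop] fun x : ℝ => x / Real.log x) →
      (∫⁻ u in Ici (1 : ℝ), ENNReal.ofReal u⁻¹ ∂(R.variation)) < ∞ →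
      P.mobiusSum =o[atTop] fun x : ℝ => x) ∧
    (∀ P₀ : LSMeasure, P₀ = classicalPrimes ∨ P₀ = logIntegral →
      ∀ P E : LSMeasure, LSMeasure.IsSum P P₀ E →
        E.neg = 0 ∨ E.pos = 0 →
        (P.primitive ~[atTop] fun x : ℝ => x / Real.log x) →
        P.mobiusSum =o[atTop] fun x : ℝ => x) := by
  refine ⟨fun P P₀ E R h ⟨a, ha, hM⟩ hE hR =>
    LSMeasure.mobiusSum_isLittleO_of_variation_isLittleO h ha hM hE hR,
    fun P₀ h₀ P E h hE hP => ?_⟩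
  have href : P₀.IsReference := by
    rcases h₀ with rfl | rfl
    · exact LSMeasure.isReference_classicalPrimes
    · exact LSMeasure.isReference_logIntegral
  exact LSMeasure.mobiusSum_isLittleO_of_monotone href h hE hP

end
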